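/- Let $0\le n\le\infty$. Let $n\text{-}\mathrm{Cat}$ be the category of small strict $n$-categories and strict $n$-functors. For $\delta=(\delta_i)_{1\le i\le n}\in(\mathbb Z/2\mathbb Z)^n$ (where $(\mathbb Z/2\mathbb Z)^\infty=\prod_{i\ge1}\mathbb Z/2\mathbb Z$), let $\mathrm{op}_\delta\colon n\text{-}\mathrm{Cat}\to n\text{-}\mathrm{Cat}$ be the functor reversing the orientation of the $i$-arrows for all $i$ with $\delta_i=1$. Let $D_k$ be the $k$-disk, the strict $\infty$-category freely generated by one $k$-arrow, and, for $j<k$, let $\sigma,\tau\colon D_j\to D_k$ be the functors picking out the $j$-dimensional source and target of the principal $k$-arrow. A table of dimensions $T$ consists of non-negative integers $k_1,\dots,k_m$ ($m\ge1$) and $k'_1,\dots,k'_{m-1}$ with $k'_i<k_i$ and $k'_i<k_{i+1}$; its height is $\max_i k_i$. Let $\Theta(T)$ be the strict $\infty$-category that is the colimit of the diagram $$D_{k_1}\xleftarrow{\ \sigma\ }D_{k'_1}\xrightarrow{\ \tau\ }D_{k_2}\xleftarrow{\ \sigma\ }\cdots\xrightarrow{\ \tau\ }D_{k_m};$$ it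 is a strict $n$-category if $T$ has height at most $n$. Joyal's category $\Theta_n$ has as objects the tables of dimensions of height at most $n$ and as morphisms $S\to T$ the strict $n$-functors $\Theta(S)\to\Theta(T)$. Let $\iota\colon\Theta_n\to n\text{-}\mathrm{Cat}$, $T\mapsto\Theta(T)$, be the resulting fully faithful functor. Let $\mathrm{Aut}(\Theta_n)$ be the category of autoequivalences of $\Theta_n$ and natural transformations, with the strict monoidal structure given by composition. Then: 1. For every $\delta\in(\mathbb Z/2\mathbb Z)^n$ there is a unique functor $P\colon\Theta_n\to\Theta_n$ with $\iota P\cong\mathrm{op}_\delta\,\iota$; it is an autoequivalence, again denoted by $\mathrm{op}_\delta$. 2. The assignment $\delta\mapsto\mathrm{op}_\delta$ defines a strict monoidal functor from the discrete category on $(\mathbb Z/2\mathbb Z)^n$, with the monoidal structure given by the group law, to $\mathrm{Aut}(\Theta_n)$, and this functor is an isomorphism of monoidal categories. 3. In particular, every autoequivalence of $\Theta_n$ is equal to $\mathrm{op}_\delta$ for a unique $\delta\in(\mathbb Z/2\mathbb Z)^n$, and the only natural transformations between autoequivalences of $\Theta_n$ are the identities. -/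

import Mathlib

open CategoryTheory MonoidalCategory

/-- A small strict `ω`-category, in the single-set presentation (Street).  The elements of `Arr` are
the arrows of all dimensions, an arrow being identified with all the iterated identities on it.
`src i` and `tgt i` are the `i`-dimensional source and target, and `comp i` is composition along
`i`-arrows, written in diagrammatic order.  The `k`-arrows are the `x` with `src k x = x`; every
arrow is a `k`-arrow for some `k`. -/
structure StrictOmegaCat where
  Arr : Type
  src : ℕ → Arr → Arr
  tgt : ℕ → Arr → Arr
  comp : ∀ (i : ℕ) (x y : Arr), tgt i x = src i y → Arr
  src_src_self : ∀ i x, src i (src i x) = src i x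
  src_tgt_self : ∀ i x, src i (tgt i x) = tgt i x
  tgt_src_self : ∀ i x, tgt i (src i x) = src i x
  tgt_tgt_self : ∀ i x, tgt i (tgt i x) = tgt i x
  src_comp_self : ∀ i x y h, src i (comp i x y h) = src i x
  tgt_comp_self : ∀ i x y h, tgt i (comp i x y h) = tgt i y
  src_comp_id : ∀ i x, comp i (src i x) x (tgt_src_self i x) = x
  comp_tgt_id : ∀ i x, comp i x (tgt i x) (src_tgt_self i x).symm = x
  assoc : ∀ i x y z hxy hyz hl hr,
    comp i (comp i x y hxy) z hl = comp i x (comp i y z hyz) hr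
  src_src_lt : ∀ i j x, i < j → src i (src j x) = src i x
  src_tgt_lt : ∀ i j x, i < j → src i (tgt j x) = src i x
  tgt_src_lt : ∀ i j x, i < j → tgt i (src j x) = tgt i x
  tgt_tgt_lt : ∀ i j x, i < j → tgt i (tgt j x) = tgt i x
  src_src_gt : ∀ i j x, i < j → src j (src i x) = src i x
  src_tgt_gt : ∀ i j x, i < j → src j (tgt i x) = tgt i x
  tgt_src_gt : ∀ i j x, i < j → tgt j (src i x) = src i x
  tgt_tgt_gt : ∀ i j x, i < j → tgt j (tgt i x) = tgt i x
  src_comp_lt : ∀ i j x y h h', i < j → src j (comp i x y h) = comp i (src j x) (src j y) h'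
  tgt_comp_lt : ∀ i j x y h h', i < j → tgt j (comp i x y h) = comp i (tgt j x) (tgt j y) h'
  interchange : ∀ i j x y z w hxy hzw hxz hyw hl hr, i < j →
    comp i (comp j x y hxy) (comp j z w hzw) hl = comp j (comp i x z hxz) (comp i y w hyw) hr
  finite_dim : ∀ x, ∃ k, src k x = x

namespace StrictOmegaCat

/-- A strict `ω`-functor. -/
@[ext]
structure Hom (C D : StrictOmegaCat) where
  toFun : C.Arr → D.Arr
  map_src : ∀ i x, toFun (C.src i x) = D.src i (toFun x)
  map_tgt : ∀ i x, toFun (C.tgt i x) = D.tgt i (toFun x)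
  map_comp : ∀ i x y h h', toFun (C.comp i x y h) = D.comp i (toFun x) (toFun y) h'

instance : Category StrictOmegaCat where
  Hom := Hom
  id C := ⟨id, fun _ _ => rfl, fun _ _ => rfl, fun _ _ _ _ _ => rfl⟩
  comp f g := ⟨g.toFun ∘ f.toFun,
    fun i x => by simp [f.map_src, g.map_src],
    fun i x => by simp [f.map_tgt, g.map_tgt],
    fun i x y h h' => by
      have h1 := congrArg f.toFun h
      rw [f.map_tgt, f.map_src] at h1
      simp only [Function.comp_apply]
      rw [f.map_comp i x y h h1, g.map_comp i _ _ h1 h']⟩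

@[simp] lemma id_toFun (C : StrictOmegaCat) (x : C.Arr) : Hom.toFun (𝟙 C) x = x := rfl

@[simp] lemma comp_toFun {C D E : StrictOmegaCat} (f : C ⟶ D) (g : D ⟶ E) (x : C.Arr) :
    Hom.toFun (f ≫ g) x = g.toFun (f.toFun x) := rfl

lemma hom_ext {C D : StrictOmegaCat} {f g : C ⟶ D} (h : ∀ x, f.toFun x = g.toFun x) : f = g :=
  Hom.ext (funext h)

/-- A strict `ω`-category is an `n`-category if all its arrows are `n`-arrows, that is, if its
`i`-arrows are identities for `i > n`. -/
def IsNCat (n : ℕ∞) : ObjectProperty StrictOmegaCat :=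
  fun C => ∀ k : ℕ, n ≤ (k : ℕ∞) → ∀ x : C.Arr, C.src k x = x

/-- The strict `ω`-category obtained from `C` by exchanging the `i`-dimensional sources and targets
(that is, reversing the orientation of the `(i+1)`-arrows) for all `i` such that `r i` holds. -/
def reverse (r : ℕ → Bool) (C : StrictOmegaCat) : StrictOmegaCat where
  Arr := C.Arr
  src i x := if r i = true then C.tgt i x else C.src i x
  tgt i x := if r i = true then C.src i x else C.tgt i x
  comp i x y h :=
    if hr : r i = true then C.comp i y x (by simpa [hr] using h.symm)
    else C.comp i x y (by simpa [hr] using h)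
  src_src_self i x := by cases hi : r i <;> simp [C.src_src_self, C.tgt_tgt_self]
  src_tgt_self i x := by cases hi : r i <;> simp [C.src_tgt_self, C.tgt_src_self]
  tgt_src_self i x := by cases hi : r i <;> simp [C.src_tgt_self, C.tgt_src_self]
  tgt_tgt_self i x := by cases hi : r i <;> simp [C.src_src_self, C.tgt_tgt_self]
  src_comp_self i x y h := by by_cases hi : r i = true <;> simp [hi, C.src_comp_self, C.tgt_comp_self]
  tgt_comp_self i x y h := by by_cases hi : r i = true <;> simp [hi, C.src_comp_self, C.tgt_comp_self]
  src_comp_id i x := by cases hi : r i <;> simp [C.src_comp_id, C.comp_tgt_id]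
  comp_tgt_id i x := by cases hi : r i <;> simp [C.src_comp_id, C.comp_tgt_id]
  assoc i x y z hxy hyz hl hr := by
    by_cases hi : r i = true
    · simp only [hi, dite_true]
      exact (C.assoc ..).symm
    · simp only [hi]
      exact C.assoc ..
  src_src_lt i j x h := by
    cases hi : r i <;> cases hj : r j <;>
      simp [C.src_src_lt i j x h, C.src_tgt_lt i j x h, C.tgt_src_lt i j x h, C.tgt_tgt_lt i j x h]
  src_tgt_lt i j x h := by
    cases hi : r i <;> cases hj : r j <;>
      simp [C.src_src_lt i j x h, C.src_tgt_lt i j x h, C.tgt_src_lt i j x h, C.tgt_tgt_lt i j x h]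
  tgt_src_lt i j x h := by
    cases hi : r i <;> cases hj : r j <;>
      simp [C.src_src_lt i j x h, C.src_tgt_lt i j x h, C.tgt_src_lt i j x h, C.tgt_tgt_lt i j x h]
  tgt_tgt_lt i j x h := by
    cases hi : r i <;> cases hj : r j <;>
      simp [C.src_src_lt i j x h, C.src_tgt_lt i j x h, C.tgt_src_lt i j x h, C.tgt_tgt_lt i j x h]
  src_src_gt i j x h := by
    cases hi : r i <;> cases hj : r j <;>
      simp [C.src_src_gt i j x h, C.src_tgt_gt i j x h, C.tgt_src_gt i j x h, C.tgt_tgt_gt i j x h]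
  src_tgt_gt i j x h := by
    cases hi : r i <;> cases hj : r j <;>
      simp [C.src_src_gt i j x h, C.src_tgt_gt i j x h, C.tgt_src_gt i j x h, C.tgt_tgt_gt i j x h]
  tgt_src_gt i j x h := by
    cases hi : r i <;> cases hj : r j <;>
      simp [C.src_src_gt i j x h, C.src_tgt_gt i j x h, C.tgt_src_gt i j x h, C.tgt_tgt_gt i j x h]
  tgt_tgt_gt i j x h := by
    cases hi : r i <;> cases hj : r j <;>
      simp [C.src_src_gt i j x h, C.src_tgt_gt i j x h, C.tgt_src_gt i j x h, C.tgt_tgt_gt i j x h]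
  src_comp_lt i j x y h h' hij := by
    by_cases hi : r i = true <;> by_cases hj : r j = true <;>
      simp only [hi, hj, dite_true, if_true] <;>
      first | exact C.src_comp_lt _ _ _ _ _ _ hij | exact C.tgt_comp_lt _ _ _ _ _ _ hij
  tgt_comp_lt i j x y h h' hij := by
    by_cases hi : r i = true <;> by_cases hj : r j = true <;>
      simp only [hi, hj, dite_true, if_true] <;>
      first | exact C.src_comp_lt _ _ _ _ _ _ hij | exact C.tgt_comp_lt _ _ _ _ _ _ hij
  interchange i j x y z w hxy hzw hxz hyw hl hr hij := by
    by_cases hi : r i = true <;> by_cases hj : r j = true <;>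
      simp only [hi, hj, dite_true] <;>
      exact C.interchange _ _ _ _ _ _ _ _ _ _ _ _ hij
  finite_dim x := by
    obtain ⟨k, hk⟩ := C.finite_dim x
    refine ⟨k, ?_⟩
    cases hi : r k
    · simpa using hk
    · have := C.tgt_src_self k x
      rw [hk] at this
      simpa using this

/-- Reversal of orientations as an endofunctor. -/
def reverseFunctor (r : ℕ → Bool) : StrictOmegaCat ⥤ StrictOmegaCat where
  obj C := C.reverse r
  map {C D} f :=
    { toFun := f.toFun
      map_src := fun i x => by
        by_cases hi : r i = true <;> simp only [reverse, hi, if_true]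
        exacts [f.map_tgt i x, f.map_src i x]
      map_tgt := fun i x => by
        by_cases hi : r i = true <;> simp only [reverse, hi, if_true]
        exacts [f.map_src i x, f.map_tgt i x]
      map_comp := fun i x y h h' => by
        by_cases hi : r i = true <;> simp only [reverse, hi, dite_true] <;>
          exact f.map_comp _ _ _ _ _ }

/-- The `k`-disk: its arrows are the principal `k`-arrow `(k, false)` and, for every `j < k`, its
iterated source `(j, false)` and its iterated target `(j, true)` of dimension `j`. -/
def disk (k : ℕ) : StrictOmegaCat where
  Arr := {p : ℕ × Bool // p.1 < k ∨ p = (k, false)}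
  src i p := if h : p.1.1 ≤ i then p else ⟨(i, false), Or.inl (by grind)⟩
  tgt i p := if h : p.1.1 ≤ i then p else ⟨(i, true), Or.inl (by grind)⟩
  comp i p q _ := if p.1.1 ≤ i then q else p
  src_src_self := by grind
  src_tgt_self := by grind
  tgt_src_self := by grind
  tgt_tgt_self := by grind
  src_comp_self := by grind
  tgt_comp_self := by grind
  src_comp_id := by grind
  comp_tgt_id := by grind
  assoc := by grind
  src_src_lt := by grind
  src_tgt_lt := by grind
  tgt_src_lt := by grind
  tgt_tgt_lt := by grind
  src_src_gt := by grind
  src_tgt_gt := by grind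
  tgt_src_gt := by grind
  tgt_tgt_gt := by grind
  src_comp_lt := by grind
  tgt_comp_lt := by grind
  interchange := by grind
  finite_dim p := ⟨p.1.1, by grind⟩

/-- For `j < k`, the morphism from the `j`-disk to the `k`-disk that sends the principal `j`-arrow
to the `j`-dimensional source (`b = false`, the morphism `σ`) or target (`b = true`, the morphism
`τ`) of the principal `k`-arrow. -/
def diskFace (b : Bool) {j k : ℕ} (hjk : j < k) : disk j ⟶ disk k where
  toFun p := if h : p.1.1 < j then ⟨p.1, Or.inl (h.trans hjk)⟩ else ⟨(j, b), Or.inl hjk⟩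
  map_src := by simp only [disk]; grind
  map_tgt := by simp only [disk]; grind
  map_comp := by simp only [disk]; grind

/-! Existence of colimits: the arrows of the colimit are the formal expressions in the arrows of the
diagram that make sense in all cocones, two of them being identified if they have the same value
in all cocones. -/

section Colimits

variable {J : Type} [SmallCategory J] (F : J ⥤ StrictOmegaCat)

/-- Formal expressions in the arrows of a diagram. -/
inductive Expr : Type
  | of (j : J) (x : (F.obj j).Arr) : Expr
  | src (i : ℕ) (a : Expr) : Expr
  | tgt (i : ℕ) (a : Expr) : Expr
  | comp (i : ℕ) (a b : Expr) : Expr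

variable {F}

/-- `Expr.Eval c a v` means that the expression `a` makes sense in the cocone `c`, with value `v`. -/
inductive Expr.Eval (c : Limits.Cocone F) : Expr F → c.pt.Arr → Prop
  | of (j x) : Expr.Eval c (.of j x) ((c.ι.app j).toFun x)
  | src (i a v) : Expr.Eval c a v → Expr.Eval c (.src i a) (c.pt.src i v)
  | tgt (i a v) : Expr.Eval c a v → Expr.Eval c (.tgt i a) (c.pt.tgt i v)
  | comp (i a b v w h) : Expr.Eval c a v → Expr.Eval c b w →
      Expr.Eval c (.comp i a b) (c.pt.comp i v w h)

lemma Expr.Eval.unique {c : Limits.Cocone F} {a : Expr F} {v w : c.pt.Arr}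
    (hv : Expr.Eval c a v) (hw : Expr.Eval c a w) : v = w := by
  induction hv generalizing w with
  | of j x => cases hw; rfl
  | src i a v _ ih => cases hw with | src _ _ _ h => rw [ih h]
  | tgt i a v _ ih => cases hw with | tgt _ _ _ h => rw [ih h]
  | comp i a b v w h _ _ iha ihb =>
    cases hw with | comp _ _ _ v' w' h' ha hb =>
      obtain rfl := iha ha
      obtain rfl := ihb hb
      rfl

/-- All arrows of the diagram that occur in the expression are `k`-arrows. -/
def Expr.Dim (k : ℕ) : Expr F → Prop
  | .of j x => (F.obj j).src k x = x
  | .src _ a => a.Dim k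
  | .tgt _ a => a.Dim k
  | .comp _ a b => a.Dim k ∧ b.Dim k

lemma tgt_eq_self {C : StrictOmegaCat} {k : ℕ} {x : C.Arr} (h : C.src k x = x) :
    C.tgt k x = x := by
  rw [← h, C.tgt_src_self]

lemma src_eq_self {C : StrictOmegaCat} {k l : ℕ} (hkl : k ≤ l) {x : C.Arr} (h : C.src k x = x) :
    C.src l x = x := by
  rcases hkl.eq_or_lt with rfl | hkl
  · exact h
  · rw [← h, C.src_src_gt k l x hkl]

lemma src_src_eq {C : StrictOmegaCat} {k : ℕ} (i : ℕ) {x : C.Arr} (h : C.src k x = x) :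
    C.src k (C.src i x) = C.src i x := by
  rcases le_total i k with hik | hik
  · exact src_eq_self hik (C.src_src_self i x)
  · rw [src_eq_self hik h, h]

lemma src_tgt_eq {C : StrictOmegaCat} {k : ℕ} (i : ℕ) {x : C.Arr} (h : C.src k x = x) :
    C.src k (C.tgt i x) = C.tgt i x := by
  rcases le_total i k with hik | hik
  · exact src_eq_self hik (C.src_tgt_self i x)
  · rw [tgt_eq_self (src_eq_self hik h), h]

lemma comp_congr {C : StrictOmegaCat} {i : ℕ} {x y x' y' : C.Arr} (hx : x = x') (hy : y = y')
    (h : C.tgt i x = C.src i y) (h' : C.tgt i x' = C.src i y') :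
    C.comp i x y h = C.comp i x' y' h' := by
  subst hx hy; rfl

lemma src_comp_eq {C : StrictOmegaCat} {k i : ℕ} {x y : C.Arr} (hx : C.src k x = x)
    (hy : C.src k y = y) (h : C.tgt i x = C.src i y) :
    C.src k (C.comp i x y h) = C.comp i x y h := by
  rcases lt_or_ge i k with hik | hik
  · rw [C.src_comp_lt i k x y h (by rw [hx, hy, h]) hik]
    exact comp_congr hx hy _ _
  · have hxy : y = C.tgt i x := by rw [h, src_eq_self hik hy]
    have : C.comp i x y h = x := (comp_congr rfl hxy _ _).trans (C.comp_tgt_id i x)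
    rw [this, hx]

lemma Expr.Eval.dim {c : Limits.Cocone F} {k : ℕ} {a : Expr F} {v : c.pt.Arr}
    (hv : Expr.Eval c a v) (ha : a.Dim k) : c.pt.src k v = v := by
  induction hv with
  | of j x => exact ((c.ι.app j).map_src k x).symm.trans (congrArg _ ha)
  | src i a v _ ih => exact src_src_eq i (ih ha)
  | tgt i a v _ ih => exact src_tgt_eq i (ih ha)
  | comp i a b v w h _ _ iha ihb => exact src_comp_eq (iha ha.1) (ihb ha.2) h

lemma Expr.Dim.mono {k l : ℕ} (hkl : k ≤ l) {a : Expr F} (ha : a.Dim k) : a.Dim l := by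
  induction a with
  | of j x => exact src_eq_self hkl ha
  | src i a ih => exact ih ha
  | tgt i a ih => exact ih ha
  | comp i a b iha ihb => exact ⟨iha ha.1, ihb ha.2⟩

lemma Expr.exists_dim (a : Expr F) : ∃ k, a.Dim k := by
  induction a with
  | of j x => exact (F.obj j).finite_dim x
  | src i a ih => exact ih
  | tgt i a ih => exact ih
  | comp i a b iha ihb =>
    obtain ⟨k, hk⟩ := iha
    obtain ⟨l, hl⟩ := ihb
    exact ⟨max k l, hk.mono (le_max_left _ _), hl.mono (le_max_right _ _)⟩

variable (F) in
/-- The expressions that make sense in all cocones. -/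
def ValidExpr : Type := {a : Expr F // ∀ c, ∃ v, Expr.Eval c a v}

noncomputable def ValidExpr.val (a : ValidExpr F) (c : Limits.Cocone F) : c.pt.Arr :=
  (a.2 c).choose

lemma ValidExpr.eval_val (a : ValidExpr F) (c : Limits.Cocone F) :
    Expr.Eval c a.1 (a.val c) := (a.2 c).choose_spec

lemma ValidExpr.val_eq (a : ValidExpr F) (c : Limits.Cocone F) {v : c.pt.Arr}
    (h : Expr.Eval c a.1 v) : a.val c = v := (a.eval_val c).unique h

variable (F) in
def exprSetoid : Setoid (ValidExpr F) where
  r a b := ∀ c, a.val c = b.val c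
  iseqv := ⟨fun _ _ => rfl, fun h c => (h c).symm, fun h h' c => (h c).trans (h' c)⟩

variable (F) in
/-- The arrows of the colimit. -/
def ColimArr : Type := Quotient (exprSetoid F)

namespace ColimArr

noncomputable def val (q : ColimArr F) (c : Limits.Cocone F) : c.pt.Arr :=
  ValidExpr.val (Quotient.out q) c

lemma ext {q q' : ColimArr F} (h : ∀ c, q.val c = q'.val c) : q = q' := by
  rw [← Quotient.out_eq q, ← Quotient.out_eq q']
  exact Quotient.sound h

def mk (a : Expr F) (h : ∀ c, ∃ v, Expr.Eval c a v) : ColimArr F :=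
  Quotient.mk (exprSetoid F) ⟨a, h⟩

lemma val_mk {a : Expr F} {h : ∀ c, ∃ v, Expr.Eval c a v} {c : Limits.Cocone F} {v : c.pt.Arr}
    (hv : Expr.Eval c a v) : (mk a h).val c = v :=
  (Quotient.exact (Quotient.out_eq (mk a h)) c).trans (ValidExpr.val_eq _ c hv)

lemma eval_out (q : ColimArr F) (c : Limits.Cocone F) : Expr.Eval c (Quotient.out q).1 (q.val c) :=
  ValidExpr.eval_val _ c

noncomputable def of (j : J) (x : (F.obj j).Arr) : ColimArr F :=
  mk (.of j x) fun _ => ⟨_, .of j x⟩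

noncomputable def src (i : ℕ) (q : ColimArr F) : ColimArr F :=
  mk (.src i (Quotient.out q).1) fun c => ⟨_, .src i _ _ (q.eval_out c)⟩

noncomputable def tgt (i : ℕ) (q : ColimArr F) : ColimArr F :=
  mk (.tgt i (Quotient.out q).1) fun c => ⟨_, .tgt i _ _ (q.eval_out c)⟩

@[simp] lemma val_of (j : J) (x : (F.obj j).Arr) (c : Limits.Cocone F) :
    (of j x).val c = (c.ι.app j).toFun x := val_mk (.of j x)

@[simp] lemma val_src (i : ℕ) (q : ColimArr F) (c : Limits.Cocone F) :
    (q.src i).val c = c.pt.src i (q.val c) := val_mk (.src i _ _ (q.eval_out c))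

@[simp] lemma val_tgt (i : ℕ) (q : ColimArr F) (c : Limits.Cocone F) :
    (q.tgt i).val c = c.pt.tgt i (q.val c) := val_mk (.tgt i _ _ (q.eval_out c))

lemma val_match {i : ℕ} {q q' : ColimArr F} (h : q.tgt i = q'.src i) (c : Limits.Cocone F) :
    c.pt.tgt i (q.val c) = c.pt.src i (q'.val c) := by
  rw [← val_tgt, h, val_src]

noncomputable def comp (i : ℕ) (q q' : ColimArr F) (h : q.tgt i = q'.src i) : ColimArr F :=
  mk (.comp i (Quotient.out q).1 (Quotient.out q').1)
    fun c => ⟨_, .comp i _ _ _ _ (val_match h c) (q.eval_out c) (q'.eval_out c)⟩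

@[simp] lemma val_comp (i : ℕ) (q q' : ColimArr F) (h : q.tgt i = q'.src i)
    (c : Limits.Cocone F) :
    (comp i q q' h).val c = c.pt.comp i (q.val c) (q'.val c) (val_match h c) :=
  val_mk (.comp i _ _ _ _ (val_match h c) (q.eval_out c) (q'.eval_out c))

lemma src_eq_self_of_dim {k : ℕ} (q : ColimArr F) (h : (Quotient.out q).1.Dim k) :
    q.src k = q :=
  ext fun c => by rw [val_src]; exact (q.eval_out c).dim h

end ColimArr

variable (F) in
/-- The colimit of a diagram of strict `ω`-categories. -/
noncomputable def colim : StrictOmegaCat where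
  Arr := ColimArr F
  src := ColimArr.src
  tgt := ColimArr.tgt
  comp := ColimArr.comp
  src_src_self _ _ := ColimArr.ext fun c => by simp [c.pt.src_src_self]
  src_tgt_self _ _ := ColimArr.ext fun c => by simp [c.pt.src_tgt_self]
  tgt_src_self _ _ := ColimArr.ext fun c => by simp [c.pt.tgt_src_self]
  tgt_tgt_self _ _ := ColimArr.ext fun c => by simp [c.pt.tgt_tgt_self]
  src_comp_self _ _ _ _ := ColimArr.ext fun c => by simp [c.pt.src_comp_self]
  tgt_comp_self _ _ _ _ := ColimArr.ext fun c => by simp [c.pt.tgt_comp_self]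
  src_comp_id _ _ := ColimArr.ext fun c => by simp [c.pt.src_comp_id]
  comp_tgt_id _ _ := ColimArr.ext fun c => by simp [c.pt.comp_tgt_id]
  assoc _ _ _ _ _ _ _ _ := ColimArr.ext fun c => by
    simp only [ColimArr.val_comp]; exact c.pt.assoc ..
  src_src_lt _ _ _ h := ColimArr.ext fun c => by simp [c.pt.src_src_lt _ _ _ h]
  src_tgt_lt _ _ _ h := ColimArr.ext fun c => by simp [c.pt.src_tgt_lt _ _ _ h]
  tgt_src_lt _ _ _ h := ColimArr.ext fun c => by simp [c.pt.tgt_src_lt _ _ _ h]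
  tgt_tgt_lt _ _ _ h := ColimArr.ext fun c => by simp [c.pt.tgt_tgt_lt _ _ _ h]
  src_src_gt _ _ _ h := ColimArr.ext fun c => by simp [c.pt.src_src_gt _ _ _ h]
  src_tgt_gt _ _ _ h := ColimArr.ext fun c => by simp [c.pt.src_tgt_gt _ _ _ h]
  tgt_src_gt _ _ _ h := ColimArr.ext fun c => by simp [c.pt.tgt_src_gt _ _ _ h]
  tgt_tgt_gt _ _ _ h := ColimArr.ext fun c => by simp [c.pt.tgt_tgt_gt _ _ _ h]
  src_comp_lt _ _ _ _ _ h' hij := ColimArr.ext fun c => by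
    have := ColimArr.val_match h' c
    simp only [ColimArr.val_comp, ColimArr.val_src] at this ⊢
    exact c.pt.src_comp_lt _ _ _ _ _ this hij
  tgt_comp_lt _ _ _ _ _ h' hij := ColimArr.ext fun c => by
    have := ColimArr.val_match h' c
    simp only [ColimArr.val_comp, ColimArr.val_tgt] at this ⊢
    exact c.pt.tgt_comp_lt _ _ _ _ _ this hij
  interchange _ _ _ _ _ _ _ _ _ _ _ _ hij := ColimArr.ext fun c => by
    simp only [ColimArr.val_comp]
    exact c.pt.interchange _ _ _ _ _ _ _ _ _ _ _ _ hij
  finite_dim q := (Quotient.out q).1.exists_dim.imp fun _ h => q.src_eq_self_of_dim h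

lemma isNCat_colim {n : ℕ∞} (h : ∀ j, IsNCat n (F.obj j)) : IsNCat n (colim F) := by
  intro k hk q
  have key : ∀ a : Expr F, a.Dim k := fun a => by
    induction a with
    | of j x => exact h j k hk x
    | src i a ih => exact ih
    | tgt i a ih => exact ih
    | comp i a b iha ihb => exact ⟨iha, ihb⟩
  exact ColimArr.src_eq_self_of_dim q (key _)

variable (F) in
noncomputable def colimCocone : Limits.Cocone F where
  pt := colim F
  ι :=
    { app := fun j =>
        { toFun := ColimArr.of j
          map_src := fun i x => ColimArr.ext fun c => by
            simp [colim, (c.ι.app j).map_src]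
          map_tgt := fun i x => ColimArr.ext fun c => by
            simp [colim, (c.ι.app j).map_tgt]
          map_comp := fun i x y h h' => ColimArr.ext fun c => by
            have hm := ColimArr.val_match h' c
            simp only [ColimArr.val_of] at hm
            refine (ColimArr.val_of j _ c).trans (((c.ι.app j).map_comp i x y h hm).trans ?_)
            refine Eq.trans ?_ (ColimArr.val_comp i _ _ h' c).symm
            exact comp_congr (ColimArr.val_of j x c).symm (ColimArr.val_of j y c).symm _ _ }
      naturality := fun j j' f => hom_ext fun x => ColimArr.ext fun c => by
        have := congrArg (fun g => Hom.toFun g x) (c.w f)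
        exact (ColimArr.val_of _ _ c).trans (this.trans (ColimArr.val_of _ _ c).symm) }

/-- The value in a given cocone, as a strict `ω`-functor. -/
noncomputable def colimDesc (c : Limits.Cocone F) : colim F ⟶ c.pt where
  toFun q := ColimArr.val q c
  map_src i q := ColimArr.val_src i q c
  map_tgt i q := ColimArr.val_tgt i q c
  map_comp i q q' h _ := ColimArr.val_comp i q q' h c

lemma colimDesc_unique (c : Limits.Cocone F) (m : colim F ⟶ c.pt)
    (hm : ∀ j x, m.toFun (ColimArr.of j x) = (c.ι.app j).toFun x) : m = colimDesc c := by
  have key : ∀ (a : Expr F) (ha : ∀ c, ∃ v, Expr.Eval c a v),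
      m.toFun (ColimArr.mk a ha) = (ColimArr.mk a ha).val c := by
    intro a
    induction a with
    | of j x => intro ha; exact (hm j x).trans (ColimArr.val_of j x c).symm
    | src i a ih =>
      intro ha
      have ha' : ∀ c, ∃ v, Expr.Eval c a v := fun c => by
        obtain ⟨_, h⟩ := ha c
        cases h with | src _ _ v h => exact ⟨v, h⟩
      have : ColimArr.mk (.src i a) ha = ColimArr.src i (ColimArr.mk a ha') :=
        ColimArr.ext fun d => by
          obtain ⟨v, hv⟩ := ha' d
          rw [ColimArr.val_src, ColimArr.val_mk hv, ColimArr.val_mk (.src i _ _ hv)]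
      rw [this, ColimArr.val_src, ← ih ha']
      exact m.map_src i _
    | tgt i a ih =>
      intro ha
      have ha' : ∀ c, ∃ v, Expr.Eval c a v := fun c => by
        obtain ⟨_, h⟩ := ha c
        cases h with | tgt _ _ v h => exact ⟨v, h⟩
      have : ColimArr.mk (.tgt i a) ha = ColimArr.tgt i (ColimArr.mk a ha') :=
        ColimArr.ext fun d => by
          obtain ⟨v, hv⟩ := ha' d
          rw [ColimArr.val_tgt, ColimArr.val_mk hv, ColimArr.val_mk (.tgt i _ _ hv)]
      rw [this, ColimArr.val_tgt, ← ih ha']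
      exact m.map_tgt i _
    | comp i a b iha ihb =>
      intro h
      have ha : ∀ c, ∃ v, Expr.Eval c a v := fun c => by
        obtain ⟨_, h⟩ := h c
        cases h with | comp _ _ _ v w _ h _ => exact ⟨v, h⟩
      have hb : ∀ c, ∃ v, Expr.Eval c b v := fun c => by
        obtain ⟨_, h⟩ := h c
        cases h with | comp _ _ _ v w _ _ h => exact ⟨w, h⟩
      have hab : (ColimArr.mk a ha).tgt i = (ColimArr.mk b hb).src i :=
        ColimArr.ext fun d => by
          obtain ⟨_, h⟩ := h d
          cases h with | comp _ _ _ v w hvw hv hw =>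
            rw [ColimArr.val_tgt, ColimArr.val_src, ColimArr.val_mk hv, ColimArr.val_mk hw, hvw]
      have : ColimArr.mk (.comp i a b) h =
          ColimArr.comp i (ColimArr.mk a ha) (ColimArr.mk b hb) hab :=
        ColimArr.ext fun d => by
          obtain ⟨_, h⟩ := h d
          cases h with | comp _ _ _ v w hvw hv hw =>
            rw [ColimArr.val_comp, ColimArr.val_mk (.comp i _ _ _ _ hvw hv hw)]
            exact comp_congr (ColimArr.val_mk hv).symm (ColimArr.val_mk hw).symm _ _
      rw [this, ColimArr.val_comp]
      have hm' : c.pt.tgt i (m.toFun (ColimArr.mk a ha)) =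
          c.pt.src i (m.toFun (ColimArr.mk b hb)) := by
        rw [iha ha, ihb hb]; exact ColimArr.val_match hab c
      exact (m.map_comp i _ _ hab hm').trans (comp_congr (iha ha) (ihb hb) _ _)
  refine hom_ext fun q => ?_
  have hq : q = ColimArr.mk (Quotient.out q).1 (Quotient.out q).2 := (Quotient.out_eq q).symm
  rw [hq]
  exact key _ _

variable (F) in
noncomputable def isColimitColimCocone : Limits.IsColimit (colimCocone F) where
  desc c := colimDesc c
  fac c j := hom_ext fun x => ColimArr.val_of j x c
  uniq c m hm := colimDesc_unique c m fun j x => congrArg (fun g => Hom.toFun g x) (hm j)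

instance : Limits.HasColimitsOfSize.{0, 0} StrictOmegaCat where
  has_colimits_of_shape _ _ :=
    { has_colimit := fun F => ⟨⟨⟨colimCocone F, isColimitColimCocone F⟩⟩⟩ }

lemma IsNCat.of_iso {n : ℕ∞} {C D : StrictOmegaCat} (e : C ≅ D) (h : IsNCat n C) :
    IsNCat n D := fun k hk x => by
  have hx : e.hom.toFun (e.inv.toFun x) = x := congrArg (fun g => Hom.toFun g x) e.inv_hom_id
  rw [← hx, ← e.hom.map_src, h k hk]

lemma isNCat_colimit {n : ℕ∞} (h : ∀ j, IsNCat n (F.obj j)) : IsNCat n (Limits.colimit F) :=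
  IsNCat.of_iso ((isColimitColimCocone F).coconePointUniqueUpToIso (Limits.colimit.isColimit F))
    (isNCat_colim h)

end Colimits

lemma isNCat_disk {n : ℕ∞} {k : ℕ} (h : (k : ℕ∞) ≤ n) : IsNCat n (disk k) := fun l hl p => by
  have : k ≤ l := by exact_mod_cast h.trans hl
  have hp := p.2
  simp only [disk]
  grind

lemma isNCat_reverse {n : ℕ∞} (r : ℕ → Bool) {C : StrictOmegaCat} (h : IsNCat n C) :
    IsNCat n (C.reverse r) := fun k hk x => by
  by_cases hr : r k = true <;> simp only [reverse, hr, if_true]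
  exacts [tgt_eq_self (h k hk x), h k hk x]

end StrictOmegaCat

/-- The category of small strict `n`-categories, `0 ≤ n ≤ ∞`, as a full subcategory of the category
of strict `ω`-categories. -/
abbrev NCat (n : ℕ∞) : Type 1 := (StrictOmegaCat.IsNCat n).FullSubcategory

/-- The group `(ℤ/2ℤ)^n`: families of elements of `ℤ/2ℤ` indexed by the integers `i ≥ 1` with
`i ≤ n`, a product over all `i ≥ 1` if `n = ∞`. -/
abbrev ZTwoPow (n : ℕ∞) : Type := {i : ℕ // 1 ≤ i ∧ (i : ℕ∞) ≤ n} → ZMod 2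

/-- The discrete category on `(ℤ/2ℤ)^n`, with the strict monoidal structure given by the group law.
(`Multiplicative` turns the additive group `(ℤ/2ℤ)^n` into a monoid written multiplicatively, so that
the tensor product is the sum in `(ℤ/2ℤ)^n`, not the product of the ring `ZMod 2`.) -/
abbrev DiscreteZTwoPow (n : ℕ∞) : Type := Discrete (Multiplicative (ZTwoPow n))

/-- An element of `(ℤ/2ℤ)^n` as an object of the discrete category. -/
abbrev ZTwoPow.toObj {n : ℕ∞} (δ : ZTwoPow n) : DiscreteZTwoPow n := ⟨Multiplicative.ofAdd δ⟩

open Classical in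
/-- Whether the orientation of the `(j+1)`-arrows is to be reversed according to `δ`. -/
noncomputable def ZTwoPow.flips {n : ℕ∞} (δ : ZTwoPow n) (j : ℕ) : Bool :=
  decide (∃ h : 1 ≤ j + 1 ∧ ((j + 1 : ℕ) : ℕ∞) ≤ n, δ ⟨j + 1, h⟩ = 1)

/-- The functor `op_δ` reversing the orientation of the `i`-arrows for all `i` such that
`δ i = 1`. -/
noncomputable def opNCat {n : ℕ∞} (δ : ZTwoPow n) : NCat n ⥤ NCat n :=
  (StrictOmegaCat.IsNCat n).lift
    ((StrictOmegaCat.IsNCat n).ι ⋙ StrictOmegaCat.reverseFunctor δ.flips)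
    (fun C => StrictOmegaCat.isNCat_reverse _ C.property)

/-- A table of dimensions: an upper row of `m = gaps + 1 ≥ 1` non-negative integers and a lower row
of `m - 1` non-negative integers, each of which is less than its two upper neighbours. -/
structure DimTable where
  gaps : ℕ
  upper : Fin (gaps + 1) → ℕ
  lower : Fin gaps → ℕ
  lower_lt_left : ∀ i, lower i < upper i.castSucc
  lower_lt_right : ∀ i, lower i < upper i.succ

namespace DimTable

/-- The greatest integer of the table (necessarily in the upper row). -/
def height (T : DimTable) : ℕ := Finset.univ.sup T.upper

/-- The diagram of disks associated to a table: the upper disks, glued along the lower disks by `σ`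
on the left and `τ` on the right. -/
def diagram (T : DimTable) :
    Limits.MultispanIndex ⟨Fin T.gaps, Fin (T.gaps + 1), Fin.castSucc, Fin.succ⟩
      StrictOmegaCat where
  left i := StrictOmegaCat.disk (T.lower i)
  right i := StrictOmegaCat.disk (T.upper i)
  fst i := StrictOmegaCat.diskFace false (T.lower_lt_left i)
  snd i := StrictOmegaCat.diskFace true (T.lower_lt_right i)

/-- The strict `ω`-category `Θ(T)` associated to a table `T`: the colimit of its diagram. -/
noncomputable def theta (T : DimTable) : StrictOmegaCat := Limits.multicoequalizer T.diagram

lemma isNCat_theta {n : ℕ∞} (T : DimTable) (h : (T.height : ℕ∞) ≤ n) :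
    StrictOmegaCat.IsNCat n T.theta := by
  have hu : ∀ i, ((T.upper i : ℕ) : ℕ∞) ≤ n := fun i =>
    le_trans (by exact_mod_cast Finset.le_sup (f := T.upper) (Finset.mem_univ i)) h
  apply StrictOmegaCat.isNCat_colimit
  rintro (i | i)
  · refine StrictOmegaCat.isNCat_disk (le_trans ?_ (hu i.castSucc))
    exact_mod_cast (T.lower_lt_left i).le
  · exact StrictOmegaCat.isNCat_disk (hu i)

end DimTable

/-- The strict `n`-category associated to a table of height at most `n`. -/
noncomputable def thetaObj (n : ℕ∞) (T : {T : DimTable // (T.height : ℕ∞) ≤ n}) : NCat n :=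
  ⟨T.1.theta, T.1.isNCat_theta T.2⟩

/-- Joyal's category `Θ_n`: its objects are the tables of dimensions of height at most `n`, and the
morphisms from `S` to `T` are the strict `n`-functors from `Θ(S)` to `Θ(T)`. -/
abbrev Theta (n : ℕ∞) : Type := InducedCategory (NCat n) (thetaObj n)

/-- The fully faithful functor from `Θ_n` to the category of strict `n`-categories. -/
noncomputable abbrev thetaIncl (n : ℕ∞) : Theta n ⥤ NCat n := inducedFunctor (thetaObj n)

section Autoequivalences

variable (C : Type*) [Category C]

attribute [local instance] endofunctorMonoidalCategory

/-- The property of being an autoequivalence. -/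
def isAutoequivalence : ObjectProperty (C ⥤ C) := fun F => F.IsEquivalence

/-- The category `Aut(C)` of autoequivalences of `C` and natural transformations. -/
abbrev AutCat := (isAutoequivalence C).FullSubcategory

instance : (isAutoequivalence C).IsMonoidal where
  prop_unit := inferInstanceAs (𝟭 C).IsEquivalence
  prop_tensor F G hF hG := by
    have : F.IsEquivalence := hF
    have : G.IsEquivalence := hG
    exact inferInstanceAs (F ⋙ G).IsEquivalence

/-- The strict monoidal structure on `Aut(C)` given by composition: `F ⊗ G` is `F ⋙ G`. -/
instance : MonoidalCategory (AutCat C) :=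
  ObjectProperty.fullMonoidalSubcategory (isAutoequivalence C)

end Autoequivalences

/-- `F` is an isomorphism of (strict) monoidal categories: it is strict monoidal, that is, it has a
monoidal structure whose structural isomorphisms are identities, and it is an isomorphism of
categories. -/
def IsMonoidalIsomorphism {C D : Type*} [Category C] [Category D] [MonoidalCategory C]
    [MonoidalCategory D] (F : C ⥤ D) : Prop :=
  (∃ _ : F.Monoidal,
    (∃ h : 𝟙_ D = F.obj (𝟙_ C), Functor.LaxMonoidal.ε F = eqToHom h) ∧
    (∀ X Y : C, ∃ h : F.obj X ⊗ F.obj Y = F.obj (X ⊗ Y),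
      Functor.LaxMonoidal.μ F X Y = eqToHom h)) ∧
  ∃ G : D ⥤ C, F ⋙ G = 𝟭 C ∧ G ⋙ F = 𝟭 D

/-!
Arrows of `Θ(T)` admit a concrete description: `Θ(T)` embeds into the product of the disks in the
upper row of `T`, as the families any two neighbouring components of which are compatible along the
disk by which they are glued (`DimTable.model`). That this subobject has the universal property of
the colimit is shown by cutting the upper row at a minimal entry of the lower row and composing the
two halves (`DimTable.exists_hom`, `DimTable.model_hom_ext`). Three facts can be read off from it.

* The indecomposable arrows are the iterated sources and targets of the principal arrows of the
  disks. An isomorphism therefore permutes the principal arrows, respecting their order and the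
  dimensions along which they are glued; so `Θ_n` is skeletal and its objects have no nontrivial
  automorphisms (`DimTable.eq_of_isIso`, `DimTable.eq_id_of_isIso`). It follows that isomorphic
  functors with values in `Θ_n` are equal, the isomorphism being the identity.
* Reversing orientations in `Θ(T)` permutes the disks and yields some `Θ(T')`
  (`DimTable.exists_reverse_iso`); so `op_δ` restricts to `Θ_n`.
* If `T` has height at most `k + 1`, arrows of `Θ(T)` with the same `k`-dimensional source and target
  are equal (`DimTable.theta_eq_of_src_eq_of_tgt_eq`).

A natural transformation between two reversals fixes the principal arrow of every disk, by induction
on the dimension, since this arrow is the only nondegenerate one with its boundary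
(`Theta.appFun_top`); hence it is an identity.

Let `P` be a fully faithful endofunctor of `Θ_n`. The disks are the objects all of whose endomorphisms
are idempotent, and their dimension is determined by the number of endomorphisms, so `P` fixes the
disks (`Theta.obj_D`). As the arrows of `X` are the morphisms from disks to `X`, this makes `P` act on
arrows, bijectively. The action preserves identities and, in each dimension separately, either
preserves or exchanges sources and targets (`Theta.exists_onArr_face`), which determines `δ`. By
induction on the dimension it is compatible with composition (`Theta.onArr_comp`): by naturality one
may consider the universal composable pair, the two arrows to be compared have the same boundary by
the induction hypothesis, and they live in some `Θ(T)` where the boundary determines them. So `P` is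
`op_δ`.
-/

/-! ### Arrows of a strict `ω`-category as images of globes -/

namespace StrictOmegaCat

variable {C D : StrictOmegaCat}

lemma src_src_of_ge {i j : ℕ} (h : j ≤ i) (x : C.Arr) : C.src i (C.src j x) = C.src j x :=
  src_eq_self h (C.src_src_self _ _)

lemma src_tgt_of_ge {i j : ℕ} (h : j ≤ i) (x : C.Arr) : C.src i (C.tgt j x) = C.tgt j x :=
  src_eq_self h (C.src_tgt_self _ _)

lemma tgt_src_of_ge {i j : ℕ} (h : j ≤ i) (x : C.Arr) : C.tgt i (C.src j x) = C.src j x :=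
  tgt_eq_self (src_src_of_ge h x)

lemma tgt_tgt_of_ge {i j : ℕ} (h : j ≤ i) (x : C.Arr) : C.tgt i (C.tgt j x) = C.tgt j x :=
  tgt_eq_self (src_tgt_of_ge h x)

lemma comp_eq_right {i : ℕ} {x y : C.Arr} (h : C.tgt i x = C.src i y) (hx : C.src i x = x) :
    C.comp i x y h = y := by
  have : x = C.src i y := by rw [← h, tgt_eq_self hx]
  exact (comp_congr this rfl _ _).trans (C.src_comp_id i y)

lemma comp_eq_left {i : ℕ} {x y : C.Arr} (h : C.tgt i x = C.src i y) (hy : C.src i y = y) :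
    C.comp i x y h = x := by
  have : y = C.tgt i x := by rw [h, hy]
  exact (comp_congr rfl this _ _).trans (C.comp_tgt_id i x)

lemma src_comp_of_lt {i j : ℕ} (hij : i < j) {x y : C.Arr} (h : C.tgt j x = C.src j y) :
    C.src i (C.comp j x y h) = C.src i x := by
  rw [← C.src_src_lt i j _ hij, C.src_comp_self, C.src_src_lt i j _ hij]

lemma tgt_comp_of_lt {i j : ℕ} (hij : i < j) {x y : C.Arr} (h : C.tgt j x = C.src j y) :
    C.tgt i (C.comp j x y h) = C.tgt i y := by
  rw [← C.tgt_tgt_lt i j _ hij, C.tgt_comp_self, C.tgt_tgt_lt i j _ hij]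

/-- The iterated source (`p.2 = false`) or target (`p.2 = true`) of `x` of dimension `p.1`.  For a
`k`-arrow `x` this is the value at `p` of the functor from the `k`-disk that corresponds to `x`. -/
def globe (x : C.Arr) (p : ℕ × Bool) : C.Arr := if p.2 = true then C.tgt p.1 x else C.src p.1 x

@[simp] lemma globe_false (x : C.Arr) (j : ℕ) : globe x (j, false) = C.src j x := by simp [globe]

@[simp] lemma globe_true (x : C.Arr) (j : ℕ) : globe x (j, true) = C.tgt j x := by simp [globe]

lemma pair_cases (p : ℕ × Bool) : p = (p.1, false) ∨ p = (p.1, true) := by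
  obtain ⟨j, b⟩ := p
  cases b <;> simp

/-- The source operation of a disk, on all pairs. -/
def pairSrc (i : ℕ) (p : ℕ × Bool) : ℕ × Bool := if p.1 ≤ i then p else (i, false)

/-- The target operation of a disk, on all pairs. -/
def pairTgt (i : ℕ) (p : ℕ × Bool) : ℕ × Bool := if p.1 ≤ i then p else (i, true)

/-- The composition of a disk, on all pairs. -/
def pairComp (i : ℕ) (p q : ℕ × Bool) : ℕ × Bool := if p.1 ≤ i then q else p

lemma globe_pairSrc (x : C.Arr) (i : ℕ) (p : ℕ × Bool) :
    globe x (pairSrc i p) = C.src i (globe x p) := by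
  obtain ⟨j, b⟩ := p
  rcases le_or_gt j i with h | h
  · cases b <;> simp [pairSrc, h, src_src_of_ge, src_tgt_of_ge]
  · cases b <;> simp [pairSrc, h.not_ge, C.src_src_lt _ _ _ h, C.src_tgt_lt _ _ _ h]

lemma globe_pairTgt (x : C.Arr) (i : ℕ) (p : ℕ × Bool) :
    globe x (pairTgt i p) = C.tgt i (globe x p) := by
  obtain ⟨j, b⟩ := p
  rcases le_or_gt j i with h | h
  · cases b <;> simp [pairTgt, h, tgt_src_of_ge, tgt_tgt_of_ge]
  · cases b <;> simp [pairTgt, h.not_ge, C.tgt_src_lt _ _ _ h, C.tgt_tgt_lt _ _ _ h]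

lemma globe_pairComp (x : C.Arr) (i : ℕ) (p q : ℕ × Bool) (h : pairTgt i p = pairSrc i q)
    (h' : C.tgt i (globe x p) = C.src i (globe x q)) :
    globe x (pairComp i p q) = C.comp i (globe x p) (globe x q) h' := by
  by_cases hp : p.1 ≤ i
  · rw [pairComp, if_pos hp, comp_eq_right]
    rw [← globe_pairSrc, pairSrc, if_pos hp]
  · have hq : q.1 ≤ i := by
      by_contra hq
      simp [pairTgt, pairSrc, hp, hq] at h
    rw [pairComp, if_neg hp, comp_eq_left]
    rw [← globe_pairSrc, pairSrc, if_pos hq]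

lemma map_globe (f : C ⟶ D) (x : C.Arr) (p : ℕ × Bool) :
    f.toFun (globe x p) = globe (f.toFun x) p := by
  obtain ⟨j, b⟩ := p
  cases b <;> simp [f.map_src, f.map_tgt]

lemma isIso_of_bijective (f : C ⟶ D) (hf : Function.Bijective f.toFun) : IsIso f := by
  obtain ⟨g, hl, hr⟩ := Function.bijective_iff_has_inverse.1 hf
  refine ⟨⟨{ toFun := g, map_src := fun i x => ?_, map_tgt := fun i x => ?_,
             map_comp := fun i x y h h' => ?_ }, ?_, ?_⟩⟩
  · exact hf.1 (by rw [hr, f.map_src, hr])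
  · exact hf.1 (by rw [hr, f.map_tgt, hr])
  · refine hf.1 ?_
    rw [hr, f.map_comp i _ _ h' (by rw [hr, hr, h])]
    exact comp_congr (hr _).symm (hr _).symm _ _
  · exact hom_ext fun x => hl x
  · exact hom_ext fun x => hr x

lemma bijective_of_isIso (f : C ⟶ D) [IsIso f] : Function.Bijective f.toFun := by
  refine Function.bijective_iff_has_inverse.2 ⟨(inv f).toFun, fun x => ?_, fun x => ?_⟩
  · exact congrArg (fun g => Hom.toFun g x) (IsIso.hom_inv_id f)
  · exact congrArg (fun g => Hom.toFun g x) (IsIso.inv_hom_id f)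

end StrictOmegaCat

/-! ### A concrete model of `Θ(T)` inside a product of disks -/

namespace DimTable

open StrictOmegaCat

/-- The compatibility of the components of an arrow of the model at two neighbouring disks glued
along an `m`-disk: below dimension `m` they agree, and otherwise their `m`-dimensional parts
run through the pair (second disk, first disk) in order.  The second disk comes first in the
diagrammatic order, since it is its target that is glued to the source of the first disk. -/
def Adj (m : ℕ) (p q : ℕ × Bool) : Prop :=
  (p = q ∧ p.1 < m) ∨
    (m ≤ p.1 ∧ m ≤ q.1 ∧ (p = (m, false) ∨ q = (m, true) ∨ (m < p.1 ∧ m < q.1)))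

lemma Adj.src {m : ℕ} {p q : ℕ × Bool} (h : Adj m p q) (i : ℕ) :
    Adj m (pairSrc i p) (pairSrc i q) := by
  unfold Adj pairSrc at *; grind

lemma Adj.tgt {m : ℕ} {p q : ℕ × Bool} (h : Adj m p q) (i : ℕ) :
    Adj m (pairTgt i p) (pairTgt i q) := by
  unfold Adj pairTgt at *; grind

lemma Adj.comp {m i : ℕ} {p q p' q' : ℕ × Bool} (h : Adj m p q) (h' : Adj m p' q')
    (hp : pairTgt i p = pairSrc i p') (hq : pairTgt i q = pairSrc i q') :
    Adj m (pairComp i p p') (pairComp i q q') := by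
  unfold Adj pairSrc pairTgt pairComp at *; grind

variable (T : DimTable)

/-- The arrows of the model: the families of arrows of the disks in the upper row such that any
two neighbours are compatible. -/
def ModelArr : Type :=
  {p : Fin (T.gaps + 1) → ℕ × Bool //
    (∀ i, (p i).1 < T.upper i ∨ p i = (T.upper i, false)) ∧
    ∀ c : Fin T.gaps, Adj (T.lower c) (p c.castSucc) (p c.succ)}

variable {T}

@[ext] lemma ModelArr.ext {p q : T.ModelArr} (h : ∀ i, p.1 i = q.1 i) : p = q :=
  Subtype.ext (funext h)

lemma ModelArr.dim_le (p : T.ModelArr) (i) : (p.1 i).1 ≤ T.upper i := by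
  rcases p.2.1 i with h | h
  exacts [h.le, by rw [h]]

/-- The componentwise source. -/
def ModelArr.src (l : ℕ) (p : T.ModelArr) : T.ModelArr :=
  ⟨fun i => pairSrc l (p.1 i),
    fun i => by have := p.2.1 i; unfold pairSrc; grind, fun c => (p.2.2 c).src l⟩

/-- The componentwise target. -/
def ModelArr.tgt (l : ℕ) (p : T.ModelArr) : T.ModelArr :=
  ⟨fun i => pairTgt l (p.1 i),
    fun i => by have := p.2.1 i; unfold pairTgt; grind, fun c => (p.2.2 c).tgt l⟩

lemma ModelArr.pair_eq {l : ℕ} {p q : T.ModelArr} (h : p.tgt l = q.src l) (i) :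
    pairTgt l (p.1 i) = pairSrc l (q.1 i) :=
  congrFun (congrArg Subtype.val h) i

/-- The componentwise composite. -/
def ModelArr.comp (l : ℕ) (p q : T.ModelArr) (h : p.tgt l = q.src l) : T.ModelArr :=
  ⟨fun i => pairComp l (p.1 i) (q.1 i),
    fun i => by have := p.2.1 i; have := q.2.1 i; unfold pairComp; grind,
    fun c => (p.2.2 c).comp (q.2.2 c) (pair_eq h _) (pair_eq h _)⟩

@[simp] lemma ModelArr.src_val (l : ℕ) (p : T.ModelArr) (i) :
    (p.src l).1 i = pairSrc l (p.1 i) := rfl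

@[simp] lemma ModelArr.tgt_val (l : ℕ) (p : T.ModelArr) (i) :
    (p.tgt l).1 i = pairTgt l (p.1 i) := rfl

@[simp] lemma ModelArr.comp_val (l : ℕ) (p q : T.ModelArr) (h) (i) :
    (p.comp l q h).1 i = pairComp l (p.1 i) (q.1 i) := rfl

variable (T) in
/-- The model of `Θ(T)`, with the componentwise operations. -/
def model : StrictOmegaCat where
  Arr := T.ModelArr
  src := ModelArr.src
  tgt := ModelArr.tgt
  comp := ModelArr.comp
  src_src_self l p := by ext1 i; simp only [ModelArr.src_val, pairSrc]; grind
  src_tgt_self l p := by ext1 i; simp only [ModelArr.src_val, ModelArr.tgt_val, pairSrc, pairTgt]; grind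
  tgt_src_self l p := by ext1 i; simp only [ModelArr.src_val, ModelArr.tgt_val, pairSrc, pairTgt]; grind
  tgt_tgt_self l p := by ext1 i; simp only [ModelArr.tgt_val, pairTgt]; grind
  src_comp_self l p q h := by
    ext1 i
    have := ModelArr.pair_eq h i
    simp only [ModelArr.src_val, ModelArr.comp_val, pairSrc, pairTgt, pairComp] at *; grind
  tgt_comp_self l p q h := by
    ext1 i
    have := ModelArr.pair_eq h i
    simp only [ModelArr.tgt_val, ModelArr.comp_val, pairSrc, pairTgt, pairComp] at *; grind
  src_comp_id l p := by
    ext1 i; simp only [ModelArr.src_val, ModelArr.comp_val, pairSrc, pairComp]; grind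
  comp_tgt_id l p := by
    ext1 i; simp only [ModelArr.tgt_val, ModelArr.comp_val, pairTgt, pairComp]; grind
  assoc l p q r hpq hqr hl hr := by
    ext1 i
    simp only [ModelArr.comp_val, pairComp]; grind
  src_src_lt l j p h := by ext1 i; simp only [ModelArr.src_val, pairSrc]; grind
  src_tgt_lt l j p h := by
    ext1 i; simp only [ModelArr.src_val, ModelArr.tgt_val, pairSrc, pairTgt]; grind
  tgt_src_lt l j p h := by
    ext1 i; simp only [ModelArr.src_val, ModelArr.tgt_val, pairSrc, pairTgt]; grind
  tgt_tgt_lt l j p h := by ext1 i; simp only [ModelArr.tgt_val, pairTgt]; grind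
  src_src_gt l j p h := by ext1 i; simp only [ModelArr.src_val, pairSrc]; grind
  src_tgt_gt l j p h := by
    ext1 i; simp only [ModelArr.src_val, ModelArr.tgt_val, pairSrc, pairTgt]; grind
  tgt_src_gt l j p h := by
    ext1 i; simp only [ModelArr.src_val, ModelArr.tgt_val, pairSrc, pairTgt]; grind
  tgt_tgt_gt l j p h := by ext1 i; simp only [ModelArr.tgt_val, pairTgt]; grind
  src_comp_lt l j p q h h' hlj := by
    ext1 i
    simp only [ModelArr.src_val, ModelArr.comp_val, pairSrc, pairComp]; grind
  tgt_comp_lt l j p q h h' hlj := by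
    ext1 i
    simp only [ModelArr.tgt_val, ModelArr.comp_val, pairTgt, pairComp]; grind
  interchange l j x y z w hxy hzw hxz hyw hl hr hlj := by
    ext1 i
    have h1 := ModelArr.pair_eq hxy i
    have h2 := ModelArr.pair_eq hzw i
    have h3 := ModelArr.pair_eq hxz i
    have h4 := ModelArr.pair_eq hyw i
    simp only [ModelArr.comp_val, pairSrc, pairTgt, pairComp] at *; grind
  finite_dim p := by
    refine ⟨Finset.univ.sup fun i => (p.1 i).1, ModelArr.ext fun i => ?_⟩
    have : (p.1 i).1 ≤ Finset.univ.sup fun i => (p.1 i).1 :=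
      Finset.le_sup (f := fun i => (p.1 i).1) (Finset.mem_univ i)
    simp only [ModelArr.src_val, pairSrc]; grind

end DimTable

/-! ### The generators of the model -/

namespace DimTable

open StrictOmegaCat

variable (T : DimTable)

/-- The lower row, extended by `0` to all natural indices. -/
def low (c : ℕ) : ℕ := if h : c < T.gaps then T.lower ⟨c, h⟩ else 0

/-- The least entry of the lower row between the `a`-th and the `b`-th entry of the upper row: the
dimension of the disk along which the `a`-th and the `b`-th disk meet. -/
noncomputable def meet (a b : ℕ) : ℕ := sInf (T.low '' Set.Ico a b)

variable {T}

@[simp] lemma low_coe (c : Fin T.gaps) : T.low c = T.lower c := by simp [low]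

lemma exists_low_eq_meet {a b : ℕ} (h : a < b) : ∃ c, a ≤ c ∧ c < b ∧ T.low c = T.meet a b := by
  obtain ⟨c, hc, h⟩ := Nat.sInf_mem (s := T.low '' Set.Ico a b) ⟨_, a, ⟨le_rfl, h⟩, rfl⟩
  exact ⟨c, hc.1, hc.2, h⟩

lemma meet_le {a b c : ℕ} (h : a ≤ c) (h' : c < b) : T.meet a b ≤ T.low c :=
  Nat.sInf_le ⟨c, ⟨h, h'⟩, rfl⟩

lemma meet_succ (a : ℕ) : T.meet a (a + 1) = T.low a := by
  obtain ⟨c, h1, h2, h3⟩ := exists_low_eq_meet (T := T) (Nat.lt_succ_self a)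
  rw [← h3]; congr 1; omega

lemma meet_eq_min {a b c : ℕ} (h : a < b) (h' : b < c) :
    T.meet a c = min (T.meet a b) (T.meet b c) := by
  obtain ⟨d, h1, h2, h3⟩ := exists_low_eq_meet (T := T) h
  obtain ⟨e, h4, h5, h6⟩ := exists_low_eq_meet (T := T) h'
  obtain ⟨f, h7, h8, h9⟩ := exists_low_eq_meet (T := T) (h.trans h')
  have i1 : T.meet a c ≤ T.low d := meet_le h1 (by omega)
  have i2 : T.meet a c ≤ T.low e := meet_le (by omega) h5
  by_cases hf : f < b
  · have i3 : T.meet a b ≤ T.low f := meet_le h7 hf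
    omega
  · have i3 : T.meet b c ≤ T.low f := meet_le (by omega) h8
    omega

lemma meet_lt_left {i j : Fin (T.gaps + 1)} (h : i < j) : T.meet i j < T.upper i := by
  have hi : (i : ℕ) < T.gaps := by omega
  have := T.lower_lt_left ⟨i, hi⟩
  have h2 : T.meet i j ≤ T.low i := meet_le le_rfl h
  rw [low, dif_pos hi] at h2
  exact h2.trans_lt this

lemma meet_lt_right {i j : Fin (T.gaps + 1)} (h : i < j) : T.meet i j < T.upper j := by
  have hj : (j : ℕ) - 1 < T.gaps := by omega
  have := T.lower_lt_right ⟨j - 1, hj⟩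
  have h2 : T.meet i j ≤ T.low (j - 1) := meet_le (by omega) (by omega)
  rw [low, dif_pos hj] at h2
  have h3 : Fin.succ ⟨(j : ℕ) - 1, hj⟩ = j := Fin.ext (by simp; omega)
  rw [h3] at this
  exact h2.trans_lt this

/-- The components of the generators of the model. -/
noncomputable def genVal (i j : Fin (T.gaps + 1)) : ℕ × Bool :=
  if i < j then (T.meet i j, true) else if j < i then (T.meet j i, false) else (T.upper i, false)

lemma genVal_self (i : Fin (T.gaps + 1)) : genVal i i = (T.upper i, false) := by simp [genVal]

lemma genVal_of_lt {i j : Fin (T.gaps + 1)} (h : i < j) : genVal i j = (T.meet i j, true) := by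
  simp [genVal, h]

lemma genVal_of_gt {i j : Fin (T.gaps + 1)} (h : j < i) : genVal i j = (T.meet j i, false) := by
  simp [genVal, h, h.not_gt]

lemma adj_genVal (i : Fin (T.gaps + 1)) (c : Fin T.gaps) :
    Adj (T.lower c) (genVal i c.castSucc) (genVal i c.succ) := by
  have hl := T.lower_lt_left c
  have hr := T.lower_lt_right c
  have hm := meet_succ (T := T) c
  rw [low_coe] at hm
  rcases lt_trichotomy i c.castSucc with h | rfl | h
  · have h' : i < c.succ := h.trans c.castSucc_lt_succ
    have := meet_eq_min (T := T) (a := i) (b := c) (c := c + 1) h (by omega)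
    rw [genVal_of_lt h, genVal_of_lt h']
    simp only [Fin.val_castSucc, Fin.val_succ]
    unfold Adj; grind
  · rw [genVal_self, genVal_of_lt c.castSucc_lt_succ]
    simp only [Fin.val_castSucc, Fin.val_succ]
    unfold Adj; grind
  · rcases (Fin.castSucc_lt_iff_succ_le.1 h).eq_or_lt with rfl | h'
    · rw [genVal_self, genVal_of_gt h]
      simp only [Fin.val_castSucc, Fin.val_succ]
      unfold Adj; grind
    · have := meet_eq_min (T := T) (a := c) (b := c + 1) (c := i) (by omega) h'
      rw [genVal_of_gt h, genVal_of_gt h']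
      simp only [Fin.val_castSucc, Fin.val_succ]
      unfold Adj; grind

/-- The principal arrow of the `i`-th disk, as an arrow of the model: its component at any other
disk is the bounding arrow of that disk by which the two disks meet. -/
noncomputable def gen (i : Fin (T.gaps + 1)) : T.model.Arr :=
  (⟨genVal i, fun j => by
    rcases lt_trichotomy i j with h | rfl | h
    · rw [genVal_of_lt h]; exact Or.inl (meet_lt_right h)
    · exact Or.inr (genVal_self _)
    · rw [genVal_of_gt h]; exact Or.inl (meet_lt_left h), adj_genVal i⟩ : T.ModelArr)

/-- The component at the `i`-th disk of an arrow of the model. -/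
def coord (p : T.model.Arr) (i : Fin (T.gaps + 1)) : ℕ × Bool := p.1 i

lemma gen_val (i j : Fin (T.gaps + 1)) : coord (gen i) j = genVal i j := rfl

@[simp] lemma model_src_val (l : ℕ) (p : T.model.Arr) (i) :
    coord (T.model.src l p) i = pairSrc l (coord p i) := rfl

@[simp] lemma model_tgt_val (l : ℕ) (p : T.model.Arr) (i) :
    coord (T.model.tgt l p) i = pairTgt l (coord p i) := rfl

@[simp] lemma model_comp_val (l : ℕ) (p q : T.model.Arr) (h) (i) :
    coord (T.model.comp l p q h) i = pairComp l (coord p i) (coord q i) := rfl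

lemma model_ext {p q : T.model.Arr} (h : ∀ i, coord p i = coord q i) : p = q := ModelArr.ext h

lemma model_pair_eq {l : ℕ} {p q : T.model.Arr} (h : T.model.tgt l p = T.model.src l q) (i) :
    pairTgt l (coord p i) = pairSrc l (coord q i) := ModelArr.pair_eq h i

lemma src_upper_gen (i : Fin (T.gaps + 1)) : T.model.src (T.upper i) (gen i) = gen i := by
  refine model_ext fun j => ?_
  rw [model_src_val, gen_val]
  rcases lt_trichotomy i j with h | rfl | h
  · rw [genVal_of_lt h, pairSrc, if_pos (meet_lt_left h).le]
  · simp [genVal_self, pairSrc]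
  · rw [genVal_of_gt h, pairSrc, if_pos (meet_lt_right h).le]

lemma src_lower_gen (c : Fin T.gaps) :
    T.model.src (T.lower c) (gen c.castSucc) = T.model.tgt (T.lower c) (gen c.succ) := by
  have hl := T.lower_lt_left c
  have hr := T.lower_lt_right c
  have hm := meet_succ (T := T) c
  rw [low_coe] at hm
  refine model_ext fun i => ?_
  rw [model_src_val, model_tgt_val, gen_val, gen_val]
  rcases lt_trichotomy i c.castSucc with h | rfl | h
  · have h' : i < c.succ := h.trans c.castSucc_lt_succ
    have := meet_eq_min (T := T) (a := i) (b := c) (c := c + 1) h (by omega)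
    rw [genVal_of_gt h, genVal_of_gt h']
    simp only [Fin.val_castSucc, Fin.val_succ]
    unfold pairSrc pairTgt; grind
  · rw [genVal_self, genVal_of_gt c.castSucc_lt_succ]
    simp only [Fin.val_castSucc, Fin.val_succ]
    unfold pairSrc pairTgt; grind
  · rcases (Fin.castSucc_lt_iff_succ_le.1 h).eq_or_lt with rfl | h'
    · rw [genVal_self, genVal_of_lt h]
      simp only [Fin.val_castSucc, Fin.val_succ]
      unfold pairSrc pairTgt; grind
    · have := meet_eq_min (T := T) (a := c) (b := c + 1) (c := i) (by omega) h'
      rw [genVal_of_lt h, genVal_of_lt h']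
      simp only [Fin.val_castSucc, Fin.val_succ]
      unfold pairSrc pairTgt; grind

/-- The projection of the model to the `i`-th disk, followed by the functor from this disk that
corresponds to an arrow of dimension at most `T.upper i`. -/
noncomputable def evalAt {E : StrictOmegaCat} (i : Fin (T.gaps + 1)) (x : E.Arr) : T.model ⟶ E where
  toFun p := globe x (coord p i)
  map_src l _ := globe_pairSrc x l _
  map_tgt l _ := globe_pairTgt x l _
  map_comp l _ _ h h' := globe_pairComp x l _ _ (model_pair_eq h i) h'

@[simp] lemma evalAt_toFun {E : StrictOmegaCat} (i : Fin (T.gaps + 1)) (x : E.Arr)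
    (p : T.model.Arr) : (evalAt i x).toFun p = globe x (coord p i) := rfl

end DimTable

/-! ### The universal property of the model -/

namespace DimTable

open StrictOmegaCat

variable {T : DimTable} {E : StrictOmegaCat}

lemma model_adj (p : T.model.Arr) (c : Fin T.gaps) :
    Adj (T.lower c) (coord p c.castSucc) (coord p c.succ) := p.2.2 c

open Classical in
/-- The value at `p` of the functor glued from `φ₁` and `φ₂` at the place `c` of the lower row:
one of the two values if the other half of `p` is a mere bounding arrow of it, and otherwise the
composite of the two values. -/
noncomputable def glueVal (c : Fin T.gaps) (φ₁ φ₂ : T.model ⟶ E) (p : T.model.Arr) : E.Arr :=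
  if coord p c.castSucc = (T.lower c, true) ∨ (coord p c.castSucc).1 < T.lower c then φ₁.toFun p
  else if coord p c.succ = (T.lower c, false) then φ₂.toFun p
  else if h : E.tgt (T.lower c) (φ₂.toFun p) = E.src (T.lower c) (φ₁.toFun p) then
    E.comp (T.lower c) (φ₂.toFun p) (φ₁.toFun p) h
  else φ₂.toFun p

/-- The conditions under which `φ₁`, depending only on the components in `L`, and `φ₂`, depending
only on the components in `R`, can be glued along the `c`-th entry of the lower row. -/
structure GlueData (c : Fin T.gaps) (φ₁ φ₂ : T.model ⟶ E) (L R : Set (Fin (T.gaps + 1)))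
    (z : E.Arr) : Prop where
  left_mem : c.castSucc ∈ L
  right_mem : c.succ ∈ R
  congr_left : ∀ p q : T.model.Arr, (∀ i ∈ L, coord p i = coord q i) → φ₁.toFun p = φ₁.toFun q
  congr_right : ∀ p q : T.model.Arr, (∀ i ∈ R, coord p i = coord q i) → φ₂.toFun p = φ₂.toFun q
  const_low : ∀ p : T.model.Arr, (coord p c.castSucc).1 < T.lower c →
    ∀ i ∈ L ∪ R, coord p i = coord p c.castSucc
  const_left : ∀ p : T.model.Arr, coord p c.castSucc = (T.lower c, false) →
    ∀ i ∈ L, coord p i = (T.lower c, false)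
  const_right : ∀ p : T.model.Arr, coord p c.succ = (T.lower c, true) →
    ∀ i ∈ R, coord p i = (T.lower c, true)
  eq_low : ∀ p : T.model.Arr, (coord p c.castSucc).1 < T.lower c → φ₁.toFun p = φ₂.toFun p
  eq_left : ∀ p : T.model.Arr, coord p c.castSucc = (T.lower c, false) → φ₁.toFun p = z
  eq_right : ∀ p : T.model.Arr, coord p c.succ = (T.lower c, true) → φ₂.toFun p = z

namespace GlueData

variable {c : Fin T.gaps} {φ₁ φ₂ : T.model ⟶ E} {L R : Set (Fin (T.gaps + 1))} {z : E.Arr}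

lemma val_left {p : T.model.Arr}
    (h : coord p c.castSucc = (T.lower c, true) ∨ (coord p c.castSucc).1 < T.lower c) :
    glueVal c φ₁ φ₂ p = φ₁.toFun p := if_pos h

lemma val_right {p : T.model.Arr} (h : coord p c.succ = (T.lower c, false)) :
    glueVal c φ₁ φ₂ p = φ₂.toFun p := by
  have h1 : ¬ (coord p c.castSucc = (T.lower c, true) ∨ (coord p c.castSucc).1 < T.lower c) := by
    have := model_adj p c
    unfold Adj at this
    grind
  rw [glueVal, if_neg h1, if_pos h]

variable (G : GlueData c φ₁ φ₂ L R z)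
include G

/-- If `p` has a proper part on both sides of `c`, the two values are composable, both boundaries
being equal to `z`. -/
lemma match_mid {p : T.model.Arr} (h1 : T.lower c ≤ (coord p c.castSucc).1)
    (h2 : coord p c.castSucc ≠ (T.lower c, true)) (h3 : coord p c.succ ≠ (T.lower c, false)) :
    E.tgt (T.lower c) (φ₂.toFun p) = E.src (T.lower c) (φ₁.toFun p) := by
  have := model_adj p c
  have := pair_cases (coord p c.castSucc)
  have := pair_cases (coord p c.succ)
  rw [← φ₁.map_src, ← φ₂.map_tgt, G.eq_left, G.eq_right]
  · simp only [model_tgt_val, pairTgt]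
    unfold Adj at *; grind
  · simp only [model_src_val, pairSrc]
    grind

lemma val_mid {p : T.model.Arr} (h1 : T.lower c ≤ (coord p c.castSucc).1)
    (h2 : coord p c.castSucc ≠ (T.lower c, true)) (h3 : coord p c.succ ≠ (T.lower c, false)) :
    glueVal c φ₁ φ₂ p =
      E.comp (T.lower c) (φ₂.toFun p) (φ₁.toFun p) (G.match_mid h1 h2 h3) := by
  rw [glueVal, if_neg (by grind), if_neg h3, dif_pos (G.match_mid h1 h2 h3)]

lemma val_congr {p q : T.model.Arr} (h : ∀ i ∈ L ∪ R, coord p i = coord q i) :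
    glueVal c φ₁ φ₂ p = glueVal c φ₁ φ₂ q := by
  have e1 := G.congr_left p q fun i hi => h i (Or.inl hi)
  have e2 := G.congr_right p q fun i hi => h i (Or.inr hi)
  have e3 := h _ (Or.inl G.left_mem)
  have e4 := h _ (Or.inr G.right_mem)
  unfold glueVal
  rw [e1, e2, e3, e4]

lemma val_src (l : ℕ) (p : T.model.Arr) :
    glueVal c φ₁ φ₂ (T.model.src l p) = E.src l (glueVal c φ₁ φ₂ p) := by
  have hadj := model_adj p c
  have := pair_cases (coord p c.castSucc)
  have := pair_cases (coord p c.succ)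
  rcases lt_or_ge l (T.lower c) with hl | hl
  · have h0 : (coord (T.model.src l p) c.castSucc).1 < T.lower c := by
      simp only [model_src_val, pairSrc]; grind
    have e := G.eq_low _ h0
    rw [val_left (Or.inr h0)]
    by_cases hL : coord p c.castSucc = (T.lower c, true) ∨ (coord p c.castSucc).1 < T.lower c
    · rw [val_left hL, φ₁.map_src]
    by_cases hR : coord p c.succ = (T.lower c, false)
    · rw [val_right hR, e, φ₂.map_src]
    · rw [G.val_mid (by grind) (by grind) hR, src_comp_of_lt hl, e, φ₂.map_src]
  · by_cases hL : coord p c.castSucc = (T.lower c, true) ∨ (coord p c.castSucc).1 < T.lower c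
    · rw [val_left hL, val_left, φ₁.map_src]
      simp only [model_src_val, pairSrc]; grind
    by_cases hR : coord p c.succ = (T.lower c, false)
    · rw [val_right hR, val_right, φ₂.map_src]
      simp only [model_src_val, pairSrc]; grind
    rw [G.val_mid (by grind) (by grind) hR]
    rcases hl.eq_or_lt with rfl | hl
    · rw [E.src_comp_self]
      by_cases hR' : coord p c.succ = (T.lower c, true)
      · rw [G.val_mid, comp_eq_left, φ₂.map_src]
        · rw [φ₁.map_src, E.src_src_self]
        all_goals simp only [model_src_val, pairSrc]; grind
      · rw [val_right, φ₂.map_src]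
        simp only [model_src_val, pairSrc]
        unfold Adj at hadj; grind
    · have h1 := G.match_mid (p := T.model.src l p)
        (by simp only [model_src_val, pairSrc]; grind)
        (by simp only [model_src_val, pairSrc]; grind)
        (by simp only [model_src_val, pairSrc]; grind)
      rw [G.val_mid, E.src_comp_lt _ _ _ _ _ _ hl]
      · exact comp_congr (φ₂.map_src _ _) (φ₁.map_src _ _) _ _
      · rw [← φ₁.map_src, ← φ₂.map_src, h1]
      all_goals simp only [model_src_val, pairSrc]; grind

lemma val_tgt (l : ℕ) (p : T.model.Arr) :
    glueVal c φ₁ φ₂ (T.model.tgt l p) = E.tgt l (glueVal c φ₁ φ₂ p) := by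
  have hadj := model_adj p c
  have := pair_cases (coord p c.castSucc)
  have := pair_cases (coord p c.succ)
  rcases lt_or_ge l (T.lower c) with hl | hl
  · have h0 : (coord (T.model.tgt l p) c.castSucc).1 < T.lower c := by
      simp only [model_tgt_val, pairTgt]; grind
    have e := G.eq_low _ h0
    rw [val_left (Or.inr h0)]
    by_cases hL : coord p c.castSucc = (T.lower c, true) ∨ (coord p c.castSucc).1 < T.lower c
    · rw [val_left hL, φ₁.map_tgt]
    by_cases hR : coord p c.succ = (T.lower c, false)
    · rw [val_right hR, e, φ₂.map_tgt]
    · rw [G.val_mid (by grind) (by grind) hR, tgt_comp_of_lt hl, φ₁.map_tgt]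
  · by_cases hL : coord p c.castSucc = (T.lower c, true) ∨ (coord p c.castSucc).1 < T.lower c
    · rw [val_left hL, val_left, φ₁.map_tgt]
      simp only [model_tgt_val, pairTgt]; grind
    by_cases hR : coord p c.succ = (T.lower c, false)
    · rw [val_right hR, val_right, φ₂.map_tgt]
      simp only [model_tgt_val, pairTgt]; grind
    rw [G.val_mid (by grind) (by grind) hR]
    rcases hl.eq_or_lt with rfl | hl
    · rw [E.tgt_comp_self]
      by_cases hL' : coord p c.castSucc = (T.lower c, false)
      · rw [G.val_mid, comp_eq_right, φ₁.map_tgt]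
        · rw [φ₂.map_tgt, E.src_tgt_self]
        all_goals simp only [model_tgt_val, pairTgt]; unfold Adj at hadj; grind
      · rw [val_left, φ₁.map_tgt]
        simp only [model_tgt_val, pairTgt]
        unfold Adj at hadj; grind
    · have h1 := G.match_mid (p := T.model.tgt l p)
        (by simp only [model_tgt_val, pairTgt]; grind)
        (by simp only [model_tgt_val, pairTgt]; grind)
        (by simp only [model_tgt_val, pairTgt]; grind)
      rw [G.val_mid, E.tgt_comp_lt _ _ _ _ _ _ hl]
      · exact comp_congr (φ₂.map_tgt _ _) (φ₁.map_tgt _ _) _ _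
      · rw [← φ₁.map_tgt, ← φ₂.map_tgt, h1]
      all_goals simp only [model_tgt_val, pairTgt]; grind

/-- If the first arrow has dimension at most `l` at all relevant components, composition along
`l`-arrows is trivial. -/
lemma val_comp_left {l : ℕ} {p q : T.model.Arr} (h : T.model.tgt l p = T.model.src l q)
    (h' : E.tgt l (glueVal c φ₁ φ₂ p) = E.src l (glueVal c φ₁ φ₂ q))
    (hp : ∀ i ∈ L ∪ R, (coord p i).1 ≤ l) :
    glueVal c φ₁ φ₂ (T.model.comp l p q h) =
      E.comp l (glueVal c φ₁ φ₂ p) (glueVal c φ₁ φ₂ q) h' := by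
  rw [comp_eq_right h']
  · refine G.val_congr fun i hi => ?_
    rw [model_comp_val, pairComp, if_pos (hp i hi)]
  · rw [← G.val_src]
    refine G.val_congr fun i hi => ?_
    rw [model_src_val, pairSrc, if_pos (hp i hi)]

lemma val_comp_right {l : ℕ} {p q : T.model.Arr} (h : T.model.tgt l p = T.model.src l q)
    (h' : E.tgt l (glueVal c φ₁ φ₂ p) = E.src l (glueVal c φ₁ φ₂ q))
    (hq : ∀ i ∈ L ∪ R, (coord q i).1 ≤ l) :
    glueVal c φ₁ φ₂ (T.model.comp l p q h) =
      E.comp l (glueVal c φ₁ φ₂ p) (glueVal c φ₁ φ₂ q) h' := by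
  rw [comp_eq_left h']
  · refine G.val_congr fun i hi => ?_
    have := model_pair_eq h i
    have := hq i hi
    simp only [model_comp_val, pairComp, pairSrc, pairTgt] at *
    grind
  · rw [← G.val_src]
    refine G.val_congr fun i hi => ?_
    rw [model_src_val, pairSrc, if_pos (hq i hi)]

/-- Gluing is compatible with composition along `l`-arrows. Below the dimension `T.lower c` one of the
two arrows is an identity; in this dimension the assertion reduces to associativity, and above it to
the interchange law. -/
lemma val_comp (l : ℕ) (p q : T.model.Arr) (h : T.model.tgt l p = T.model.src l q)
    (h' : E.tgt l (glueVal c φ₁ φ₂ p) = E.src l (glueVal c φ₁ φ₂ q)) :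
    glueVal c φ₁ φ₂ (T.model.comp l p q h) =
      E.comp l (glueVal c φ₁ φ₂ p) (glueVal c φ₁ φ₂ q) h' := by
  have hp := model_adj p c
  have hq := model_adj q c
  have := pair_cases (coord p c.castSucc)
  have := pair_cases (coord p c.succ)
  have := pair_cases (coord q c.castSucc)
  have := pair_cases (coord q c.succ)
  have hL := model_pair_eq h c.castSucc
  have hR := model_pair_eq h c.succ
  have m1 : E.tgt l (φ₁.toFun p) = E.src l (φ₁.toFun q) := by
    rw [← φ₁.map_src, ← φ₁.map_tgt, h]
  have m2 : E.tgt l (φ₂.toFun p) = E.src l (φ₂.toFun q) := by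
    rw [← φ₂.map_src, ← φ₂.map_tgt, h]
  unfold pairSrc pairTgt at hL hR
  by_cases hp0 : (coord p c.castSucc).1 < T.lower c
  · by_cases hpl : (coord p c.castSucc).1 ≤ l
    · exact G.val_comp_left h h' fun i hi => by rwa [G.const_low p hp0 i hi]
    · have : (coord q c.castSucc).1 ≤ l := by grind
      refine G.val_comp_right h h' fun i hi => ?_
      rwa [G.const_low q (by omega) i hi]
  by_cases hlm : l < T.lower c
  · have : (coord q c.castSucc).1 ≤ l := by grind
    refine G.val_comp_right h h' fun i hi => ?_
    rwa [G.const_low q (by omega) i hi]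
  -- the first arrow lies in the left half
  by_cases hp1 : coord p c.castSucc = (T.lower c, true)
  · have hq1 : coord q c.castSucc = (T.lower c, true) := by grind
    rw [val_left, φ₁.map_comp l p q h m1]
    · exact comp_congr (val_left (Or.inl hp1)).symm (val_left (Or.inl hq1)).symm _ _
    · rw [model_comp_val, pairComp]; grind
  -- the first arrow lies in the right half
  by_cases hp2 : coord p c.succ = (T.lower c, false)
  · have hp2' : coord p c.castSucc = (T.lower c, false) := by unfold Adj at hp; grind
    by_cases hq2 : coord q c.succ = (T.lower c, false)
    · rw [val_right, φ₂.map_comp l p q h m2]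
      · exact comp_congr (val_right hp2).symm (val_right hq2).symm _ _
      · rw [model_comp_val, pairComp]; grind
    · obtain rfl : l = T.lower c := by grind
      have hq1 : T.lower c ≤ (coord q c.castSucc).1 := by grind
      have hq3 : coord q c.castSucc ≠ (T.lower c, true) := by grind
      have e : φ₁.toFun (T.model.comp (T.lower c) p q h) = φ₁.toFun q :=
        G.congr_left _ _ fun i hi => by
          rw [model_comp_val, pairComp, if_pos (by rw [G.const_left p hp2' i hi])]
      have k := G.match_mid hq1 hq3 hq2
      rw [G.val_mid]
      · refine (comp_congr (φ₂.map_comp _ p q h m2) e _ ?_).trans ?_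
        · rw [E.tgt_comp_self, k]
        refine (E.assoc _ _ _ _ m2 k _ ?_).trans ?_
        · rw [m2, E.src_comp_self]
        exact comp_congr (val_right hp2).symm (G.val_mid hq1 hq3 hq2).symm _ _
      all_goals rw [model_comp_val, pairComp]; grind
  -- the first arrow has a proper part in both halves
  have kp := G.match_mid (by omega) hp1 hp2
  rcases eq_or_ne l (T.lower c) with rfl | hlm'
  · have hq2 : coord q c.succ = (T.lower c, true) := by unfold Adj at hp; grind
    have e2 : φ₂.toFun (T.model.comp (T.lower c) p q h) = φ₂.toFun p :=
      G.congr_right _ _ fun i hi => by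
        have h1 := G.const_right q hq2 i hi
        have h2 := model_pair_eq h i
        simp only [model_comp_val, pairComp, pairSrc, pairTgt] at *
        grind
    have hcomp := G.val_mid (p := T.model.comp (T.lower c) p q h)
      (by rw [model_comp_val, pairComp]; grind) (by rw [model_comp_val, pairComp]; grind)
      (by rw [model_comp_val, pairComp]; unfold Adj at hp; grind)
    have hz : E.src (T.lower c) (φ₂.toFun q) = φ₂.toFun q := by
      rw [← φ₂.map_src]
      refine G.congr_right _ _ fun i hi => ?_
      rw [model_src_val, G.const_right q hq2 i hi, pairSrc, if_pos le_rfl]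
    rw [hcomp]
    by_cases hp3 : coord p c.castSucc = (T.lower c, false)
    · have hq1 : T.lower c ≤ (coord q c.castSucc).1 := by grind
      have hq3 : coord q c.castSucc ≠ (T.lower c, true) := by grind
      have hq4 : coord q c.succ ≠ (T.lower c, false) := by grind
      have e1 : φ₁.toFun (T.model.comp (T.lower c) p q h) = φ₁.toFun q :=
        G.congr_left _ _ fun i hi => by
          rw [model_comp_val, pairComp, if_pos (by rw [G.const_left p hp3 i hi])]
      have hz' : E.src (T.lower c) (φ₁.toFun p) = φ₁.toFun p := by
        rw [← φ₁.map_src]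
        refine G.congr_left _ _ fun i hi => ?_
        rw [model_src_val, G.const_left p hp3 i hi, pairSrc, if_pos le_rfl]
      refine comp_congr ?_ ?_ _ _
      · rw [e2, G.val_mid (by omega) hp1 hp2, comp_eq_left _ hz']
      · rw [e1, G.val_mid hq1 hq3 hq4, comp_eq_right _ hz]
    · have hq1 : coord q c.castSucc = (T.lower c, true) := by unfold Adj at hp; grind
      refine (comp_congr e2 (φ₁.map_comp _ p q h m1) _ ?_).trans ?_
      · rw [E.src_comp_self, kp]
      refine (E.assoc _ _ _ _ kp m1 ?_ _).symm.trans ?_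
      · rw [E.tgt_comp_self, m1]
      exact comp_congr (G.val_mid (by omega) hp1 hp2).symm (val_left (Or.inl hq1)).symm _ _
  · have hlm2 : T.lower c < l := by omega
    have hq1 : T.lower c ≤ (coord q c.castSucc).1 := by grind
    have hq3 : coord q c.castSucc ≠ (T.lower c, true) := by grind
    have hq4 : coord q c.succ ≠ (T.lower c, false) := by grind
    have kq := G.match_mid hq1 hq3 hq4
    have hc := G.val_mid (p := T.model.comp l p q h)
      (by rw [model_comp_val, pairComp]; grind) (by rw [model_comp_val, pairComp]; grind)
      (by rw [model_comp_val, pairComp]; grind)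
    have kc := G.match_mid (p := T.model.comp l p q h)
      (by rw [model_comp_val, pairComp]; grind) (by rw [model_comp_val, pairComp]; grind)
      (by rw [model_comp_val, pairComp]; grind)
    rw [φ₂.map_comp l p q h m2, φ₁.map_comp l p q h m1] at kc
    have h'' := h'
    rw [G.val_mid (by omega) hp1 hp2, G.val_mid hq1 hq3 hq4] at h''
    rw [hc]
    refine (comp_congr (φ₂.map_comp l p q h m2) (φ₁.map_comp l p q h m1) _ kc).trans ?_
    refine (E.interchange _ _ _ _ _ _ m2 m1 kp kq kc h'' hlm2).trans ?_
    exact comp_congr (G.val_mid (by omega) hp1 hp2).symm (G.val_mid hq1 hq3 hq4).symm _ _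

/-- The functor glued from `φ₁` and `φ₂`. -/
noncomputable def hom : T.model ⟶ E where
  toFun := glueVal c φ₁ φ₂
  map_src := G.val_src
  map_tgt := G.val_tgt
  map_comp := G.val_comp

end GlueData

end DimTable

namespace DimTable

open StrictOmegaCat

variable {T : DimTable} {E : StrictOmegaCat}

/-- Induction to the right along the upper row. -/
lemma forall_of_step_right {Q : Fin (T.gaps + 1) → Prop} (a : Fin (T.gaps + 1)) (b : ℕ) (h0 : Q a)
    (step : ∀ d : Fin T.gaps, (a : ℕ) ≤ d → (d : ℕ) < b → Q d.castSucc → Q d.succ)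
    (i : Fin (T.gaps + 1)) (hai : a ≤ i) (hib : (i : ℕ) ≤ b) : Q i := by
  obtain ⟨i, hi⟩ := i
  have hai : (a : ℕ) ≤ i := hai
  induction i, hai using Nat.le_induction with
  | base => exact h0
  | succ n hn ih =>
    exact step ⟨n, by omega⟩ hn (by simpa using hib) (ih (by omega) hn (by simp at hib ⊢; omega))

/-- Induction to the left along the upper row. -/
lemma forall_of_step_left {Q : Fin (T.gaps + 1) → Prop} (a : ℕ) (b : Fin (T.gaps + 1)) (h0 : Q b)
    (step : ∀ d : Fin T.gaps, a ≤ d → (d : ℕ) < b → Q d.succ → Q d.castSucc)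
    (i : Fin (T.gaps + 1)) (hai : a ≤ i) (hib : i ≤ b) : Q i := by
  obtain ⟨n, hn⟩ : ∃ n, (b : ℕ) = i + n := ⟨b - i, by omega⟩
  induction n generalizing i with
  | zero =>
    obtain rfl : i = b := Fin.ext (by omega)
    exact h0
  | succ n ih =>
    have hi : (i : ℕ) < T.gaps := by omega
    exact step ⟨i, hi⟩ hai (by simp; omega)
      (ih (Fin.succ ⟨i, hi⟩) (by simp; omega) (by rw [Fin.le_def]; simp; omega) (by simp; omega))

/-- An arrow of dimension less than the entries of the lower row between `a` and `b` has constant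
components there. -/
lemma coord_eq_of_lt {m a b : ℕ} (p : T.model.Arr)
    (hm : ∀ d : Fin T.gaps, a ≤ d → (d : ℕ) < b → m ≤ T.lower d)
    (i j : Fin (T.gaps + 1)) (hai : a ≤ i) (hib : (i : ℕ) ≤ b) (haj : a ≤ j) (hjb : (j : ℕ) ≤ b)
    (h : (coord p i).1 < m) : coord p j = coord p i := by
  rcases le_total i j with hij | hji
  · refine forall_of_step_right (Q := fun j => coord p j = coord p i) i b rfl
      (fun d h1 h2 h3 => ?_) j hij hjb
    have h4 := hm d (by omega) h2
    have := model_adj p d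
    unfold Adj at this; grind
  · refine forall_of_step_left (Q := fun j => coord p j = coord p i) a i rfl
      (fun d h1 h2 h3 => ?_) j haj hji
    have h4 := hm d h1 (by omega)
    have := model_adj p d
    unfold Adj at this; grind

/-- Existence in the universal property of a part of the model: the universal property is proved by
splitting the table at the least entries of the lower row. -/
lemma exists_hom_interval (x : Fin (T.gaps + 1) → E.Arr)
    (hx : ∀ i, E.src (T.upper i) (x i) = x i)
    (hg : ∀ c : Fin T.gaps,
      E.src (T.lower c) (x c.castSucc) = E.tgt (T.lower c) (x c.succ)) (n : ℕ) :
    ∀ a b : Fin (T.gaps + 1), a ≤ b → (b : ℕ) - a = n → ∃ φ : T.model ⟶ E,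
      (∀ i, a ≤ i → i ≤ b → φ.toFun (gen i) = x i) ∧
      ∀ p q : T.model.Arr, (∀ i ∈ Set.Icc a b, coord p i = coord q i) → φ.toFun p = φ.toFun q := by
  induction n using Nat.strong_induction_on with
  | _ n ih =>
  intro a b hab hn
  rcases hab.eq_or_lt with rfl | hab
  · refine ⟨evalAt a (x a), fun i h1 h2 => ?_, fun p q h => ?_⟩
    · obtain rfl : i = a := le_antisymm h2 h1
      rw [evalAt_toFun, gen_val, genVal_self, globe_false, hx]
    · rw [evalAt_toFun, evalAt_toFun, h a ⟨le_rfl, le_rfl⟩]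
  obtain ⟨c', hac, hcb, hc⟩ := exists_low_eq_meet (T := T) hab
  have hcg : c' < T.gaps := by omega
  obtain ⟨c, rfl⟩ : ∃ c : Fin T.gaps, (c : ℕ) = c' := ⟨⟨c', hcg⟩, rfl⟩
  have hmin : ∀ d : Fin T.gaps, (a : ℕ) ≤ d → (d : ℕ) < b → T.lower c ≤ T.lower d :=
    fun d h1 h2 => by rw [← low_coe, ← low_coe, hc]; exact meet_le h1 h2
  have hac' : a ≤ c.castSucc := by rw [Fin.le_def]; simpa using hac
  have hcb' : c.succ ≤ b := by rw [Fin.le_def]; simpa using hcb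
  obtain ⟨φ₁, hφ₁, hc₁⟩ := ih (c - a) (by omega) a c.castSucc hac' (by simp)
  obtain ⟨φ₂, hφ₂, hc₂⟩ := ih (b - (c + 1)) (by omega) c.succ b hcb' (by simp)
  have hL : φ₁.toFun (gen c.castSucc) = x c.castSucc := hφ₁ _ hac' le_rfl
  have hR : φ₂.toFun (gen c.succ) = x c.succ := hφ₂ _ le_rfl hcb'
  have gL : coord (gen c.castSucc) c.castSucc = (T.upper c.castSucc, false) := genVal_self _
  have gR : coord (gen c.succ) c.succ = (T.upper c.succ, false) := genVal_self _
  have hlL := T.lower_lt_left c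
  have hlR := T.lower_lt_right c
  have hleft : ∀ p : T.model.Arr, coord p c.castSucc = (T.lower c, false) →
      ∀ i ∈ Set.Icc a c.castSucc, coord p i = (T.lower c, false) := fun p hp i hi => by
    refine forall_of_step_left (Q := fun j => coord p j = (T.lower c, false)) a c.castSucc hp
      (fun d h1 h2 h3 => ?_) i hi.1 hi.2
    have h4 := hmin d h1 (by simp at h2; omega)
    have := model_adj p d
    have := pair_cases (coord p d.castSucc)
    unfold Adj at *; grind
  have hright : ∀ p : T.model.Arr, coord p c.succ = (T.lower c, true) →
      ∀ i ∈ Set.Icc c.succ b, coord p i = (T.lower c, true) := fun p hp i hi => by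
    refine forall_of_step_right (Q := fun j => coord p j = (T.lower c, true)) c.succ b hp
      (fun d h1 h2 h3 => ?_) i hi.1 hi.2
    have h4 := hmin d (by simp at h1; omega) h2
    have := model_adj p d
    have := pair_cases (coord p d.succ)
    unfold Adj at *; grind
  have hlow : ∀ p : T.model.Arr, (coord p c.castSucc).1 < T.lower c →
      ∀ i, a ≤ i → i ≤ b → coord p i = coord p c.castSucc := fun p hp i h1 h2 =>
    coord_eq_of_lt (m := T.lower c) (a := a) (b := b) p hmin _ _ hac (by simp; omega) h1 h2 hp
  have G : GlueData c φ₁ φ₂ (Set.Icc a c.castSucc) (Set.Icc c.succ b)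
      (E.src (T.lower c) (x c.castSucc)) := by
    refine ⟨⟨hac', le_rfl⟩, ⟨le_rfl, hcb'⟩, hc₁, hc₂, fun p hp i hi => ?_, hleft, hright,
      fun p hp => ?_, fun p hp => ?_, fun p hp => ?_⟩
    · rcases hi with hi | hi
      · exact hlow p hp i hi.1 (hi.2.trans (c.castSucc_lt_succ.le.trans hcb'))
      · exact hlow p hp i (hac'.trans (c.castSucc_lt_succ.le.trans hi.1)) hi.2
    · -- both values are the same bounding arrow of the common boundary of the glued disks
      have e1 : φ₁.toFun p = globe (x c.castSucc) (coord p c.castSucc) := by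
        rw [← hL, ← map_globe]
        refine hc₁ _ _ fun i hi => ?_
        rw [hlow p hp i hi.1 (hi.2.trans (c.castSucc_lt_succ.le.trans hcb'))]
        have h1 : coord (globe (gen c.castSucc) (coord p c.castSucc)) c.castSucc =
            coord p c.castSucc := by
          rcases pair_cases (coord p c.castSucc) with h | h <;> rw [h]
          · rw [globe_false, model_src_val, gL, pairSrc, if_neg (by simp; omega)]
          · rw [globe_true, model_tgt_val, gL, pairTgt, if_neg (by simp; omega)]
        conv_lhs => rw [← h1]
        exact (coord_eq_of_lt (m := T.lower c) (a := a) (b := b) _ hmin c.castSucc i hac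
          (by simp; omega) hi.1 (hi.2.trans (c.castSucc_lt_succ.le.trans hcb'))
          (by rwa [h1])).symm
      have e2 : φ₂.toFun p = globe (x c.succ) (coord p c.castSucc) := by
        have hp' : coord p c.succ = coord p c.castSucc :=
          hlow p hp _ (hac'.trans c.castSucc_lt_succ.le) hcb'
        rw [← hR, ← map_globe]
        refine hc₂ _ _ fun i hi => ?_
        rw [hlow p hp i (hac'.trans (c.castSucc_lt_succ.le.trans hi.1)) hi.2]
        have h1 : coord (globe (gen c.succ) (coord p c.castSucc)) c.succ =
            coord p c.castSucc := by
          rcases pair_cases (coord p c.castSucc) with h | h <;> rw [h]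
          · rw [globe_false, model_src_val, gR, pairSrc, if_neg (by simp; omega)]
          · rw [globe_true, model_tgt_val, gR, pairTgt, if_neg (by simp; omega)]
        conv_lhs => rw [← h1]
        exact (coord_eq_of_lt (m := T.lower c) (a := a) (b := b) _ hmin c.succ i
          (by simp; omega) (by simp; omega)
          (hac'.trans (c.castSucc_lt_succ.le.trans hi.1)) hi.2 (by rwa [h1])).symm
      rw [e1, e2]
      rcases pair_cases (coord p c.castSucc) with h | h <;> rw [h]
      · rw [globe_false, globe_false, ← E.src_src_lt _ _ _ hp, hg, E.src_tgt_lt _ _ _ hp]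
      · rw [globe_true, globe_true, ← E.tgt_src_lt _ _ _ hp, hg, E.tgt_tgt_lt _ _ _ hp]
    · rw [← hL, ← φ₁.map_src]
      refine hc₁ _ _ fun i hi => ?_
      rw [hleft p hp i hi, hleft _ _ i hi]
      rw [model_src_val, gL, pairSrc, if_neg (by simp; omega)]
    · rw [hg, ← hR, ← φ₂.map_tgt]
      refine hc₂ _ _ fun i hi => ?_
      rw [hright p hp i hi, hright _ _ i hi]
      rw [model_tgt_val, gR, pairTgt, if_neg (by simp; omega)]
  have hcm := meet_succ (T := T) c
  rw [low_coe] at hcm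
  refine ⟨G.hom, fun i h1 h2 => ?_, fun p q h => ?_⟩
  · rcases lt_or_ge c.castSucc i with hi | hi
    · have hv : (coord (gen i) c.castSucc) = (T.lower c, false) := by
        rw [gen_val, genVal_of_gt hi]
        obtain ⟨d, h3, h4, h5⟩ := exists_low_eq_meet (T := T) (show (c.castSucc : ℕ) < i from hi)
        have h6 := hmin ⟨d, by omega⟩ (by simp at h3 ⊢; omega) (by simp at h4 ⊢; omega)
        have h7 : T.meet c.castSucc i ≤ T.low c := meet_le le_rfl hi
        rw [low_coe] at h7
        rw [← low_coe ⟨d, by omega⟩] at h6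
        simp only [Fin.val_castSucc] at *
        rw [show T.meet c i = T.lower c by omega]
      have hs : c.succ ≤ i := Fin.castSucc_lt_iff_succ_le.1 hi
      by_cases hQ : coord (gen i) c.succ = (T.lower c, false)
      · exact (GlueData.val_right hQ).trans (hφ₂ i hs h2)
      · refine (G.val_mid (by rw [hv]) (by rw [hv]; simp) hQ).trans ?_
        rw [comp_eq_left]
        · exact hφ₂ i hs h2
        · rw [G.eq_left _ hv, E.src_src_self]
    · have hv : T.meet i c.succ = T.lower c := by
        obtain ⟨d, h3, h4, h5⟩ := exists_low_eq_meet (T := T) (a := i) (b := c.succ)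
          (by simp [Fin.le_def] at hi ⊢; omega)
        have h6 := hmin ⟨d, by omega⟩ (by simp at h3 ⊢; omega) (by simp at h4 ⊢; omega)
        have h7 : T.meet i c.succ ≤ T.low c := meet_le hi (by simp)
        rw [low_coe] at h7
        rw [← low_coe ⟨d, by omega⟩] at h6
        simp only [Fin.val_succ] at *
        omega
      have hv' : coord (gen i) c.succ = (T.lower c, true) := by
        rw [gen_val, genVal_of_lt (hi.trans_lt c.castSucc_lt_succ), hv]
      by_cases hP : coord (gen i) c.castSucc = (T.lower c, true) ∨
          (coord (gen i) c.castSucc).1 < T.lower c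
      · exact (GlueData.val_left hP).trans (hφ₁ i h1 hi)
      · refine (G.val_mid (by grind) (by grind) (by rw [hv']; simp)).trans ?_
        rw [comp_eq_right]
        · exact hφ₁ i h1 hi
        · rw [G.eq_right _ hv', E.src_src_self]
  · refine G.val_congr fun i hi => h i ?_
    rcases hi with hi | hi
    · exact ⟨hi.1, hi.2.trans (c.castSucc_lt_succ.le.trans hcb')⟩
    · exact ⟨hac'.trans (c.castSucc_lt_succ.le.trans hi.1), hi.2⟩

/-- A family of arrows of the right dimensions with matching sources and targets extends to a
functor on the model. -/
lemma exists_hom (x : Fin (T.gaps + 1) → E.Arr)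
    (hx : ∀ i, E.src (T.upper i) (x i) = x i)
    (hg : ∀ c : Fin T.gaps,
      E.src (T.lower c) (x c.castSucc) = E.tgt (T.lower c) (x c.succ)) :
    ∃ φ : T.model ⟶ E, ∀ i, φ.toFun (gen i) = x i := by
  obtain ⟨φ, h, -⟩ := exists_hom_interval x hx hg _ 0 (Fin.last _) (Fin.zero_le _) rfl
  exact ⟨φ, fun i => h i (Fin.zero_le _) (Fin.le_last _)⟩

end DimTable

/-! ### Indecomposable arrows and generation of the model -/

namespace StrictOmegaCat

/-- An arrow is indecomposable if it is not the composite of two other arrows. -/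
def IsIndecomposable {C : StrictOmegaCat} (x : C.Arr) : Prop :=
  ∀ l a b h, C.comp l a b h = x → a = x ∨ b = x

end StrictOmegaCat

namespace DimTable

open StrictOmegaCat

variable {T : DimTable} {E : StrictOmegaCat}

lemma coord_dim_le (p : T.model.Arr) (i) : (coord p i).1 ≤ T.upper i := ModelArr.dim_le p i

lemma coord_lt_or_eq (p : T.model.Arr) (i) :
    (coord p i).1 < T.upper i ∨ coord p i = (T.upper i, false) := p.2.1 i

lemma coord_globe (p : T.model.Arr) (q : ℕ × Bool) (i) :
    coord (globe p q) i = if q.2 = true then pairTgt q.1 (coord p i) else pairSrc q.1 (coord p i) := by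
  obtain ⟨j, b⟩ := q
  cases b <;> simp

/-- Every arrow of the model is the composite along the disk in the `c`-th place of the lower row
of its part on the right of `c`, whiskered by a source on the left, and its part on the left
of `c`, whiskered by a target on the right. -/
lemma exists_cut (p : T.model.Arr) (c : Fin T.gaps) :
    ∃ a b h, T.model.comp (T.lower c) a b h = p ∧
      (∀ i ≤ c.castSucc, coord a i = pairSrc (T.lower c) (coord p i)) ∧
      (∀ i ≥ c.succ, coord b i = pairTgt (T.lower c) (coord p i)) := by
  let a : T.model.Arr := (⟨fun i => if i ≤ c.castSucc then pairSrc (T.lower c) (coord p i)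
      else coord p i, fun i => by
        have := coord_lt_or_eq p i
        unfold pairSrc; grind, fun d => by
        have hd := model_adj p d
        beta_reduce
        rcases lt_trichotomy d c with h | rfl | h
        · rw [if_pos (by simpa using h.le), if_pos (by rw [Fin.le_def]; simp; omega)]
          exact hd.src _
        · rw [if_pos le_rfl, if_neg (by simp)]
          unfold Adj pairSrc at *; grind
        · rw [if_neg (by simpa using h), if_neg (by rw [Fin.le_def]; simp; omega)]
          exact hd⟩ : T.ModelArr)
  let b : T.model.Arr := (⟨fun i => if i ≤ c.castSucc then coord p i
      else pairTgt (T.lower c) (coord p i), fun i => by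
        have := coord_lt_or_eq p i
        unfold pairTgt; grind, fun d => by
        have hd := model_adj p d
        beta_reduce
        rcases lt_trichotomy d c with h | rfl | h
        · rw [if_pos (by simpa using h.le), if_pos (by rw [Fin.le_def]; simp; omega)]
          exact hd
        · rw [if_pos le_rfl, if_neg (by simp)]
          unfold Adj pairTgt at *; grind
        · rw [if_neg (by simpa using h), if_neg (by rw [Fin.le_def]; simp; omega)]
          exact hd.tgt _⟩ : T.ModelArr)
  have ha : ∀ i, coord a i = if i ≤ c.castSucc then pairSrc (T.lower c) (coord p i)
      else coord p i := fun i => rfl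
  have hb : ∀ i, coord b i = if i ≤ c.castSucc then coord p i
      else pairTgt (T.lower c) (coord p i) := fun i => rfl
  refine ⟨a, b, ?_, ?_, fun i hi => by rw [ha, if_pos hi], fun i hi => ?_⟩
  · refine model_ext fun i => ?_
    rw [model_tgt_val, model_src_val, ha, hb]
    unfold pairSrc pairTgt; grind
  · refine model_ext fun i => ?_
    rw [model_comp_val, ha, hb]
    unfold pairComp pairSrc pairTgt; grind
  · rw [hb, if_neg]
    exact not_le.2 (c.castSucc_lt_succ.trans_le hi)

/-- An indecomposable arrow is not cut properly at any `c`: one of its sides is degenerate. -/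
lemma dim_le_of_isIndecomposable {p : T.model.Arr} (hp : IsIndecomposable p) (c : Fin T.gaps) :
    (∀ i ≤ c.castSucc, (coord p i).1 ≤ T.lower c) ∨
      (∀ i ≥ c.succ, (coord p i).1 ≤ T.lower c) := by
  obtain ⟨a, b, h, hab, ha, hb⟩ := exists_cut p c
  rcases hp _ _ _ _ hab with rfl | rfl
  · left
    intro i hi
    have := ha i hi
    unfold pairSrc at this; grind
  · right
    intro i hi
    have := hb i hi
    unfold pairTgt at this; grind

lemma pairGlobe_self {p : T.model.Arr} {i : Fin (T.gaps + 1)} :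
    coord (globe (gen i) (coord p i)) i = coord p i := by
  have := coord_lt_or_eq p i
  rw [coord_globe, gen_val, genVal_self]
  have := pair_cases (coord p i)
  unfold pairTgt pairSrc; grind

/-- The indecomposable arrows of the model are the iterated sources and targets of the
generators. -/
lemma exists_globe_of_isIndecomposable {p : T.model.Arr} (hp : IsIndecomposable p) :
    ∃ i q, p = globe (gen i) q := by
  obtain ⟨i₀, -, hmax⟩ := Finset.univ.exists_max_image (fun i => (coord p i).1)
    ⟨(0 : Fin (T.gaps + 1)), Finset.mem_univ _⟩
  obtain ⟨d, hd⟩ : ∃ d, (coord p i₀).1 = d := ⟨_, rfl⟩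
  have hmax' : ∀ i, (coord p i).1 ≤ d := fun i => hd ▸ hmax i (Finset.mem_univ i)
  -- A component of maximal dimension determines the arrow, unless it is also the bounding arrow
  -- by which its disk is glued; the first or last such component avoids this ambiguity.
  obtain ⟨i, hi, hF, hT⟩ : ∃ i, (coord p i).1 = d ∧
      (coord p i = (d, false) → ∀ j, i < j → coord p j ≠ (d, false)) ∧
      (coord p i = (d, true) → ∀ j, j < i → coord p j ≠ (d, true)) := by
    by_cases hex : ∃ i, coord p i = (d, false)
    · obtain ⟨i, hi, him⟩ := (Finset.univ.filter fun i => coord p i = (d, false)).exists_max_image id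
        (by obtain ⟨i, hi⟩ := hex; exact ⟨i, by simpa using hi⟩)
      simp only [Finset.mem_filter, Finset.mem_univ, true_and, id] at hi him
      exact ⟨i, by rw [hi], fun _ j hj h => (him j h).not_gt hj, fun h => by simp [hi] at h⟩
    · have h0 : coord p i₀ = (d, true) := by
        rcases pair_cases (coord p i₀) with h | h
        · exact absurd ⟨i₀, by rw [h, hd]⟩ hex
        · rw [h, hd]
      obtain ⟨i, hi, him⟩ := (Finset.univ.filter fun i => coord p i = (d, true)).exists_min_image id
        ⟨i₀, by simpa using h0⟩
      simp only [Finset.mem_filter, Finset.mem_univ, true_and, id] at hi him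
      exact ⟨i, by rw [hi], fun h => by simp [hi] at h, fun _ j hj h => (him j h).not_gt hj⟩
  have hR : ∀ c : Fin T.gaps, i ≤ c.castSucc → ∀ j ≥ c.succ, (coord p j).1 ≤ T.lower c := by
    intro c hc j hj
    rcases dim_le_of_isIndecomposable hp c with h | h
    · have := h i hc
      have := hmax' j
      omega
    · exact h j hj
  have hL : ∀ c : Fin T.gaps, c.succ ≤ i → ∀ j ≤ c.castSucc, (coord p j).1 ≤ T.lower c := by
    intro c hc j hj
    rcases dim_le_of_isIndecomposable hp c with h | h
    · exact h j hj
    · have := h i hc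
      have := hmax' j
      omega
  have hpc := pair_cases (coord p i)
  rw [hi] at hpc
  have key1 : ∀ j, i ≤ j → i < j → coord p j =
      if T.meet i j ≤ d then (T.meet i j, true) else coord p i := by
    intro j hij
    refine forall_of_step_right (Q := fun j => i < j → coord p j =
      if T.meet i j ≤ d then (T.meet i j, true) else coord p i) i T.gaps (fun h => absurd h (lt_irrefl _))
      (fun c h1 h2 h3 h4 => ?_) j hij (by omega)
    have hc := hR c h1 c.succ le_rfl
    have hadj := model_adj p c
    have hms := meet_succ (T := T) c
    rw [low_coe] at hms
    have hne := hF
    have hpc' := pair_cases (coord p c.succ)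
    rcases (show i ≤ c.castSucc from h1).eq_or_lt with rfl | hlt
    · have hne := fun h => hF h _ h4
      simp only [Fin.val_castSucc, Fin.val_succ, hms]
      unfold Adj at hadj; grind
    · have hne := fun h => hF h _ h4
      have h3 := h3 hlt
      have hmin := meet_eq_min (T := T) (a := i) (b := c) (c := c + 1) hlt (by omega)
      simp only [Fin.val_castSucc, Fin.val_succ] at *
      unfold Adj at hadj; grind
  have key2 : ∀ j, j ≤ i → j < i → coord p j =
      if T.meet j i ≤ d then (T.meet j i, false) else coord p i := by
    intro j hij
    refine forall_of_step_left (Q := fun j => j < i → coord p j =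
      if T.meet j i ≤ d then (T.meet j i, false) else coord p i) 0 i (fun h => absurd h (lt_irrefl _))
      (fun c h1 h2 h3 h4 => ?_) j (by omega) hij
    have hci : c.succ ≤ i := Fin.castSucc_lt_iff_succ_le.1 h4
    have hc := hL c hci c.castSucc le_rfl
    have hadj := model_adj p c
    have hms := meet_succ (T := T) c
    rw [low_coe] at hms
    have hpc' := pair_cases (coord p c.castSucc)
    rcases hci.eq_or_lt with rfl | hlt
    · have hne := fun h => hT h _ h4
      simp only [Fin.val_castSucc, Fin.val_succ, hms]
      unfold Adj at hadj; grind
    · have hne := fun h => hT h _ h4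
      have h3 := h3 hlt
      have hmin := meet_eq_min (T := T) (a := c) (b := c + 1) (c := i) (by omega) hlt
      simp only [Fin.val_castSucc, Fin.val_succ] at *
      unfold Adj at hadj; grind
  refine ⟨i, coord p i, model_ext fun j => ?_⟩
  rcases lt_trichotomy i j with h | rfl | h
  · rw [key1 j h.le h, coord_globe, gen_val, genVal_of_lt h]
    unfold pairSrc pairTgt; grind
  · exact pairGlobe_self.symm
  · rw [key2 j h.le h, coord_globe, gen_val, genVal_of_gt h]
    unfold pairSrc pairTgt; grind

/-- The generators generate: a functor on the model is determined by its values on them. The proof is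
by induction on the sum of the dimensions of the components, which decreases in a proper
decomposition. -/
lemma model_hom_ext {φ ψ : T.model ⟶ E} (h : ∀ i, φ.toFun (gen i) = ψ.toFun (gen i)) : φ = ψ := by
  refine hom_ext fun p => ?_
  obtain ⟨n, hn⟩ : ∃ n, ∑ i, (coord p i).1 = n := ⟨_, rfl⟩
  induction n using Nat.strong_induction_on generalizing p with
  | _ n ih =>
  by_cases hp : IsIndecomposable p
  · obtain ⟨i, q, rfl⟩ := exists_globe_of_isIndecomposable hp
    rw [map_globe, map_globe, h]
  · simp only [IsIndecomposable, not_forall, not_or] at hp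
    obtain ⟨l, a, b, hab, rfl, ha, hb⟩ := hp
    have hle : ∀ i, (coord a i).1 ≤ (coord (T.model.comp l a b hab) i).1 ∧
        (coord b i).1 ≤ (coord (T.model.comp l a b hab) i).1 ∧
        ((coord a i).1 = (coord (T.model.comp l a b hab) i).1 →
          coord a i = coord (T.model.comp l a b hab) i) ∧
        ((coord b i).1 = (coord (T.model.comp l a b hab) i).1 →
          coord b i = coord (T.model.comp l a b hab) i) := fun i => by
      have := model_pair_eq hab i
      rw [model_comp_val]
      unfold pairComp pairSrc pairTgt at *; grind
    have ha' : ∑ i, (coord a i).1 < n := by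
      rw [← hn]
      refine Finset.sum_lt_sum (fun i _ => (hle i).1) ?_
      by_contra hcon
      push Not at hcon
      exact ha (model_ext fun i => (hle i).2.2.1
        (le_antisymm (hle i).1 (hcon i (Finset.mem_univ i))))
    have hb' : ∑ i, (coord b i).1 < n := by
      rw [← hn]
      refine Finset.sum_lt_sum (fun i _ => (hle i).2.1) ?_
      by_contra hcon
      push Not at hcon
      exact hb (model_ext fun i => (hle i).2.2.2
        (le_antisymm (hle i).2.1 (hcon i (Finset.mem_univ i))))
    have h1 := ih _ ha' a rfl
    have h2 := ih _ hb' b rfl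
    have m1 : E.tgt l (φ.toFun a) = E.src l (φ.toFun b) := by rw [← φ.map_tgt, hab, φ.map_src]
    have m2 : E.tgt l (ψ.toFun a) = E.src l (ψ.toFun b) := by rw [← ψ.map_tgt, hab, ψ.map_src]
    rw [φ.map_comp _ _ _ _ m1, ψ.map_comp _ _ _ _ m2]
    exact comp_congr h1 h2 _ _

lemma coord_eq_of_lt_meet (p : T.model.Arr) {i j : Fin (T.gaps + 1)} (hij : i < j)
    (h : (coord p i).1 < T.meet i j ∨ (coord p j).1 < T.meet i j) : coord p i = coord p j := by
  have hm : ∀ d : Fin T.gaps, (i : ℕ) ≤ d → (d : ℕ) < j → T.meet i j ≤ T.lower d :=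
    fun d h1 h2 => by rw [← low_coe]; exact meet_le h1 h2
  rcases h with h | h
  · exact (coord_eq_of_lt p hm i j le_rfl hij.le hij.le le_rfl h).symm
  · exact coord_eq_of_lt p hm j i hij.le le_rfl le_rfl hij.le h

lemma isIndecomposable_gen (i : Fin (T.gaps + 1)) :
    IsIndecomposable (gen i : T.model.Arr) := by
  intro l a b h hab
  have hp := fun j => model_pair_eq h j
  have hci : coord (gen i) i = (T.upper i, false) := genVal_self i
  have hc : ∀ j, pairComp l (coord a j) (coord b j) = coord (gen i) j := fun j => by
    rw [← hab, model_comp_val]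
  unfold pairComp pairSrc pairTgt at *
  -- the components of `gen i` at the other disks, and how an arrow of low dimension propagates
  have hcase : ∀ j, j ≠ i → ∃ m, (coord (gen i) j).1 = m ∧ m < T.upper i ∧
      ∀ p : T.model.Arr, (coord p i).1 < m ∨ (coord p j).1 < m → coord p i = coord p j := by
    intro j hj
    rcases lt_or_gt_of_ne hj with hj | hj
    · refine ⟨T.meet j i, ?_, meet_lt_right hj, fun p hp =>
        (coord_eq_of_lt_meet p hj hp.symm).symm⟩
      rw [gen_val, genVal_of_gt hj]
    · refine ⟨T.meet i j, ?_, meet_lt_left hj, fun p hp => coord_eq_of_lt_meet p hj hp⟩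
      rw [gen_val, genVal_of_lt hj]
  have hpi := hp i
  have hcci := hc i
  by_cases hai : T.upper i ≤ l ∨ (coord a i).1 ≤ l
  · right
    refine model_ext fun j => ?_
    have h1 := hp j
    have h2 := hc j
    by_cases hj : j = i
    · subst hj; grind
    · obtain ⟨m, hm, hmi, hm'⟩ := hcase j hj
      have := hm' a
      grind
  · left
    refine model_ext fun j => ?_
    have h1 := hp j
    have h2 := hc j
    by_cases hj : j = i
    · subst hj; grind
    · obtain ⟨m, hm, hmi, hm'⟩ := hcase j hj
      have := hm' a
      grind

end DimTable

/-! ### The model determines the table and has no automorphisms -/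

namespace StrictOmegaCat

/-- The indecomposable arrows that are not an iterated source or target of another
indecomposable arrow. -/
def IsGenerator {C : StrictOmegaCat} (x : C.Arr) : Prop :=
  IsIndecomposable x ∧ ∀ y : C.Arr, IsIndecomposable y → ∀ q, globe y q = x → y = x

variable {C D : StrictOmegaCat}

lemma IsIndecomposable.of_map (f : C ⟶ D) [IsIso f] {x : C.Arr}
    (h : IsIndecomposable (f.toFun x)) : IsIndecomposable x := by
  rintro l a b hab rfl
  have h' : D.tgt l (f.toFun a) = D.src l (f.toFun b) := by rw [← f.map_tgt, hab, f.map_src]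
  exact (h l _ _ h' (f.map_comp _ _ _ _ _).symm).imp (fun h => (bijective_of_isIso f).1 h)
    (fun h => (bijective_of_isIso f).1 h)

lemma isIndecomposable_map (f : C ⟶ D) [IsIso f] {x : C.Arr} :
    IsIndecomposable (f.toFun x) ↔ IsIndecomposable x := by
  refine ⟨.of_map f, fun h => .of_map (inv f) ?_⟩
  have : (inv f).toFun (f.toFun x) = x := congrArg (fun g => Hom.toFun g x) (IsIso.hom_inv_id f)
  rwa [this]

lemma IsGenerator.map (f : C ⟶ D) [IsIso f] {x : C.Arr} (h : IsGenerator x) :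
    IsGenerator (f.toFun x) := by
  refine ⟨(isIndecomposable_map f).2 h.1, fun y hy q hq => ?_⟩
  obtain ⟨y, rfl⟩ := (bijective_of_isIso f).2 y
  rw [← map_globe] at hq
  rw [h.2 y ((isIndecomposable_map f).1 hy) q ((bijective_of_isIso f).1 hq)]

end StrictOmegaCat

namespace DimTable

open StrictOmegaCat

variable {S T : DimTable}

lemma eq_of_globe_gen {i j : Fin (T.gaps + 1)} {q : ℕ × Bool} (h : globe (gen i) q = gen j) :
    i = j := by
  by_contra hij
  have h1 : coord (gen j) j = (T.upper j, false) := genVal_self j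
  rw [← h, coord_globe] at h1
  rcases lt_or_gt_of_ne hij with hij | hij
  · have := meet_lt_right hij
    rw [gen_val, genVal_of_lt hij] at h1
    unfold pairSrc pairTgt at h1; grind
  · have := meet_lt_left hij
    rw [gen_val, genVal_of_gt hij] at h1
    unfold pairSrc pairTgt at h1; grind

lemma gen_injective : Function.Injective (gen : Fin (T.gaps + 1) → T.model.Arr) := fun i j h =>
  eq_of_globe_gen (q := (T.upper i, false)) (by rw [globe_false, src_upper_gen, h])

/-- The generators of the model are characterized by a property that isomorphisms preserve. -/
lemma isGenerator_iff {x : T.model.Arr} : IsGenerator x ↔ ∃ i, gen i = x := by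
  constructor
  · rintro ⟨h1, h2⟩
    obtain ⟨i, q, rfl⟩ := exists_globe_of_isIndecomposable h1
    exact ⟨i, h2 _ (isIndecomposable_gen i) q rfl⟩
  · rintro ⟨i, rfl⟩
    refine ⟨isIndecomposable_gen i, fun y hy q hq => ?_⟩
    obtain ⟨j, q', rfl⟩ := exists_globe_of_isIndecomposable hy
    have hji : j = i := by
      refine eq_of_globe_gen (q := if q'.1 ≤ q.1 then q' else q) ?_
      rw [← hq]
      obtain ⟨k, b⟩ := q
      have := globe_pairSrc (gen j) k q'
      have := globe_pairTgt (gen j) k q'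
      unfold pairSrc pairTgt at *
      cases b <;> grind [globe_true, globe_false]
    subst hji
    refine model_ext fun l => ?_
    have h1 : coord (gen j) j = (T.upper j, false) := genVal_self j
    have h2 := congrArg (fun x => coord x j) hq
    simp only [coord_globe, h1] at h2
    have h3 : T.upper j ≤ q'.1 := by unfold pairSrc pairTgt at h2; grind
    have h4 : globe (gen j) q' = gen j := by
      have := src_eq_self h3 (src_upper_gen j)
      rcases pair_cases q' with h | h <;> rw [h]
      · rw [globe_false, this]
      · rw [globe_true, tgt_eq_self this]
    rw [h4]

lemma le_of_tgt_gen_eq_src_gen {m : ℕ} {i j : Fin (T.gaps + 1)}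
    (h : T.model.tgt m (gen i) = T.model.src m (gen j)) : j ≤ i := by
  by_contra! hij
  have h1 := model_pair_eq h i
  have := meet_lt_left hij
  rw [gen_val, gen_val, genVal_self, genVal_of_gt hij] at h1
  unfold pairSrc pairTgt at h1; grind

lemma eq_lower_of_tgt_gen_eq_src_gen {m : ℕ} {c : Fin T.gaps}
    (h : T.model.tgt m (gen c.succ) = T.model.src m (gen c.castSucc)) : m = T.lower c := by
  have h1 := model_pair_eq h c.castSucc
  have hm := meet_succ (T := T) c
  rw [low_coe] at hm
  have := T.lower_lt_left c
  rw [gen_val, gen_val, genVal_self, genVal_of_gt c.castSucc_lt_succ] at h1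
  simp only [Fin.val_castSucc, Fin.val_succ, hm] at h1
  unfold pairSrc pairTgt at h1; grind

lemma upper_le_of_src_gen {m : ℕ} {i : Fin (T.gaps + 1)}
    (h : T.model.src m (gen i) = gen i) : T.upper i ≤ m := by
  have h1 := congrArg (fun x => coord x i) h
  simp only [model_src_val, gen_val, genVal_self] at h1
  unfold pairSrc at h1; grind

/-- An isomorphism of models maps generators to generators. It preserves their order, since the source
of a generator in some dimension is the target of another one only if the latter is not on its left.
-/
lemma exists_equiv_of_isIso (f : S.model ⟶ T.model) [IsIso f] :
    ∃ e : Fin (S.gaps + 1) ≃o Fin (T.gaps + 1), ∀ i, f.toFun (gen i) = gen (e i) := by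
  have h1 : ∀ i, ∃ j, gen j = f.toFun (gen i) := fun i =>
    isGenerator_iff.1 ((isGenerator_iff.2 ⟨i, rfl⟩ : IsGenerator (gen i)).map f)
  have h2 : ∀ j, ∃ i, gen i = (inv f).toFun (gen j) := fun j =>
    isGenerator_iff.1 ((isGenerator_iff.2 ⟨j, rfl⟩ : IsGenerator (gen j)).map (inv f))
  choose u hu using h1
  choose v hv using h2
  have hl : ∀ x, (inv f).toFun (f.toFun x) = x := fun x =>
    congrArg (fun g => Hom.toFun g x) (IsIso.hom_inv_id f)
  have hr : ∀ x, f.toFun ((inv f).toFun x) = x := fun x =>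
    congrArg (fun g => Hom.toFun g x) (IsIso.inv_hom_id f)
  let e : Fin (S.gaps + 1) ≃ Fin (T.gaps + 1) :=
    ⟨u, v, fun i => gen_injective (by rw [hv, hu, hl]), fun j => gen_injective (by rw [hu, hv, hr])⟩
  have hmono : StrictMono e := by
    refine Fin.strictMono_iff_lt_succ.2 fun c => ?_
    have h3 : u c.castSucc ≤ u c.succ := by
      refine le_of_tgt_gen_eq_src_gen (m := S.lower c) ?_
      rw [hu, hu, ← f.map_src, ← f.map_tgt, src_lower_gen]
    exact lt_of_le_of_ne h3 fun h => c.castSucc_lt_succ.ne (e.injective h)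
  exact ⟨hmono.orderIsoOfSurjective e e.surjective, fun i => (hu i).symm⟩

/-- Isomorphic models come from equal tables. -/
lemma eq_of_isIso (f : S.model ⟶ T.model) [IsIso f] : S = T := by
  obtain ⟨e, he⟩ := exists_equiv_of_isIso f
  have hinj := (bijective_of_isIso f).1
  obtain ⟨a, u, l, h1, h2⟩ := S
  obtain ⟨a', u', l', h1', h2'⟩ := T
  obtain rfl : a = a' := by simpa using Fintype.card_congr e.toEquiv
  obtain rfl : e = OrderIso.refl _ := Subsingleton.elim _ _
  have hu : u = u' := by
    funext i
    refine le_antisymm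
      (upper_le_of_src_gen (T := ⟨a, u, l, h1, h2⟩) (m := u' i) (i := i) (hinj ?_))
      (upper_le_of_src_gen (T := ⟨a, u', l', h1', h2'⟩) (m := u i) (i := i) ?_)
    · rw [f.map_src, he]; exact src_upper_gen _
    · have := he i
      rw [OrderIso.refl_apply] at this
      erw [← this, ← f.map_src]
      exact congrArg f.toFun (src_upper_gen (T := ⟨a, u, l, h1, h2⟩) i)
  subst hu
  have hl : l = l' := by
    funext c
    refine eq_lower_of_tgt_gen_eq_src_gen (T := ⟨a, u, l', h1', h2'⟩) (c := c) ?_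
    have h3 := he c.succ
    have h4 := he c.castSucc
    rw [OrderIso.refl_apply] at h3 h4
    erw [← h3, ← h4, ← f.map_src, ← f.map_tgt]
    exact congrArg f.toFun (src_lower_gen (T := ⟨a, u, l, h1, h2⟩) c).symm
  subst hl
  rfl

/-- The only automorphism of a model is the identity. -/
lemma eq_id_of_isIso (f : T.model ⟶ T.model) [IsIso f] : f = 𝟙 _ := by
  obtain ⟨e, he⟩ := exists_equiv_of_isIso f
  obtain rfl : e = OrderIso.refl _ := Subsingleton.elim _ _
  exact model_hom_ext he

end DimTable

/-! ### Reversal of orientations on the model -/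

namespace DimTable

open StrictOmegaCat

variable {T : DimTable} {E : StrictOmegaCat}

lemma Adj.trans {m m' : ℕ} {p q s : ℕ × Bool} (h : Adj m p q) (h' : Adj m' q s) :
    Adj (min m m') p s := by
  have := pair_cases p
  have := pair_cases q
  have := pair_cases s
  rcases le_total m m' with h1 | h1
  · rw [min_eq_left h1]
    unfold Adj at *; grind
  · rw [min_eq_right h1]
    unfold Adj at *; grind

/-- Any two components are compatible, not only neighbours. -/
lemma adj_meet (p : T.model.Arr) {i j : Fin (T.gaps + 1)} (hij : i < j) :
    Adj (T.meet i j) (coord p i) (coord p j) := by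
  refine forall_of_step_right (Q := fun j => i < j → Adj (T.meet i j) (coord p i) (coord p j))
    i T.gaps (fun h => absurd h (lt_irrefl _)) (fun c h1 _ h3 _ => ?_) j hij.le (by omega) hij
  have hms := meet_succ (T := T) c
  rw [low_coe] at hms
  have hadj := model_adj p c
  rcases (show i ≤ c.castSucc from h1).eq_or_lt with rfl | hlt
  · simpa only [Fin.val_castSucc, Fin.val_succ, hms] using hadj
  · have hmin := meet_eq_min (T := T) (a := i) (b := c) (c := c + 1) hlt (by omega)
    rw [Fin.val_succ, hmin, hms]
    exact (h3 hlt).trans hadj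

variable (T) in
/-- The symmetric version of `meet`. -/
noncomputable def sepDim (i j : Fin (T.gaps + 1)) : ℕ :=
  if i < j then T.meet i j else T.meet j i

variable (T) in
/-- The order in which the disks of a table occur after the reversal of orientations: two disks
are exchanged if the dimension in which they meet is reversed. -/
def RevLT (r : ℕ → Bool) (i j : Fin (T.gaps + 1)) : Prop :=
  (i < j ∧ r (T.meet i j) = false) ∨ (j < i ∧ r (T.meet j i) = true)

lemma meet_eq_min_fin {i j l : Fin (T.gaps + 1)} (h : i < j) (h' : j < l) :
    T.meet i l = min (T.meet i j) (T.meet j l) := meet_eq_min h h'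

/-- Transitivity holds since of the three dimensions in which three disks meet pairwise, the one
belonging to the outer disks is the least of the other two. -/
lemma RevLT.trans {r : ℕ → Bool} {i j l : Fin (T.gaps + 1)} (h : T.RevLT r i j)
    (h' : T.RevLT r j l) : T.RevLT r i l := by
  have h1 := @meet_eq_min_fin T i j l
  have h2 := @meet_eq_min_fin T i l j
  have h3 := @meet_eq_min_fin T j i l
  have h4 := @meet_eq_min_fin T j l i
  have h5 := @meet_eq_min_fin T l i j
  have h6 := @meet_eq_min_fin T l j i
  unfold RevLT at *
  rcases lt_trichotomy i l with h7 | h7 | h7 <;> grind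

lemma RevLT.sepDim_eq {r : ℕ → Bool} {i j l : Fin (T.gaps + 1)} (h : T.RevLT r i j)
    (h' : T.RevLT r j l) : T.sepDim i l = min (T.sepDim i j) (T.sepDim j l) := by
  have h1 := @meet_eq_min_fin T i j l
  have h2 := @meet_eq_min_fin T i l j
  have h3 := @meet_eq_min_fin T j i l
  have h4 := @meet_eq_min_fin T j l i
  have h5 := @meet_eq_min_fin T l i j
  have h6 := @meet_eq_min_fin T l j i
  unfold RevLT sepDim at *
  rcases lt_trichotomy i l with h7 | h7 | h7 <;> grind

lemma isStrictTotalOrder_revLT (r : ℕ → Bool) : IsStrictTotalOrder _ (T.RevLT r) where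
  irrefl i h := by unfold RevLT at h; grind
  trans _ _ _ := RevLT.trans
  trichotomous i j := by
    unfold RevLT
    rcases lt_trichotomy i j with h | h | h
    · cases hr : r (T.meet i j) <;> grind
    · grind
    · cases hr : r (T.meet j i) <;> grind

lemma exists_equiv_fin_of_isStrictTotalOrder {α : Type*} [Fintype α] {n : ℕ}
    (hn : Fintype.card α = n) (s : α → α → Prop) (hs : IsStrictTotalOrder α s) :
    ∃ e : Fin n ≃ α, ∀ a b, a < b ↔ s (e a) (e b) := by
  classical
  let : LinearOrder α := linearOrderOfSTO s
  exact ⟨(Fintype.orderIsoFinOfCardEq α hn).toEquiv, fun a b =>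
    (Fintype.orderIsoFinOfCardEq α hn).lt_iff_lt.symm⟩

/-- The isomorphism of the `k`-disk with its reversal, on all pairs. -/
def flipPair (r : ℕ → Bool) (k : ℕ) (p : ℕ × Bool) : ℕ × Bool :=
  if p.1 < k then (p.1, p.2 ^^ r p.1) else p

lemma flipPair_flipPair (r : ℕ → Bool) (k : ℕ) (p : ℕ × Bool) :
    flipPair r k (flipPair r k p) = p := by
  unfold flipPair
  obtain ⟨j, b⟩ := p
  by_cases h : j < k <;> simp [h]

lemma flipPair_valid {r : ℕ → Bool} {k : ℕ} {p : ℕ × Bool} (h : p.1 < k ∨ p = (k, false)) :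
    (flipPair r k p).1 < k ∨ flipPair r k p = (k, false) := by
  unfold flipPair; grind

lemma Adj.flip {r : ℕ → Bool} {m k k' : ℕ} {p q : ℕ × Bool} (h : Adj m p q) (hr : r m = false)
    (hk : m < k) (hk' : m < k') :
    Adj m (flipPair r k p) (flipPair r k' q) := by
  obtain ⟨j, b⟩ := p
  obtain ⟨j', b'⟩ := q
  unfold Adj flipPair at *; grind

lemma Adj.flip_swap {r : ℕ → Bool} {m k k' : ℕ} {p q : ℕ × Bool} (h : Adj m p q)
    (hr : r m = true) (hk : m < k) (hk' : m < k') :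
    Adj m (flipPair r k' q) (flipPair r k p) := by
  obtain ⟨j, b⟩ := p
  obtain ⟨j', b'⟩ := q
  unfold Adj flipPair at *; grind

lemma flipPair_pairSrc {r : ℕ → Bool} {k l : ℕ} {p : ℕ × Bool} (h : p.1 ≤ k) :
    flipPair r k (if r l = true then pairTgt l p else pairSrc l p) =
      pairSrc l (flipPair r k p) := by
  unfold flipPair pairTgt pairSrc; grind

lemma flipPair_pairTgt {r : ℕ → Bool} {k l : ℕ} {p : ℕ × Bool} (h : p.1 ≤ k) :
    flipPair r k (if r l = true then pairSrc l p else pairTgt l p) =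
      pairTgt l (flipPair r k p) := by
  unfold flipPair pairTgt pairSrc; grind

lemma flipPair_pairComp {r : ℕ → Bool} {k l : ℕ} {p q : ℕ × Bool}
    (hpq : pairTgt l (flipPair r k p) = pairSrc l (flipPair r k q)) :
    flipPair r k (if r l = true then pairComp l q p else pairComp l p q) =
      pairComp l (flipPair r k p) (flipPair r k q) := by
  have h1 : (flipPair r k p).1 = p.1 := by unfold flipPair; grind
  have h2 : (flipPair r k q).1 = q.1 := by unfold flipPair; grind
  unfold pairTgt pairSrc pairComp at *
  have h3 := flipPair_flipPair r k p
  have h4 := flipPair_flipPair r k q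
  grind

lemma coord_reverse_src (r : ℕ → Bool) (l : ℕ) (p : T.model.Arr) (i) :
    coord ((T.model.reverse r).src l p) i =
      if r l = true then pairTgt l (coord p i) else pairSrc l (coord p i) := by
  by_cases h : r l = true <;> simp only [reverse, h, if_true] <;> simp

lemma coord_reverse_tgt (r : ℕ → Bool) (l : ℕ) (p : T.model.Arr) (i) :
    coord ((T.model.reverse r).tgt l p) i =
      if r l = true then pairSrc l (coord p i) else pairTgt l (coord p i) := by
  by_cases h : r l = true <;> simp only [reverse, h, if_true] <;> simp

lemma coord_reverse_comp (r : ℕ → Bool) (l : ℕ) (p q : T.model.Arr) (h) (i) :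
    coord ((T.model.reverse r).comp l p q h) i =
      if r l = true then pairComp l (coord q i) (coord p i)
      else pairComp l (coord p i) (coord q i) := by
  by_cases h : r l = true <;> simp only [reverse, h, if_true, dite_true] <;> simp

/-- Reversing orientations in the model of a table yields the model of another table, with the same
upper row up to order. -/
lemma exists_reverse_iso (T : DimTable) (r : ℕ → Bool) :
    ∃ T' : DimTable, (∀ i, ∃ j, T'.upper i = T.upper j) ∧
      Nonempty (T.model.reverse r ≅ T'.model) := by
  obtain ⟨e, he⟩ := exists_equiv_fin_of_isStrictTotalOrder (n := T.gaps + 1) (by simp) _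
    (isStrictTotalOrder_revLT (T := T) r)
  have hlt : ∀ i j : Fin (T.gaps + 1), T.RevLT r i j →
      T.sepDim i j < T.upper i ∧ T.sepDim i j < T.upper j := fun i j h => by
    have h1 := @meet_lt_left T i j
    have h2 := @meet_lt_right T i j
    have h3 := @meet_lt_left T j i
    have h4 := @meet_lt_right T j i
    unfold RevLT sepDim at *; grind
  have hcs : ∀ c : Fin T.gaps, T.RevLT r (e c.castSucc) (e c.succ) := fun c =>
    (he _ _).1 c.castSucc_lt_succ
  let T' : DimTable := ⟨T.gaps, fun i => T.upper (e i),
    fun c => T.sepDim (e c.castSucc) (e c.succ), fun c => (hlt _ _ (hcs c)).1,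
    fun c => (hlt _ _ (hcs c)).2⟩
  have hmeet : ∀ a b : Fin (T.gaps + 1), a < b → T'.meet a b = T.sepDim (e a) (e b) := by
    intro a b hab
    refine forall_of_step_right (T := T)
      (Q := fun b => a < b → T'.meet a b = T.sepDim (e a) (e b)) a T.gaps
      (fun h => absurd h (lt_irrefl _)) (fun c h1 _ h3 _ => ?_) b hab.le (by omega) hab
    have hms := meet_succ (T := T') c
    rw [low_coe (T := T') c] at hms
    rcases (show a ≤ c.castSucc from h1).eq_or_lt with rfl | hlt'
    · rw [Fin.val_castSucc, Fin.val_succ, hms]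
    · have hmin := meet_eq_min (T := T') (a := a) (b := c) (c := c + 1) hlt' (by omega)
      rw [Fin.val_succ, hmin, hms, RevLT.sepDim_eq ((he _ _).1 hlt') (hcs c), ← h3 hlt']
      rfl
  let F : T.model.reverse r ⟶ T'.model :=
    { toFun := fun p => (⟨fun a => flipPair r (T.upper (e a)) (coord p (e a)), fun a =>
          flipPair_valid (coord_lt_or_eq _ _), fun c => by
          have h1 := hcs c
          have h2 := hlt _ _ h1
          change Adj (T.sepDim (e c.castSucc) (e c.succ))
            (flipPair r (T.upper (e c.castSucc)) (coord p (e c.castSucc)))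
            (flipPair r (T.upper (e c.succ)) (coord p (e c.succ)))
          unfold sepDim at *
          rcases h1 with ⟨h3, h4⟩ | ⟨h3, h4⟩
          · rw [if_pos h3] at *
            exact (adj_meet p h3).flip h4 h2.1 h2.2
          · rw [if_neg h3.not_gt] at *
            exact (adj_meet p h3).flip_swap h4 h2.2 h2.1⟩ : T'.ModelArr)
      map_src := fun l p => model_ext fun a => by
        exact (congrArg _ (coord_reverse_src r l p _)).trans (flipPair_pairSrc (coord_dim_le p _))
      map_tgt := fun l p => model_ext fun a => by
        exact (congrArg _ (coord_reverse_tgt r l p _)).trans (flipPair_pairTgt (coord_dim_le p _))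
      map_comp := fun l p q h h' => model_ext fun a => by
        exact (congrArg _ (coord_reverse_comp r l p q h _)).trans
          (flipPair_pairComp (model_pair_eq h' a)) }
  have hF : ∀ p a, coord (F.toFun p) a = flipPair r (T.upper (e a)) (coord p (e a)) :=
    fun _ _ => rfl
  have hbij : Function.Bijective F.toFun := by
    constructor
    · intro p q hpq
      refine model_ext (T := T) fun i => ?_
      obtain ⟨a, rfl⟩ := e.surjective i
      rw [← flipPair_flipPair r (T.upper (e a)) (coord p (e a)), ← hF, hpq, hF, flipPair_flipPair]
    · intro p
      have hv := fun a => coord_lt_or_eq p a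
      refine ⟨(⟨fun i => flipPair r (T.upper i) (coord p (e.symm i)), fun i =>
        flipPair_valid ?_, fun c => ?_⟩ : T.ModelArr), model_ext fun a => ?_⟩
      · have := coord_lt_or_eq p (e.symm i)
        change _ < T.upper (e (e.symm i)) ∨ _ = (T.upper (e (e.symm i)), false) at this
        simpa using this
      · have hms := meet_succ (T := T) c
        rw [low_coe] at hms
        have h1 := (hlt (e (e.symm c.castSucc)) (e (e.symm c.succ)))
        have hl := T.lower_lt_left c
        have hr := T.lower_lt_right c
        rcases lt_trichotomy (e.symm c.castSucc) (e.symm c.succ) with h | h | h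
        · have h2 := adj_meet p h
          have h3 := (he _ _).1 h
          rw [hmeet _ _ h] at h2
          rw [e.apply_symm_apply, e.apply_symm_apply] at h2 h3
          rw [sepDim, if_pos c.castSucc_lt_succ, Fin.val_castSucc, Fin.val_succ, hms] at h2
          refine h2.flip ?_ hl hr
          have := c.castSucc_lt_succ
          unfold RevLT at h3
          simp only [Fin.val_castSucc, Fin.val_succ, hms] at h3
          grind
        · exact absurd (e.symm.injective h) c.castSucc_lt_succ.ne
        · have h2 := adj_meet p h
          have h3 := (he _ _).1 h
          rw [hmeet _ _ h] at h2
          rw [e.apply_symm_apply, e.apply_symm_apply] at h2 h3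
          rw [sepDim, if_neg c.castSucc_lt_succ.not_gt, Fin.val_castSucc, Fin.val_succ, hms] at h2
          refine h2.flip_swap ?_ hr hl
          have := c.castSucc_lt_succ
          unfold RevLT at h3
          simp only [Fin.val_castSucc, Fin.val_succ, hms] at h3
          grind
      · refine (hF _ a).trans ?_
        refine (flipPair_flipPair r _ _).trans ?_
        rw [e.symm_apply_apply]
  have : IsIso F := isIso_of_bijective F hbij
  exact ⟨T', fun i => ⟨e i, rfl⟩, ⟨asIso F⟩⟩

/-- An arrow of top dimension is determined by its source and its target. -/
lemma model_eq_of_src_eq_of_tgt_eq {k : ℕ} (hT : ∀ i, T.upper i ≤ k + 1) {p q : T.model.Arr}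
    (h1 : T.model.src k p = T.model.src k q) (h2 : T.model.tgt k p = T.model.tgt k q) : p = q := by
  refine model_ext fun i => ?_
  have h3 := congrArg (fun x => coord x i) h1
  have h4 := congrArg (fun x => coord x i) h2
  have h5 := coord_lt_or_eq p i
  have h6 := coord_lt_or_eq q i
  have h7 := hT i
  have h8 := pair_cases (coord p i)
  have h9 := pair_cases (coord q i)
  simp only [model_src_val, model_tgt_val] at h3 h4
  unfold pairSrc pairTgt at *; grind

end DimTable

/-! ### The isomorphism of `Θ(T)` with its model -/

namespace StrictOmegaCat

variable {C D : StrictOmegaCat}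

/-- The functor from the `k`-disk that corresponds to an arrow (which should be a `k`-arrow). -/
def diskHom (k : ℕ) (x : C.Arr) : disk k ⟶ C where
  toFun p := globe x p.1
  map_src i p := by
    rw [← globe_pairSrc]
    congr 1
    by_cases hp : p.1.1 ≤ i <;> simp [disk, pairSrc, hp]
  map_tgt i p := by
    rw [← globe_pairTgt]
    congr 1
    by_cases hp : p.1.1 ≤ i <;> simp [disk, pairTgt, hp]
  map_comp i p q h h' := by
    rw [← globe_pairComp]
    · congr 1
      by_cases hp : p.1.1 ≤ i <;> simp [disk, pairComp, hp]
    · have := congrArg Subtype.val h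
      simp only [disk] at this
      unfold pairSrc pairTgt; grind

/-- The principal arrow of the `k`-disk. -/
def diskTop (k : ℕ) : (disk k).Arr := ⟨(k, false), Or.inr rfl⟩

lemma globe_diskTop {k : ℕ} (p : (disk k).Arr) : globe (diskTop k) p.1 = p := by
  obtain ⟨⟨j, b⟩, hp⟩ := p
  cases b <;> simp [globe, disk, diskTop, Subtype.ext_iff] <;> grind

lemma disk_hom_ext {k : ℕ} {f g : disk k ⟶ C} (h : f.toFun (diskTop k) = g.toFun (diskTop k)) :
    f = g :=
  hom_ext fun p => by rw [← globe_diskTop p, map_globe, map_globe, h]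

lemma src_diskTop (k : ℕ) : (disk k).src k (diskTop k) = diskTop k := by
  simp [disk, diskTop]

lemma diskHom_diskTop {k : ℕ} {x : C.Arr} (hx : C.src k x = x) :
    (diskHom k x).toFun (diskTop k) = x := hx

lemma diskFace_false_diskTop {j k : ℕ} (hjk : j < k) :
    (diskFace false hjk).toFun (diskTop j) = (disk k).src j (diskTop k) := by
  simp [diskFace, diskTop, disk, hjk]

lemma diskFace_true_diskTop {j k : ℕ} (hjk : j < k) :
    (diskFace true hjk).toFun (diskTop j) = (disk k).tgt j (diskTop k) := by
  simp [diskFace, diskTop, disk, hjk]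

end StrictOmegaCat

namespace DimTable

open StrictOmegaCat

variable {T : DimTable} {E : StrictOmegaCat}

/-- The principal arrow of the `i`-th disk, as an arrow of `Θ(T)`. -/
noncomputable def thetaGen (i : Fin (T.gaps + 1)) : T.theta.Arr :=
  Hom.toFun (Limits.Multicoequalizer.π T.diagram i) (diskTop (T.upper i))

lemma src_upper_thetaGen (i : Fin (T.gaps + 1)) : T.theta.src (T.upper i) (thetaGen i) = thetaGen i := by
  rw [thetaGen]
  refine ((Limits.Multicoequalizer.π T.diagram i).map_src _ _).symm.trans ?_
  exact congrArg _ (src_diskTop _)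

lemma diagram_fst_diskTop (c : Fin T.gaps) :
    Hom.toFun (T.diagram.fst c) (diskTop (T.lower c)) =
      (disk (T.upper c.castSucc)).src (T.lower c) (diskTop (T.upper c.castSucc)) :=
  diskFace_false_diskTop (T.lower_lt_left c)

lemma diagram_snd_diskTop (c : Fin T.gaps) :
    Hom.toFun (T.diagram.snd c) (diskTop (T.lower c)) =
      (disk (T.upper c.succ)).tgt (T.lower c) (diskTop (T.upper c.succ)) :=
  diskFace_true_diskTop (T.lower_lt_right c)

lemma src_lower_thetaGen (c : Fin T.gaps) :
    T.theta.src (T.lower c) (thetaGen c.castSucc) = T.theta.tgt (T.lower c) (thetaGen c.succ) := by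
  have h := congrArg (fun f => Hom.toFun f (diskTop (T.lower c)))
    (Limits.Multicoequalizer.condition T.diagram c)
  have h1 := diagram_fst_diskTop c
  have h2 := diagram_snd_diskTop c
  refine ((Limits.Multicoequalizer.π T.diagram c.castSucc).map_src _ _).symm.trans ?_
  refine Eq.trans ?_ ((Limits.Multicoequalizer.π T.diagram c.succ).map_tgt _ _)
  exact (congrArg _ h1).symm.trans (h.trans (congrArg _ h2))

lemma theta_hom_ext {φ ψ : T.theta ⟶ E} (h : ∀ i, φ.toFun (thetaGen i) = ψ.toFun (thetaGen i)) :
    φ = ψ :=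
  Limits.Multicoequalizer.hom_ext T.diagram φ ψ fun i => disk_hom_ext (h i)

lemma exists_theta_hom (x : Fin (T.gaps + 1) → E.Arr)
    (hx : ∀ i, E.src (T.upper i) (x i) = x i)
    (hg : ∀ c : Fin T.gaps,
      E.src (T.lower c) (x c.castSucc) = E.tgt (T.lower c) (x c.succ)) :
    ∃ φ : T.theta ⟶ E, ∀ i, φ.toFun (thetaGen i) = x i := by
  let φ : T.theta ⟶ E := Limits.Multicoequalizer.desc T.diagram E
    (fun i => diskHom (T.upper i) (x i)) (fun c => disk_hom_ext (by
      have h1 := diagram_fst_diskTop c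
      have h2 := diagram_snd_diskTop c
      have h3 := diskHom_diskTop (hx c.castSucc)
      have h4 := diskHom_diskTop (hx c.succ)
      refine (congrArg (diskHom (T.upper c.castSucc) (x c.castSucc)).toFun h1).trans (Eq.trans ?_
        (congrArg (diskHom (T.upper c.succ) (x c.succ)).toFun h2).symm)
      refine ((diskHom _ _).map_src _ _).trans (Eq.trans ?_ ((diskHom _ _).map_tgt _ _).symm)
      exact (congrArg _ h3).trans ((hg c).trans (congrArg _ h4).symm)))
  refine ⟨φ, fun i => ?_⟩
  have h1 : Limits.Multicoequalizer.π T.diagram i ≫ φ = diskHom (T.upper i) (x i) :=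
    Limits.Multicoequalizer.π_desc _ _ _ _ _
  exact (congrArg (fun f => Hom.toFun f (diskTop (T.upper i))) h1).trans (diskHom_diskTop (hx i))

variable (T) in
lemma exists_theta_iso_model : ∃ e : T.theta ≅ T.model, ∀ i, e.hom.toFun (thetaGen i) = gen i := by
  obtain ⟨φ, hφ⟩ := exists_theta_hom (T := T) gen src_upper_gen src_lower_gen
  obtain ⟨ψ, hψ⟩ := exists_hom (T := T) thetaGen src_upper_thetaGen src_lower_thetaGen
  exact ⟨⟨φ, ψ, theta_hom_ext fun i => by simp [hφ, hψ], model_hom_ext fun i => by simp [hφ, hψ]⟩,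
    hφ⟩

variable (T) in
/-- The isomorphism of `Θ(T)` with its model. -/
noncomputable def thetaIso : T.theta ≅ T.model := (exists_theta_iso_model T).choose

lemma thetaIso_hom_thetaGen (i : Fin (T.gaps + 1)) : T.thetaIso.hom.toFun (thetaGen i) = gen i :=
  (exists_theta_iso_model T).choose_spec i

lemma thetaIso_hom_injective : Function.Injective T.thetaIso.hom.toFun :=
  (bijective_of_isIso _).1

lemma eq_of_theta_iso {S T : DimTable} (f : S.theta ⟶ T.theta) [IsIso f] : S = T :=
  eq_of_isIso (S.thetaIso.inv ≫ f ≫ T.thetaIso.hom)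

lemma theta_eq_id_of_isIso (f : T.theta ⟶ T.theta) [IsIso f] : f = 𝟙 _ := by
  have h := eq_id_of_isIso (T.thetaIso.inv ≫ f ≫ T.thetaIso.hom)
  rw [Iso.inv_comp_eq, Category.comp_id] at h
  exact (cancel_mono T.thetaIso.hom).1 (by simpa using h)

lemma exists_reverse_theta_iso (T : DimTable) (r : ℕ → Bool) :
    ∃ T' : DimTable, T'.height ≤ T.height ∧ Nonempty (T'.theta ≅ T.theta.reverse r) := by
  obtain ⟨T', hT', ⟨e⟩⟩ := exists_reverse_iso T r
  refine ⟨T', Finset.sup_le fun i _ => ?_, ⟨T'.thetaIso ≪≫ e.symm ≪≫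
    ((reverseFunctor r).mapIso T.thetaIso).symm⟩⟩
  obtain ⟨j, hj⟩ := hT' i
  rw [hj]
  exact Finset.le_sup (f := T.upper) (Finset.mem_univ j)

lemma theta_eq_of_src_eq_of_tgt_eq {k : ℕ} (hT : IsNCat ((k + 1 : ℕ) : ℕ∞) T.theta)
    {p q : T.theta.Arr} (h1 : T.theta.src k p = T.theta.src k q)
    (h2 : T.theta.tgt k p = T.theta.tgt k q) : p = q := by
  refine thetaIso_hom_injective (model_eq_of_src_eq_of_tgt_eq (k := k) (fun i => ?_) ?_ ?_)
  · refine upper_le_of_src_gen ?_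
    rw [← thetaIso_hom_thetaGen, ← Hom.map_src, hT _ le_rfl]
  · rw [← Hom.map_src, ← Hom.map_src, h1]
  · rw [← Hom.map_tgt, ← Hom.map_tgt, h2]

/-- The table with a single entry. -/
def diskTable (k : ℕ) : DimTable := ⟨0, fun _ => k, Fin.elim0, fun c => c.elim0, fun c => c.elim0⟩

/-- The only index of the upper row of a table with a single entry. -/
def diskIdx (k : ℕ) : Fin ((diskTable k).gaps + 1) := (0 : Fin 1)

lemma height_diskTable (k : ℕ) : (diskTable k).height = k :=
  Finset.sup_const Finset.univ_nonempty k

/-- The principal arrow of the disk `Θ(k)`. -/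
noncomputable def top (k : ℕ) : (diskTable k).theta.Arr := thetaGen (T := diskTable k) (diskIdx k)

lemma src_top (k : ℕ) : (diskTable k).theta.src k (top k) = top k :=
  src_upper_thetaGen (T := diskTable k) (diskIdx k)

lemma diskTable_hom_ext {k : ℕ} {φ ψ : (diskTable k).theta ⟶ E}
    (h : φ.toFun (top k) = ψ.toFun (top k)) : φ = ψ :=
  theta_hom_ext fun i => by
    obtain rfl : i = diskIdx k := Subsingleton.elim (α := Fin 1) _ _
    exact h

lemma exists_diskTable_hom {k : ℕ} {x : E.Arr} (hx : E.src k x = x) :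
    ∃ φ : (diskTable k).theta ⟶ E, φ.toFun (top k) = x := by
  obtain ⟨φ, h⟩ := exists_theta_hom (T := diskTable k) (fun _ => x) (fun _ => hx)
    (fun c => c.elim0)
  exact ⟨φ, h _⟩

/-- The arrows of a disk are the pairs `q` of the explicit description. -/
lemma exists_globe_top {k : ℕ} (x : (diskTable k).theta.Arr) :
    ∃ q : ℕ × Bool, (q.1 < k ∨ q = (k, false)) ∧ x = globe (top k) q := by
  have hv := coord_lt_or_eq ((diskTable k).thetaIso.hom.toFun x) (diskIdx k)
  refine ⟨_, hv, thetaIso_hom_injective ?_⟩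
  rw [map_globe]
  refine model_ext fun i => ?_
  obtain rfl : i = diskIdx k := Subsingleton.elim (α := Fin 1) _ _
  have := thetaIso_hom_thetaGen (T := diskTable k) (diskIdx k)
  rw [top, this]
  exact pairGlobe_self.symm

lemma globe_top_injective {k : ℕ} {q q' : ℕ × Bool} (hq : q.1 < k ∨ q = (k, false))
    (hq' : q'.1 < k ∨ q' = (k, false)) (h : globe (top k) q = globe (top k) q') : q = q' := by
  have h1 := congrArg (fun x => coord ((diskTable k).thetaIso.hom.toFun x) (diskIdx k)) h
  have h2 := thetaIso_hom_thetaGen (T := diskTable k) (diskIdx k)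
  have h3 : coord (gen (T := diskTable k) (diskIdx k)) (diskIdx k) = ((diskTable k).upper (diskIdx k), false) :=
    genVal_self (T := diskTable k) (diskIdx k)
  have h4 : (diskTable k).upper (diskIdx k) = k := rfl
  rw [← top] at h2
  simp only [map_globe, coord_globe, h2, h3, h4] at h1
  have := pair_cases q
  have := pair_cases q'
  unfold pairSrc pairTgt at h1; grind

lemma isNCat_diskTable (k : ℕ) : IsNCat (k : ℕ∞) (diskTable k).theta :=
  isNCat_theta _ (by rw [height_diskTable])

lemma natCard_diskTable (k : ℕ) : Nat.card (diskTable k).theta.Arr = 2 * k + 1 := by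
  let f : (Fin k × Bool) ⊕ Unit → (diskTable k).theta.Arr :=
    Sum.elim (fun p => globe (top k) (p.1, p.2)) (fun _ => top k)
  have htop : top k = globe (top k) (k, false) := by rw [globe_false, src_top]
  have hf : Function.Bijective f := by
    constructor
    · rintro (⟨i, b⟩ | u) (⟨i', b'⟩ | u') h
      · have := globe_top_injective (Or.inl i.2) (Or.inl i'.2) h
        simp only [Prod.mk.injEq] at this
        rw [Fin.ext this.1, this.2]
      · have := globe_top_injective (Or.inl i.2) (Or.inr rfl) (h.trans htop)
        simp only [Prod.mk.injEq] at this
        exact absurd this.1 i.2.ne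
      · have := globe_top_injective (Or.inl i'.2) (Or.inr rfl) (h.symm.trans htop)
        simp only [Prod.mk.injEq] at this
        exact absurd this.1 i'.2.ne
      · rfl
    · intro x
      obtain ⟨⟨j, b⟩, h | h, rfl⟩ := exists_globe_top x
      · exact ⟨Sum.inl (⟨j, h⟩, b), rfl⟩
      · exact ⟨Sum.inr (), by rw [h]; exact htop⟩
  rw [← Nat.card_congr (Equiv.ofBijective f hf)]
  simp [mul_comm]

/-- If a table has more than one entry, `Θ(T)` has an endomorphism that is not idempotent: it
collapses `Θ(T)` to one of its disks and maps this disk to a bounding arrow of the next disk, thereby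
moving objects by one step. -/
lemma exists_not_idempotent (c : Fin T.gaps) : ∃ f : T.model ⟶ T.model, f ≫ f ≠ f := by
  set y : T.model.Arr := T.model.src (T.lower c + 1) (gen c.succ) with hy
  refine ⟨evalAt c.castSucc y, fun h => ?_⟩
  have h1 := congrArg (fun f => Hom.toFun f (gen c.castSucc)) h
  have hl := T.lower_lt_left c
  have hr := T.lower_lt_right c
  have hms := meet_succ (T := T) c
  rw [low_coe] at hms
  have hyl : coord y c.castSucc = (T.lower c, false) := by
    rw [hy, model_src_val, gen_val, genVal_of_gt c.castSucc_lt_succ, Fin.val_castSucc, Fin.val_succ,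
      hms, pairSrc, if_pos (by simp)]
  have h2 : (evalAt c.castSucc y).toFun (gen c.castSucc) = y := by
    rw [evalAt_toFun, gen_val, genVal_self, globe_false]
    exact src_eq_self (show T.lower c + 1 ≤ _ from hl) (T.model.src_src_self _ _)
  simp only [comp_toFun, h2] at h1
  rw [evalAt_toFun, hyl, globe_false, hy, T.model.src_src_lt _ _ _ (Nat.lt_succ_self _)] at h1
  have h3 := congrArg (fun x => coord x c.succ) h1
  simp only [model_src_val, gen_val, genVal_self] at h3
  unfold pairSrc at h3; grind

lemma diskTable_idempotent {k : ℕ} (f : (diskTable k).theta ⟶ (diskTable k).theta) :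
    f ≫ f = f := by
  refine diskTable_hom_ext ?_
  obtain ⟨⟨j, b⟩, -, h⟩ := exists_globe_top (f.toFun (top k))
  rw [comp_toFun, h, map_globe, h]
  cases b <;> simp [src_src_self, tgt_tgt_self]

end DimTable

/-! ### Joyal's category: disks, rigidity and orientation reversal -/

namespace StrictOmegaCat

lemma globe_eq_self {C : StrictOmegaCat} {k j : ℕ} (hkj : k ≤ j) {x : C.Arr} (h : C.src k x = x)
    (b : Bool) : globe x (j, b) = x := by
  cases b
  · rw [globe_false, src_eq_self hkj h]
  · rw [globe_true, tgt_eq_self (src_eq_self hkj h)]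

lemma globe_globe_of_lt {C : StrictOmegaCat} {i j : ℕ} (h : i < j) (x : C.Arr) (b b' : Bool) :
    globe (globe x (j, b)) (i, b') = globe x (i, b') := by
  cases b <;> cases b' <;>
    simp [C.src_src_lt _ _ _ h, C.src_tgt_lt _ _ _ h, C.tgt_src_lt _ _ _ h, C.tgt_tgt_lt _ _ _ h]

lemma src_globe {C : StrictOmegaCat} (x : C.Arr) (q : ℕ × Bool) :
    C.src q.1 (globe x q) = globe x q := by
  rw [← globe_pairSrc, pairSrc, if_pos le_rfl]

lemma reverse_src_eq_globe {C : StrictOmegaCat} (r : ℕ → Bool) (j : ℕ) (x : C.Arr) :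
    (C.reverse r).src j x = globe x (j, r j) := by
  simp [reverse, globe]

lemma reverse_tgt_eq_globe {C : StrictOmegaCat} (r : ℕ → Bool) (j : ℕ) (x : C.Arr) :
    (C.reverse r).tgt j x = globe x (j, !r j) := by
  cases h : r j <;> simp [reverse, globe, h]

/-- Two reversals compose to the reversal for the symmetric difference. -/
def reverseReverseHom {r r' r'' : ℕ → Bool} (h : ∀ j, r'' j = (r j ^^ r' j)) (C : StrictOmegaCat) :
    (C.reverse r).reverse r' ⟶ C.reverse r'' where
  toFun x := x
  map_src i x := by
    cases h1 : r i <;> cases h2 : r' i <;> simp [reverse, h, h1, h2]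
  map_tgt i x := by
    cases h1 : r i <;> cases h2 : r' i <;> simp [reverse, h, h1, h2]
  map_comp i x y _ _ := by
    cases h1 : r i <;> cases h2 : r' i <;> simp [reverse, h, h1, h2]

/-- The trivial reversal. -/
def reverseFalseHom {r : ℕ → Bool} (h : ∀ j, r j = false) (C : StrictOmegaCat) :
    C.reverse r ⟶ C where
  toFun x := x
  map_src i x := by simp [reverse, h]
  map_tgt i x := by simp [reverse, h]
  map_comp i x y _ _ := by simp [reverse, h]

lemma isIso_reverseReverseHom {r r' r'' : ℕ → Bool} (h : ∀ j, r'' j = (r j ^^ r' j)) (C : StrictOmegaCat) :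
    IsIso (reverseReverseHom h C) :=
  isIso_of_bijective _ Function.bijective_id

lemma isIso_reverseFalseHom {r : ℕ → Bool} (h : ∀ j, r j = false) (C : StrictOmegaCat) :
    IsIso (reverseFalseHom h C) :=
  isIso_of_bijective _ Function.bijective_id

end StrictOmegaCat

open StrictOmegaCat

namespace ZTwoPow

variable {n : ℕ∞}

lemma flips_zero (j : ℕ) : (0 : ZTwoPow n).flips j = false := by
  simp [flips]

lemma flips_add (δ δ' : ZTwoPow n) (j : ℕ) :
    (δ + δ').flips j = (δ.flips j ^^ δ'.flips j) := by
  by_cases h : 1 ≤ j + 1 ∧ ((j + 1 : ℕ) : ℕ∞) ≤ n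
  · have key : ∀ a b : ZMod 2, (a + b = 1) ↔ ¬ ((a = 1) ↔ (b = 1)) := by decide
    have e : ∀ ε : ZTwoPow n, ε.flips j = true ↔ ε ⟨j + 1, h⟩ = 1 := fun ε => by
      simp only [flips, decide_eq_true_eq]
      exact ⟨fun ⟨_, h⟩ => h, fun h' => ⟨h, h'⟩⟩
    have h1 := e δ
    have h2 := e δ'
    have h3 := e (δ + δ')
    rw [Pi.add_apply, key, ← h1, ← h2] at h3
    cases h4 : δ.flips j <;> cases h5 : δ'.flips j <;> cases h6 : (δ + δ').flips j <;>
      simp [h4, h5, h6] at h3 ⊢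
  · have e : ∀ ε : ZTwoPow n, ε.flips j = false := fun ε => by
      simp only [flips, decide_eq_false_iff_not]
      exact fun ⟨h', _⟩ => h h'
    simp [e]

lemma flips_injective {δ δ' : ZTwoPow n}
    (h : ∀ j : ℕ, ((j + 1 : ℕ) : ℕ∞) ≤ n → δ.flips j = δ'.flips j) : δ = δ' := by
  funext ⟨i, hi⟩
  obtain ⟨j, rfl⟩ : ∃ j, i = j + 1 := ⟨i - 1, by omega⟩
  have e : ∀ ε : ZTwoPow n, ε.flips j = true ↔ ε ⟨j + 1, hi⟩ = 1 := fun ε => by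
    simp only [flips, decide_eq_true_eq]
    exact ⟨fun ⟨_, h⟩ => h, fun h' => ⟨hi, h'⟩⟩
  have h1 := e δ
  rw [h j hi.2, e δ'] at h1
  have key : ∀ a b : ZMod 2, (a = 1 ↔ b = 1) → b = a := by decide
  exact key _ _ h1

lemma exists_flips_eq (r : ℕ → Bool) :
    ∃ δ : ZTwoPow n, ∀ j : ℕ, ((j + 1 : ℕ) : ℕ∞) ≤ n → δ.flips j = r j := by
  refine ⟨fun i => if r (i.1 - 1) = true then 1 else 0, fun j hj => ?_⟩
  rw [Bool.eq_iff_iff]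
  simp only [flips, decide_eq_true_eq]
  simp only [Nat.add_sub_cancel, ite_eq_left_iff, zero_ne_one, imp_false, not_not]
  exact ⟨fun ⟨_, h⟩ => h, fun h => ⟨⟨by omega, hj⟩, h⟩⟩

lemma add_self (δ : ZTwoPow n) : δ + δ = 0 := by
  funext i
  have key : ∀ a : ZMod 2, a + a = 0 := by decide
  exact key _

end ZTwoPow

section Reversal

variable {n : ℕ∞}

/-- Composition of reversals corresponds to addition. -/
noncomputable def opNCatCompIso (δ δ' : ZTwoPow n) : opNCat δ ⋙ opNCat δ' ≅ opNCat (δ + δ') :=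
  NatIso.ofComponents (fun C => (StrictOmegaCat.IsNCat n).isoMk
    (@asIso _ _ _ _ _ (isIso_reverseReverseHom (ZTwoPow.flips_add δ δ') C.obj))) (fun _ => rfl)

/-- The reversal for `0` is the identity. -/
noncomputable def opNCatZeroIso : opNCat (0 : ZTwoPow n) ≅ 𝟭 (NCat n) :=
  NatIso.ofComponents (fun C => (StrictOmegaCat.IsNCat n).isoMk
    (@asIso _ _ _ _ _ (isIso_reverseFalseHom ZTwoPow.flips_zero C.obj))) (fun _ => rfl)

end Reversal

namespace Theta

variable {n : ℕ∞}

/-- The strict `ω`-category underlying an object of `Θ_n`. -/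
noncomputable abbrev cat (X : Theta n) : StrictOmegaCat := (thetaObj n X).obj

/-- The action of a morphism of `Θ_n` on arrows. -/
noncomputable def ap {X Y : Theta n} (f : X ⟶ Y) (x : X.cat.Arr) : Y.cat.Arr := f.hom.hom.toFun x

/-- The morphism of `Θ_n` given by a strict `ω`-functor. -/
noncomputable def ofHom {X Y : Theta n} (φ : X.cat ⟶ Y.cat) : X ⟶ Y :=
  InducedCategory.homMk (ObjectProperty.homMk φ)

@[simp] lemma ap_id (X : Theta n) (x : X.cat.Arr) : ap (𝟙 X) x = x := rfl

@[simp] lemma ap_comp {X Y Z : Theta n} (f : X ⟶ Y) (g : Y ⟶ Z) (x : X.cat.Arr) :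
    ap (f ≫ g) x = ap g (ap f x) := rfl

lemma ap_src {X Y : Theta n} (f : X ⟶ Y) (j : ℕ) (x : X.cat.Arr) :
    ap f (X.cat.src j x) = Y.cat.src j (ap f x) := f.hom.hom.map_src j x

lemma ap_globe {X Y : Theta n} (f : X ⟶ Y) (x : X.cat.Arr) (q : ℕ × Bool) :
    ap f (globe x q) = globe (ap f x) q := map_globe f.hom.hom x q

lemma hom_ext {X Y : Theta n} {f g : X ⟶ Y} (h : f.hom.hom = g.hom.hom) : f = g :=
  InducedCategory.hom_ext (ObjectProperty.hom_ext _ h)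

lemma isIso_hom_hom {X Y : Theta n} (f : X ⟶ Y) [IsIso f] : IsIso f.hom.hom :=
  inferInstanceAs (IsIso ((StrictOmegaCat.IsNCat n).ι.map ((thetaIncl n).map f)))

/-- `Θ_n` is skeletal. -/
lemma eq_of_isIso {X Y : Theta n} (f : X ⟶ Y) [IsIso f] : X = Y :=
  have := isIso_hom_hom f
  Subtype.ext (@DimTable.eq_of_theta_iso _ _ f.hom.hom this)

/-- The objects of `Θ_n` have no automorphisms. -/
lemma eq_eqToHom_of_isIso {X Y : Theta n} (f : X ⟶ Y) [IsIso f] (h : X = Y) : f = eqToHom h := by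
  subst h
  have := isIso_hom_hom f
  exact hom_ext (@DimTable.theta_eq_id_of_isIso _ f.hom.hom this)

/-- Isomorphic functors to `Θ_n` are equal, the isomorphism being the identity. -/
lemma exists_eq_eqToHom_of_isIso {C : Type*} [Category C] {F G : C ⥤ Theta n} (γ : F ⟶ G)
    [IsIso γ] : ∃ h : F = G, γ = eqToHom h := by
  have hobj : ∀ X, F.obj X = G.obj X := fun X => eq_of_isIso (γ.app X)
  have happ : ∀ X, γ.app X = eqToHom (hobj X) := fun X => eq_eqToHom_of_isIso _ _
  have h : F = G := by
    refine CategoryTheory.Functor.ext hobj fun X Y f => ?_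
    have := γ.naturality f
    rw [happ, happ] at this
    rw [← Category.assoc, ← this]
    simp
  refine ⟨h, ?_⟩
  ext X : 2
  rw [happ, eqToHom_app]

lemma eq_of_iso {C : Type*} [Category C] {F G : C ⥤ Theta n} (e : F ≅ G) : F = G :=
  (exists_eq_eqToHom_of_isIso e.hom).1

/-- The `k`-disk as an object of `Θ_n`. -/
def D (k : ℕ) (hk : (k : ℕ∞) ≤ n) : Theta n :=
  (⟨DimTable.diskTable k, by rwa [DimTable.height_diskTable]⟩ :
    {T : DimTable // (T.height : ℕ∞) ≤ n})

/-- The principal arrow of the `k`-disk. -/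
noncomputable def top (k : ℕ) (hk : (k : ℕ∞) ≤ n) : (D k hk).cat.Arr := DimTable.top k

lemma src_top (k : ℕ) (hk : (k : ℕ∞) ≤ n) : (D k hk).cat.src k (top k hk) = top k hk :=
  DimTable.src_top k

lemma D_hom_ext {k : ℕ} {hk : (k : ℕ∞) ≤ n} {X : Theta n} {f g : D k hk ⟶ X}
    (h : ap f (top k hk) = ap g (top k hk)) : f = g :=
  hom_ext (DimTable.diskTable_hom_ext h)

lemma exists_arrow {k : ℕ} (hk : (k : ℕ∞) ≤ n) {X : Theta n} {x : X.cat.Arr}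
    (hx : X.cat.src k x = x) : ∃ f : D k hk ⟶ X, ap f (top k hk) = x := by
  obtain ⟨φ, h⟩ := DimTable.exists_diskTable_hom hx
  exact ⟨ofHom φ, h⟩

/-- The morphism from the `k`-disk that corresponds to a `k`-arrow. -/
noncomputable def arrow {k : ℕ} (hk : (k : ℕ∞) ≤ n) {X : Theta n} (x : X.cat.Arr)
    (hx : X.cat.src k x = x) : D k hk ⟶ X := (exists_arrow hk hx).choose

@[simp] lemma ap_arrow {k : ℕ} (hk : (k : ℕ∞) ≤ n) {X : Theta n} (x : X.cat.Arr)
    (hx : X.cat.src k x = x) : ap (arrow hk x hx) (top k hk) = x := (exists_arrow hk hx).choose_spec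

lemma src_ap_top {k : ℕ} {hk : (k : ℕ∞) ≤ n} {X : Theta n} (f : D k hk ⟶ X) :
    X.cat.src k (ap f (top k hk)) = ap f (top k hk) := by
  rw [← ap_src, src_top]

lemma exists_globe_top {k : ℕ} {hk : (k : ℕ∞) ≤ n} (x : (D k hk).cat.Arr) :
    ∃ q : ℕ × Bool, (q.1 < k ∨ q = (k, false)) ∧ x = globe (top k hk) q :=
  DimTable.exists_globe_top x

lemma globe_top_injective {k : ℕ} {hk : (k : ℕ∞) ≤ n} {q q' : ℕ × Bool}
    (hq : q.1 < k ∨ q = (k, false)) (hq' : q'.1 < k ∨ q' = (k, false))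
    (h : globe (top k hk) q = globe (top k hk) q') : q = q' :=
  DimTable.globe_top_injective hq hq' h

/-- Every arrow is a `k`-arrow for some `k ≤ n`. -/
lemma exists_dim {X : Theta n} (x : X.cat.Arr) :
    ∃ k : ℕ, (k : ℕ∞) ≤ n ∧ X.cat.src k x = x := by
  obtain ⟨k, hk⟩ := X.cat.finite_dim x
  rcases le_total (k : ℕ∞) n with h | h
  · exact ⟨k, h, hk⟩
  · obtain ⟨m, rfl⟩ := ENat.ne_top_iff_exists.1 (ne_top_of_le_ne_top (ENat.natCast_ne_top k) h)
    exact ⟨m, le_rfl, (thetaObj _ X).property m le_rfl x⟩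

/-- The morphism of disks picking out the `j`-dimensional source or target. -/
noncomputable def face (b : Bool) {j k : ℕ} (hj : (j : ℕ∞) ≤ n) (hk : (k : ℕ∞) ≤ n) :
    D j hj ⟶ D k hk := arrow hj (globe (top k hk) (j, b)) (src_globe (top k hk) (j, b))

@[simp] lemma ap_face (b : Bool) {j k : ℕ} (hj : (j : ℕ∞) ≤ n) (hk : (k : ℕ∞) ≤ n) :
    ap (face b hj hk) (top j hj) = globe (top k hk) (j, b) := ap_arrow hj _ _

/-- The orientation reversal `op_δ` on `Θ_n`, up to isomorphism. -/
lemma exists_op (δ : ZTwoPow n) :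
    ∃ P : Theta n ⥤ Theta n, Nonempty (P ⋙ thetaIncl n ≅ thetaIncl n ⋙ opNCat δ) := by
  have h : ∀ X : Theta n, (thetaIncl n).essImage ((thetaIncl n ⋙ opNCat δ).obj X) := fun X => by
    obtain ⟨T, hT, ⟨e⟩⟩ := DimTable.exists_reverse_theta_iso X.1 δ.flips
    have hTn : (T.height : ℕ∞) ≤ n := le_trans (by exact_mod_cast hT) X.2
    exact ⟨(⟨T, hTn⟩ : {T : DimTable // (T.height : ℕ∞) ≤ n}), ⟨(StrictOmegaCat.IsNCat n).isoMk e⟩⟩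
  exact ⟨Functor.essImage.liftFunctor _ _ h, ⟨Functor.essImage.liftFunctorCompIso _ _ h⟩⟩

/-- The map on arrows underlying a component of a natural transformation between reversals. -/
noncomputable def appFun {δ δ' : ZTwoPow n} (η : thetaIncl n ⋙ opNCat δ ⟶ thetaIncl n ⋙ opNCat δ')
    (X : Theta n) (x : X.cat.Arr) : X.cat.Arr := (η.app X).hom.toFun x

section NatTrans

variable {δ δ' : ZTwoPow n} (η : thetaIncl n ⋙ opNCat δ ⟶ thetaIncl n ⋙ opNCat δ')

lemma appFun_ap {X Y : Theta n} (f : X ⟶ Y) (x : X.cat.Arr) :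
    appFun η Y (ap f x) = ap f (appFun η X x) :=
  congrArg (fun g : (thetaIncl n ⋙ opNCat δ).obj X ⟶ (thetaIncl n ⋙ opNCat δ').obj Y =>
    Hom.toFun g.hom x) (η.naturality f)

lemma appFun_globe {X : Theta n} (x : X.cat.Arr) (j : ℕ) (b : Bool) :
    appFun η X (globe x (j, δ.flips j ^^ b)) = globe (appFun η X x) (j, δ'.flips j ^^ b) := by
  cases b
  · have h : appFun η X ((X.cat.reverse δ.flips).src j x) =
      (X.cat.reverse δ'.flips).src j (appFun η X x) := (η.app X).hom.map_src j x
    rw [reverse_src_eq_globe, reverse_src_eq_globe] at h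
    simpa using h
  · have h : appFun η X ((X.cat.reverse δ.flips).tgt j x) =
      (X.cat.reverse δ'.flips).tgt j (appFun η X x) := (η.app X).hom.map_tgt j x
    rw [reverse_tgt_eq_globe, reverse_tgt_eq_globe] at h
    simpa using h

/-- A natural transformation between reversals preserves the principal arrow of every disk: by
induction on the dimension, since this arrow is the only nondegenerate one with its boundary. As it
also preserves the boundary, the reversals agree. -/
lemma appFun_top (k : ℕ) (hk : (k : ℕ∞) ≤ n) :
    appFun η (D k hk) (top k hk) = top k hk ∧ ∀ j < k, δ.flips j = δ'.flips j := by
  induction k with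
  | zero =>
    refine ⟨?_, fun j hj => absurd hj (Nat.not_lt_zero _)⟩
    obtain ⟨q, hq, h⟩ := exists_globe_top (hk := hk) (appFun η (D 0 hk) (top 0 hk))
    rw [h, show q = (0, false) by simpa using hq, globe_false, src_top]
  | succ k ih =>
    have hk' : (k : ℕ∞) ≤ n := le_trans (by exact_mod_cast k.le_succ) hk
    obtain ⟨ih1, ih2⟩ := ih hk'
    have hb : ∀ b, globe (top (k + 1) hk) (k, δ.flips k ^^ b) =
        globe (appFun η (D (k + 1) hk) (top (k + 1) hk)) (k, δ'.flips k ^^ b) := fun b => by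
      rw [← appFun_globe, ← ap_face _ hk' hk, appFun_ap, ih1]
    obtain ⟨q, hq, hz⟩ := exists_globe_top (hk := hk) (appFun η (D (k + 1) hk) (top (k + 1) hk))
    rcases hq with hq | rfl
    · exfalso
      simp only [hz, globe_eq_self (Nat.lt_succ_iff.1 hq) (src_globe _ _)] at hb
      have := globe_top_injective (Or.inl (Nat.lt_succ_self k)) (Or.inl (Nat.lt_succ_self k))
        ((hb false).trans (hb true).symm)
      simp at this
    · rw [globe_false, src_top] at hz
      refine ⟨hz, fun j hj => ?_⟩
      rcases (Nat.lt_succ_iff.1 hj).eq_or_lt with rfl | hj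
      · rw [hz] at hb
        have := globe_top_injective (Or.inl (Nat.lt_succ_self j)) (Or.inl (Nat.lt_succ_self j))
          (hb false)
        simpa using this
      · exact ih2 j hj

end NatTrans

lemma eq_of_natTrans_op {δ δ' : ZTwoPow n}
    (η : thetaIncl n ⋙ opNCat δ ⟶ thetaIncl n ⋙ opNCat δ') : δ = δ' :=
  ZTwoPow.flips_injective fun j hj => (appFun_top η (j + 1) hj).2 j (Nat.lt_succ_self j)

lemma isIso_natTrans_op {δ δ' : ZTwoPow n}
    (η : thetaIncl n ⋙ opNCat δ ⟶ thetaIncl n ⋙ opNCat δ') : IsIso η := by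
  have hid : ∀ X, appFun η X = id := fun X => by
    funext x
    obtain ⟨k, hk, hx⟩ := exists_dim (X := X) x
    rw [← ap_arrow hk x hx, appFun_ap, (appFun_top η k hk).1, id]
  have : ∀ X, IsIso (η.app X) := fun X => by
    rw [← ObjectProperty.isIso_hom_iff]
    refine isIso_of_bijective _ ?_
    change Function.Bijective (appFun η X)
    rw [hid]
    exact Function.bijective_id
  exact NatIso.isIso_of_isIso_app η

/-- A natural transformation between two reversals of `Θ_n` is an identity. -/
lemma natTrans_eq_eqToHom {δ δ' : ZTwoPow n} {P Q : Theta n ⥤ Theta n}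
    (e : P ⋙ thetaIncl n ≅ thetaIncl n ⋙ opNCat δ)
    (e' : Q ⋙ thetaIncl n ≅ thetaIncl n ⋙ opNCat δ') (γ : P ⟶ Q) :
    ∃ h : P = Q, γ = eqToHom h := by
  have := isIso_natTrans_op (e.inv ≫ Functor.whiskerRight γ (thetaIncl n) ≫ e'.hom)
  have h1 : IsIso (Functor.whiskerRight γ (thetaIncl n)) := by
    have h2 : Functor.whiskerRight γ (thetaIncl n) =
      e.hom ≫ (e.inv ≫ Functor.whiskerRight γ (thetaIncl n) ≫ e'.hom) ≫ e'.inv := by simp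
    rw [h2]
    infer_instance
  have h3 : ∀ X, IsIso (γ.app X) := fun X => by
    have : IsIso ((thetaIncl n).map (γ.app X)) :=
      inferInstanceAs (IsIso ((Functor.whiskerRight γ (thetaIncl n)).app X))
    exact isIso_of_reflects_iso (γ.app X) (thetaIncl n)
  have := NatIso.isIso_of_isIso_app γ
  exact exists_eq_eqToHom_of_isIso γ

lemma eq_of_iso_comp_thetaIncl {P Q : Theta n ⥤ Theta n}
    (e : P ⋙ thetaIncl n ≅ Q ⋙ thetaIncl n) : P = Q :=
  eq_of_iso ((Functor.FullyFaithful.ofFullyFaithful (thetaIncl n)).whiskeringRight _ |>.preimageIso e)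

end Theta

/-! ### Autoequivalences preserve disks -/

open StrictOmegaCat

lemma DimTable.exists_eq_diskTable {T : DimTable} (h : ∀ f : T.theta ⟶ T.theta, f ≫ f = f) :
    ∃ k, T = DimTable.diskTable k := by
  have h0 : T.gaps = 0 := by
    by_contra h0
    obtain ⟨f, hf⟩ := T.exists_not_idempotent ⟨0, Nat.pos_of_ne_zero h0⟩
    refine hf ?_
    have h1 := congrArg (fun φ => T.thetaIso.inv ≫ φ ≫ T.thetaIso.hom)
      (h (T.thetaIso.hom ≫ f ≫ T.thetaIso.inv))
    simpa using h1
  obtain ⟨g, upper, lower, h1, h2⟩ := T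
  obtain rfl : g = 0 := h0
  refine ⟨upper 0, ?_⟩
  have hu : upper = fun _ => upper 0 :=
    funext fun i => congrArg upper (Subsingleton.elim (α := Fin 1) i 0)
  have hl : lower = Fin.elim0 := funext fun c => c.elim0
  subst hl
  unfold diskTable
  congr

namespace Theta

variable {n : ℕ∞}

lemma natCard_end_D (k : ℕ) (hk : (k : ℕ∞) ≤ n) : Nat.card (D k hk ⟶ D k hk) = 2 * k + 1 := by
  rw [← DimTable.natCard_diskTable k]
  refine Nat.card_congr (Equiv.ofBijective (fun f => ap f (top k hk)) ⟨fun f g h => D_hom_ext h,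
    fun x => exists_arrow hk (X := D k hk) (DimTable.isNCat_diskTable k k le_rfl x)⟩)

variable (P : Theta n ⥤ Theta n) [P.Full] [P.Faithful]

/-- A fully faithful endofunctor of `Θ_n` preserves disks: these are the objects all of whose
endomorphisms are idempotent, and the number of endomorphisms determines the dimension. -/
lemma obj_D (k : ℕ) (hk : (k : ℕ∞) ≤ n) : P.obj (D k hk) = D k hk := by
  have hidem : ∀ f : P.obj (D k hk) ⟶ P.obj (D k hk), f ≫ f = f := fun f => by
    obtain ⟨g, rfl⟩ := P.map_surjective f
    rw [← P.map_comp]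
    exact congrArg P.map (hom_ext (DimTable.diskTable_idempotent g.hom.hom))
  obtain ⟨l, hl⟩ := DimTable.exists_eq_diskTable (T := (P.obj (D k hk)).1) fun φ =>
    congrArg (fun f : P.obj (D k hk) ⟶ P.obj (D k hk) => f.hom.hom) (hidem (ofHom φ))
  have hln : (l : ℕ∞) ≤ n := by
    have := (P.obj (D k hk)).2
    rwa [hl, DimTable.height_diskTable] at this
  have hobj : P.obj (D k hk) = D l hln := Subtype.ext hl
  have hcard : Nat.card (D k hk ⟶ D k hk) = Nat.card (P.obj (D k hk) ⟶ P.obj (D k hk)) :=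
    Nat.card_congr (Functor.FullyFaithful.ofFullyFaithful P).homEquiv
  rw [hobj, natCard_end_D, natCard_end_D] at hcard
  obtain rfl : k = l := by omega
  exact hobj

/-- The principal arrow of the image of a disk. -/
noncomputable def imTop (k : ℕ) (hk : (k : ℕ∞) ≤ n) : (P.obj (D k hk)).cat.Arr :=
  ap (eqToHom (obj_D P k hk).symm) (top k hk)

lemma ap_eqToHom_imTop {k : ℕ} {hk : (k : ℕ∞) ≤ n} :
    ap (eqToHom (obj_D P k hk)) (imTop P k hk) = top k hk := by
  rw [imTop, ← ap_comp, eqToHom_trans, eqToHom_refl, ap_id]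

lemma src_imTop (k : ℕ) (hk : (k : ℕ∞) ≤ n) :
    (P.obj (D k hk)).cat.src k (imTop P k hk) = imTop P k hk :=
  src_ap_top _

variable {P}

lemma exists_globe_imTop {k : ℕ} {hk : (k : ℕ∞) ≤ n} (x : (P.obj (D k hk)).cat.Arr) :
    ∃ q : ℕ × Bool, (q.1 < k ∨ q = (k, false)) ∧ x = globe (imTop P k hk) q := by
  obtain ⟨q, hq, h⟩ := exists_globe_top (ap (eqToHom (obj_D P k hk)) x)
  refine ⟨q, hq, ?_⟩
  have := congrArg (ap (eqToHom (obj_D P k hk).symm)) h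
  rwa [ap_globe, ← ap_comp, eqToHom_trans, eqToHom_refl, ap_id] at this

lemma globe_imTop_injective {k : ℕ} {hk : (k : ℕ∞) ≤ n} {q q' : ℕ × Bool}
    (hq : q.1 < k ∨ q = (k, false)) (hq' : q'.1 < k ∨ q' = (k, false))
    (h : globe (imTop P k hk) q = globe (imTop P k hk) q') : q = q' := by
  have := congrArg (ap (eqToHom (obj_D P k hk))) h
  rw [ap_globe, ap_globe, ap_eqToHom_imTop] at this
  exact globe_top_injective hq hq' this

lemma map_D_hom_ext {k : ℕ} {hk : (k : ℕ∞) ≤ n} {X : Theta n} {f g : D k hk ⟶ X}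
    (h : ap (P.map f) (imTop P k hk) = ap (P.map g) (imTop P k hk)) : f = g := by
  refine P.map_injective ((cancel_epi (eqToHom (obj_D P k hk).symm)).1 (D_hom_ext ?_))
  exact h

lemma exists_map_D {k : ℕ} (hk : (k : ℕ∞) ≤ n) {X : Theta n} {y : (P.obj X).cat.Arr}
    (hy : (P.obj X).cat.src k y = y) : ∃ f : D k hk ⟶ X, ap (P.map f) (imTop P k hk) = y := by
  obtain ⟨g, hg⟩ := exists_arrow hk hy
  obtain ⟨f, hf⟩ := P.map_surjective (eqToHom (obj_D P k hk) ≫ g)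
  exact ⟨f, by rw [hf, ap_comp, ap_eqToHom_imTop, hg]⟩

/-! ### The action of an autoequivalence on arrows -/

/-- The morphism of disks exhibiting a principal arrow as an identity. -/
noncomputable def degen {j k : ℕ} (h : j ≤ k) (hj : (j : ℕ∞) ≤ n) (hk : (k : ℕ∞) ≤ n) :
    D k hk ⟶ D j hj := arrow hk (top j hj) (src_eq_self h (src_top j hj))

lemma ap_degen {j k : ℕ} (h : j ≤ k) (hj : (j : ℕ∞) ≤ n) (hk : (k : ℕ∞) ≤ n) :
    ap (degen h hj hk) (top k hk) = top j hj := ap_arrow hk _ _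

variable (P) in
/-- The functor `P` preserves degeneracies, since these are retractions. -/
lemma map_degen_imTop {j k : ℕ} (h : j ≤ k) (hj : (j : ℕ∞) ≤ n) (hk : (k : ℕ∞) ≤ n) :
    ap (P.map (degen h hj hk)) (imTop P k hk) = imTop P j hj := by
  have hid : face false hj hk ≫ degen h hj hk = 𝟙 _ := D_hom_ext (by
    rw [ap_comp, ap_face, ap_globe, ap_degen, globe_false, src_top, ap_id])
  obtain ⟨q, hq, h1⟩ := exists_globe_imTop (ap (P.map (degen h hj hk)) (imTop P k hk))
  obtain ⟨q', hq', h2⟩ := exists_globe_imTop (ap (P.map (face false hj hk)) (imTop P j hj))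
  have h3 : imTop P j hj = globe (globe (imTop P j hj) q) q' := by
    rw [← h1, ← ap_globe, ← h2, ← ap_comp, ← P.map_comp, hid, P.map_id, ap_id]
  have htop : globe (imTop P j hj) (j, false) = imTop P j hj := by
    rw [globe_false, src_imTop]
  rcases hq with hq | rfl
  · exfalso
    -- a proper face of the principal arrow has smaller dimension, and so have its own faces
    have h4 : (P.obj (D j hj)).cat.src q.1 (imTop P j hj) = imTop P j hj := by
      rw [h3, ← globe_pairSrc, pairSrc]
      split_ifs with h5
      · rfl
      · rw [globe_false, src_globe, globe_eq_self (le_of_not_ge h5) (src_globe _ _)]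
    have := globe_imTop_injective (q := (q.1, false)) (Or.inl hq) (Or.inr rfl)
      (((globe_false _ _).trans h4).trans htop.symm)
    simp only [Prod.mk.injEq] at this
    exact hq.ne this.1
  · rw [h1, htop]

variable (P) in
/-- The map on arrows induced by `P`, obtained from the action of `P` on morphisms out of disks. -/
noncomputable def onArr (X : Theta n) (x : X.cat.Arr) : (P.obj X).cat.Arr :=
  ap (P.map (arrow (exists_dim x).choose_spec.1 x (exists_dim x).choose_spec.2)) (imTop P _ _)

lemma map_imTop_eq {j k : ℕ} {hj : (j : ℕ∞) ≤ n} {hk : (k : ℕ∞) ≤ n} {X : Theta n}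
    {f : D j hj ⟶ X} {g : D k hk ⟶ X} (h : ap f (top j hj) = ap g (top k hk)) :
    ap (P.map f) (imTop P j hj) = ap (P.map g) (imTop P k hk) := by
  wlog hjk : j ≤ k generalizing j k
  · exact (this h.symm (le_of_not_ge hjk)).symm
  have : degen hjk hj hk ≫ f = g := D_hom_ext (by rw [ap_comp, ap_degen, h])
  rw [← this, P.map_comp, ap_comp, map_degen_imTop]

lemma onArr_ap_top {k : ℕ} {hk : (k : ℕ∞) ≤ n} {X : Theta n} (f : D k hk ⟶ X) :
    onArr P X (ap f (top k hk)) = ap (P.map f) (imTop P k hk) :=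
  map_imTop_eq (ap_arrow _ _ _)

lemma onArr_ap {X Y : Theta n} (g : X ⟶ Y) (x : X.cat.Arr) :
    onArr P Y (ap g x) = ap (P.map g) (onArr P X x) := by
  obtain ⟨k, hk, hx⟩ := exists_dim x
  obtain ⟨f, rfl⟩ := exists_arrow hk hx
  rw [← ap_comp, onArr_ap_top, onArr_ap_top, P.map_comp, ap_comp]

lemma src_onArr {k : ℕ} (hk : (k : ℕ∞) ≤ n) {X : Theta n} {x : X.cat.Arr}
    (hx : X.cat.src k x = x) : (P.obj X).cat.src k (onArr P X x) = onArr P X x := by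
  obtain ⟨f, rfl⟩ := exists_arrow hk hx
  rw [onArr_ap_top, ← ap_src, src_imTop]

lemma onArr_injective (X : Theta n) : Function.Injective (onArr P X) := fun x y h => by
  obtain ⟨k, hk, hx⟩ := exists_dim x
  obtain ⟨l, hl, hy⟩ := exists_dim y
  wlog hkl : k ≤ l generalizing x y k l
  · exact (this y x h.symm l hl hy k hk hx (le_of_not_ge hkl)).symm
  obtain ⟨f, rfl⟩ := exists_arrow hl (src_eq_self hkl hx)
  obtain ⟨g, rfl⟩ := exists_arrow hl hy
  rw [onArr_ap_top, onArr_ap_top] at h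
  rw [map_D_hom_ext h]

lemma exists_onArr_eq {k : ℕ} (hk : (k : ℕ∞) ≤ n) {X : Theta n} {y : (P.obj X).cat.Arr}
    (hy : (P.obj X).cat.src k y = y) : ∃ x, X.cat.src k x = x ∧ onArr P X x = y := by
  obtain ⟨f, hf⟩ := exists_map_D hk hy
  exact ⟨_, src_ap_top f, by rw [onArr_ap_top, hf]⟩

lemma onArr_surjective (X : Theta n) : Function.Surjective (onArr P X) := fun y => by
  obtain ⟨k, hk, hy⟩ := exists_dim y
  obtain ⟨x, -, hx⟩ := exists_onArr_eq hk hy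
  exact ⟨x, hx⟩

lemma src_of_src_onArr {k : ℕ} (hk : (k : ℕ∞) ≤ n) {X : Theta n} {x : X.cat.Arr}
    (hx : (P.obj X).cat.src k (onArr P X x) = onArr P X x) : X.cat.src k x = x := by
  obtain ⟨x', h, h'⟩ := exists_onArr_eq hk hx
  rwa [onArr_injective X h'] at h

lemma isNCat_obj {k : ℕ} (hk : (k : ℕ∞) ≤ n) {X : Theta n} (h : IsNCat (k : ℕ∞) X.cat) :
    IsNCat (k : ℕ∞) (P.obj X).cat := fun l hl y => by
  obtain ⟨x, rfl⟩ := onArr_surjective X y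
  exact src_eq_self (by exact_mod_cast hl) (src_onArr hk (h k le_rfl x))

/-- In each dimension, `P` either preserves or exchanges the two faces of a disk. -/
lemma exists_onArr_face (j : ℕ) (hj : ((j + 1 : ℕ) : ℕ∞) ≤ n) :
    ∃ r : Bool, ∀ b, onArr P _ (globe (top (j + 1) hj) (j, b)) =
      globe (imTop P (j + 1) hj) (j, b ^^ r) := by
  have hj' : (j : ℕ∞) ≤ n := le_trans (by exact_mod_cast j.le_succ) hj
  have key : ∀ b, ∃ c, onArr P _ (globe (top (j + 1) hj) (j, b)) =
      globe (imTop P (j + 1) hj) (j, c) := fun b => by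
    obtain ⟨q, hq, h⟩ := exists_globe_imTop (onArr P _ (globe (top (j + 1) hj) (j, b)))
    rcases hq with hq | rfl
    · rcases (Nat.lt_succ_iff.1 hq).eq_or_lt with hq | hq
      · exact ⟨q.2, h.trans (congrArg _ (Prod.ext hq rfl))⟩
      · exfalso
        have hqn : (q.1 : ℕ∞) ≤ n := le_trans (by exact_mod_cast hq.le) hj'
        have h1 := src_of_src_onArr (P := P) (x := globe (top (j + 1) hj) (j, b)) hqn
          (by rw [h, src_globe])
        rw [← globe_false, globe_globe_of_lt hq] at h1
        have := globe_top_injective (Or.inl (by simp; omega)) (Or.inl (by simp)) h1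
        simp only [Prod.mk.injEq] at this
        exact hq.ne this.1
    · exfalso
      have h1 := src_onArr (P := P) hj' (src_globe (top (j + 1) hj) (j, b))
      rw [h, ← globe_false, globe_false _ (j + 1), src_imTop] at h1
      have := globe_imTop_injective (q' := (j + 1, false)) (Or.inl (by simp)) (Or.inr rfl)
        (h1.trans (by rw [globe_false, src_imTop]))
      simp at this
  obtain ⟨c, hc⟩ := key false
  obtain ⟨c', hc'⟩ := key true
  have hcc : c ≠ c' := by
    rintro rfl
    have := globe_top_injective (Or.inl (by simp)) (Or.inl (by simp))
      (onArr_injective _ (hc.trans hc'.symm))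
    simp at this
  refine ⟨c, fun b => ?_⟩
  cases b
  · simpa using hc
  · rw [hc']
    cases c <;> cases c' <;> simp_all

variable (P) in
/-- The functor `P` exchanges the `j`-dimensional faces of the disk of dimension `j + 1` precisely if
`r j` holds. -/
def FlipsFaces (r : ℕ → Bool) : Prop :=
  ∀ (j : ℕ) (hj : ((j + 1 : ℕ) : ℕ∞) ≤ n) (b : Bool),
    onArr P _ (globe (top (j + 1) hj) (j, b)) = globe (imTop P (j + 1) hj) (j, b ^^ r j)

variable (P) in
/-- The element `δ` belonging to `P`. -/
lemma exists_flipsFaces : ∃ δ : ZTwoPow n, FlipsFaces P δ.flips := by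
  have h : ∀ j : ℕ, ∃ r : Bool, ∀ (hj : ((j + 1 : ℕ) : ℕ∞) ≤ n) (b : Bool),
      onArr P _ (globe (top (j + 1) hj) (j, b)) = globe (imTop P (j + 1) hj) (j, b ^^ r) :=
    fun j => by
      by_cases hj : ((j + 1 : ℕ) : ℕ∞) ≤ n
      · obtain ⟨r, hr⟩ := exists_onArr_face (P := P) j hj
        exact ⟨r, fun _ => hr⟩
      · exact ⟨false, fun hj' => absurd hj' hj⟩
  choose r hr using h
  obtain ⟨δ, hδ⟩ := ZTwoPow.exists_flips_eq (n := n) r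
  exact ⟨δ, fun j hj b => by rw [hδ j hj]; exact hr j hj b⟩

lemma onArr_globe {r : ℕ → Bool} (hr : FlipsFaces P r)
    {X : Theta n} (x : X.cat.Arr) (j : ℕ) (b : Bool) :
    onArr P X (globe x (j, b)) = globe (onArr P X x) (j, b ^^ r j) := by
  obtain ⟨k, hk, hx⟩ := exists_dim x
  induction k generalizing x with
  | zero => rw [globe_eq_self j.zero_le hx, globe_eq_self j.zero_le (src_onArr hk hx)]
  | succ k ih =>
    have hk' : (k : ℕ∞) ≤ n := le_trans (by exact_mod_cast k.le_succ) hk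
    have hface : ∀ b, onArr P X (globe x (k, b)) = globe (onArr P X x) (k, b ^^ r k) := fun b => by
      obtain ⟨f, rfl⟩ := exists_arrow hk hx
      rw [← ap_globe, onArr_ap, hr, ap_globe, onArr_ap_top]
    rcases lt_trichotomy j k with hjk | rfl | hjk
    · rw [← globe_globe_of_lt hjk x false, ih _ hk' (src_globe x (k, false)), hface, globe_globe_of_lt hjk]
    · exact hface b
    · rw [globe_eq_self hjk hx, globe_eq_self hjk (src_onArr hk hx)]

end Theta

/-! ### Autoequivalences are reversals -/

open StrictOmegaCat

/-- A map that commutes with sources and targets and preserves the composites of `k`-arrows along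
`i`-arrows for `i < k` preserves the composites of all arrows up to the `k`-dimensional boundary. -/
lemma StrictOmegaCat.boundary_map_comp_eq {C R : StrictOmegaCat} {F : C.Arr → R.Arr}
    (hs : ∀ j x, F (C.src j x) = R.src j (F x)) (ht : ∀ j x, F (C.tgt j x) = R.tgt j (F x))
    {i k : ℕ} (hik : i ≤ k)
    (ih : ∀ x y, C.src k x = x → C.src k y = y → ∀ h h',
      F (C.comp i x y h) = R.comp i (F x) (F y) h')
    {x y : C.Arr} (h : C.tgt i x = C.src i y) (h' : R.tgt i (F x) = R.src i (F y)) :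
    R.src k (F (C.comp i x y h)) = R.src k (R.comp i (F x) (F y) h') ∧
      R.tgt k (F (C.comp i x y h)) = R.tgt k (R.comp i (F x) (F y) h') := by
  rw [← hs, ← ht]
  rcases hik.eq_or_lt with rfl | hik
  · simp only [src_comp_self, tgt_comp_self, hs, ht, and_self]
  · have h1 : C.tgt i (C.src k x) = C.src i (C.src k y) := by
      rw [C.tgt_src_lt _ _ _ hik, C.src_src_lt _ _ _ hik, h]
    have h2 : C.tgt i (C.tgt k x) = C.src i (C.tgt k y) := by
      rw [C.tgt_tgt_lt _ _ _ hik, C.src_tgt_lt _ _ _ hik, h]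
    have h1' : R.tgt i (R.src k (F x)) = R.src i (R.src k (F y)) := by
      rw [R.tgt_src_lt _ _ _ hik, R.src_src_lt _ _ _ hik, h']
    have h2' : R.tgt i (R.tgt k (F x)) = R.src i (R.tgt k (F y)) := by
      rw [R.tgt_tgt_lt _ _ _ hik, R.src_tgt_lt _ _ _ hik, h']
    rw [C.src_comp_lt _ _ _ _ _ h1 hik, C.tgt_comp_lt _ _ _ _ _ h2 hik,
      R.src_comp_lt _ _ _ _ _ h1' hik, R.tgt_comp_lt _ _ _ _ _ h2' hik,
      ih _ _ (C.src_src_self _ _) (C.src_src_self _ _) h1 (by rw [hs, hs, h1']),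
      ih _ _ (C.src_tgt_self _ _) (C.src_tgt_self _ _) h2 (by rw [ht, ht, h2'])]
    exact ⟨comp_congr (hs _ _) (hs _ _) _ _, comp_congr (ht _ _) (ht _ _) _ _⟩

/-- The table for two `k`-arrows that are composable along an `i`-arrow. -/
def DimTable.pair {i k : ℕ} (h : i < k) : DimTable := ⟨1, fun _ => k, fun _ => i, fun _ => h, fun _ => h⟩

namespace DimTable

lemma reverse_eq_of_src_eq_of_tgt_eq {T : DimTable} {k : ℕ} (hT : IsNCat ((k + 1 : ℕ) : ℕ∞) T.theta)
    {r : ℕ → Bool} {p q : T.theta.Arr} (h1 : (T.theta.reverse r).src k p = (T.theta.reverse r).src k q)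
    (h2 : (T.theta.reverse r).tgt k p = (T.theta.reverse r).tgt k q) : p = q := by
  rw [reverse_src_eq_globe, reverse_src_eq_globe] at h1
  rw [reverse_tgt_eq_globe, reverse_tgt_eq_globe] at h2
  cases h : r k
  · rw [h, globe_false, globe_false] at h1
    rw [h, Bool.not_false, globe_true, globe_true] at h2
    exact theta_eq_of_src_eq_of_tgt_eq hT h1 h2
  · rw [h, globe_true, globe_true] at h1
    rw [h, Bool.not_true, globe_false, globe_false] at h2
    exact theta_eq_of_src_eq_of_tgt_eq hT h2 h1

lemma height_pair {i k : ℕ} (h : i < k) : (pair h).height = k :=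
  Finset.sup_const Finset.univ_nonempty k

/-- The first of the two arrows, in diagrammatic order: it belongs to the right-hand disk. -/
noncomputable def pairFst {i k : ℕ} (h : i < k) : (pair h).theta.Arr :=
  thetaGen (T := pair h) (1 : Fin 2)

/-- The second of the two arrows, in diagrammatic order. -/
noncomputable def pairSnd {i k : ℕ} (h : i < k) : (pair h).theta.Arr :=
  thetaGen (T := pair h) (0 : Fin 2)

lemma tgt_pairFst {i k : ℕ} (h : i < k) :
    (pair h).theta.tgt i (pairFst h) = (pair h).theta.src i (pairSnd h) :=
  (src_lower_thetaGen (T := pair h) (0 : Fin 1)).symm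

lemma exists_pair_hom {i k : ℕ} (h : i < k) {C : StrictOmegaCat} {x y : C.Arr}
    (hx : C.src k x = x) (hy : C.src k y = y) (hxy : C.tgt i x = C.src i y) :
    ∃ φ : (pair h).theta ⟶ C, φ.toFun (pairFst h) = x ∧ φ.toFun (pairSnd h) = y := by
  obtain ⟨φ, hφ⟩ := exists_theta_hom (T := pair h) (E := C) (fun i : Fin 2 => if i = 0 then y else x)
    (fun i => by
      change C.src k _ = _
      split_ifs
      exacts [hy, hx])
    (fun c => by
      obtain rfl : c = (0 : Fin 1) := Subsingleton.elim (α := Fin 1) _ _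
      exact hxy.symm)
  exact ⟨φ, hφ (1 : Fin 2), hφ (0 : Fin 2)⟩

end DimTable

namespace Theta

/-- The universal pair of composable `k`-arrows as an object of `Θ_n`. -/
def pair {n : ℕ∞} {i k : ℕ} (h : i < k) (hk : (k : ℕ∞) ≤ n) : Theta n :=
  (⟨DimTable.pair h, by rwa [DimTable.height_pair]⟩ : {T : DimTable // (T.height : ℕ∞) ≤ n})

variable {n : ℕ∞} {P : Theta n ⥤ Theta n} [P.Full] [P.Faithful] {r : ℕ → Bool}

lemma onArr_src (hr : FlipsFaces P r) {X : Theta n} (j : ℕ) (x : X.cat.Arr) :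
    onArr P X (X.cat.src j x) = ((P.obj X).cat.reverse r).src j (onArr P X x) := by
  rw [reverse_src_eq_globe, ← globe_false, onArr_globe hr, Bool.false_xor]

lemma onArr_tgt (hr : FlipsFaces P r) {X : Theta n} (j : ℕ) (x : X.cat.Arr) :
    onArr P X (X.cat.tgt j x) = ((P.obj X).cat.reverse r).tgt j (onArr P X x) := by
  rw [reverse_tgt_eq_globe, ← globe_true, onArr_globe hr, Bool.true_xor]

/-- The map on arrows is compatible with composition. As it is natural, it suffices to consider the
universal composable pair of `k`-arrows, by induction on `k`; there the assertion is an equality of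
`k`-arrows in some `Θ(T)` of height at most `k`, and these are determined by their boundary. -/
lemma onArr_comp (hr : FlipsFaces P r) (k : ℕ) (hk : (k : ℕ∞) ≤ n) {X : Theta n} (i : ℕ)
    {x y : X.cat.Arr}
    (hx : X.cat.src k x = x) (hy : X.cat.src k y = y) (h : X.cat.tgt i x = X.cat.src i y)
    (h' : ((P.obj X).cat.reverse r).tgt i (onArr P X x) =
      ((P.obj X).cat.reverse r).src i (onArr P X y)) :
    onArr P X (X.cat.comp i x y h) =
      ((P.obj X).cat.reverse r).comp i (onArr P X x) (onArr P X y) h' := by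
  induction k generalizing X x y with
  | zero =>
    have hx' := src_eq_self i.zero_le hx
    rw [comp_eq_right h hx', comp_eq_right h' (by rw [← onArr_src hr, hx'])]
  | succ k ih =>
    have hk' : (k : ℕ∞) ≤ n := le_trans (by exact_mod_cast k.le_succ) hk
    rcases lt_or_ge i (k + 1) with hik | hik
    · let W : Theta n := pair hik hk
      obtain ⟨φ, hφ1, hφ2⟩ := DimTable.exists_pair_hom hik hx hy h
      obtain ⟨f, u, v, huv, rfl, rfl⟩ : ∃ (f : W ⟶ X) (u v : W.cat.Arr),
          W.cat.tgt i u = W.cat.src i v ∧ ap f u = x ∧ ap f v = y :=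
        ⟨ofHom φ, DimTable.pairFst hik, DimTable.pairSnd hik, DimTable.tgt_pairFst hik, hφ1, hφ2⟩
      have huv' : ((P.obj W).cat.reverse r).tgt i (onArr P W u) =
          ((P.obj W).cat.reverse r).src i (onArr P W v) :=
        (onArr_tgt hr i u).symm.trans ((congrArg _ huv).trans (onArr_src hr i v))
      have hPW : IsNCat ((k + 1 : ℕ) : ℕ∞) (P.obj W).cat :=
        isNCat_obj hk (DimTable.isNCat_theta (DimTable.pair hik) (by rw [DimTable.height_pair]))
      have hkey : onArr P W (W.cat.comp i u v huv) =
          ((P.obj W).cat.reverse r).comp i (onArr P W u) (onArr P W v) huv' := by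
        obtain ⟨hs, ht⟩ := boundary_map_comp_eq (R := (P.obj W).cat.reverse r) (F := onArr P W)
          (onArr_src hr) (onArr_tgt hr) (Nat.lt_succ_iff.1 hik)
          (fun x y hx hy h h' => ih hk' hx hy h h') huv huv'
        exact DimTable.reverse_eq_of_src_eq_of_tgt_eq hPW hs ht
      have h1 : X.cat.comp i (ap f u) (ap f v) h = ap f (W.cat.comp i u v huv) :=
        (f.hom.hom.map_comp _ _ _ _ _).symm
      have h2 : ((P.obj X).cat.reverse r).tgt i (ap (P.map f) (onArr P W u)) =
          ((P.obj X).cat.reverse r).src i (ap (P.map f) (onArr P W v)) := by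
        rwa [← onArr_ap, ← onArr_ap]
      have h3 : ap (P.map f) (((P.obj W).cat.reverse r).comp i (onArr P W u) (onArr P W v) huv') =
          ((P.obj X).cat.reverse r).comp i (ap (P.map f) (onArr P W u))
            (ap (P.map f) (onArr P W v)) h2 :=
        ((reverseFunctor r).map (P.map f).hom.hom).map_comp _ _ _ _ _
      rw [h1, onArr_ap, hkey, h3]
      exact comp_congr (C := (P.obj X).cat.reverse r) (onArr_ap f u).symm (onArr_ap f v).symm _ _
    · have hx' := src_eq_self hik hx
      rw [comp_eq_right h hx', comp_eq_right h' (by rw [← onArr_src hr, hx'])]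

/-- The map on arrows as a strict `ω`-functor to the reversal. -/
noncomputable def onArrHom (hr : FlipsFaces P r) (X : Theta n) : X.cat ⟶ (P.obj X).cat.reverse r where
  toFun := onArr P X
  map_src j x := onArr_src hr j x
  map_tgt j x := onArr_tgt hr j x
  map_comp i x y h h' := by
    obtain ⟨k, hk, hx⟩ := exists_dim x
    obtain ⟨l, hl, hy⟩ := exists_dim y
    rcases le_total k l with hkl | hkl
    · exact onArr_comp hr l hl i (src_eq_self hkl hx) hy h h'
    · exact onArr_comp hr k hk i hx (src_eq_self hkl hy) h h'

lemma isIso_onArrHom (hr : FlipsFaces P r) (X : Theta n) : IsIso (onArrHom hr X) :=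
  isIso_of_bijective _ ⟨onArr_injective X, onArr_surjective X⟩

variable (P) in
/-- A fully faithful endofunctor of `Θ_n` is a reversal. -/
lemma exists_comp_thetaIncl_iso :
    ∃ δ : ZTwoPow n, Nonempty (P ⋙ thetaIncl n ≅ thetaIncl n ⋙ opNCat δ) := by
  obtain ⟨δ, hδ⟩ := exists_flipsFaces P
  let e : thetaIncl n ≅ (P ⋙ thetaIncl n) ⋙ opNCat δ :=
    NatIso.ofComponents (fun X => (StrictOmegaCat.IsNCat n).isoMk
      (@asIso _ _ _ _ _ (isIso_onArrHom hδ X)))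
      (fun {X Y} f => ObjectProperty.hom_ext _ (StrictOmegaCat.hom_ext fun x => onArr_ap f x))
  -- reversing twice is the identity
  have e' : opNCat δ ⋙ opNCat δ ≅ 𝟭 (NCat n) :=
    opNCatCompIso δ δ ≪≫ eqToIso (by rw [ZTwoPow.add_self]) ≪≫ opNCatZeroIso
  exact ⟨δ, ⟨((Functor.isoWhiskerRight e (opNCat δ)) ≪≫ Functor.associator _ _ _ ≪≫
    Functor.isoWhiskerLeft _ e' ≪≫ Functor.rightUnitor _).symm⟩⟩

end Theta

/-! ### The group of autoequivalences -/

namespace Theta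

variable {n : ℕ∞}

/-- The orientation reversal `op_δ` of `Θ_n`. -/
noncomputable def op (δ : ZTwoPow n) : Theta n ⥤ Theta n := (exists_op δ).choose

/-- The functor `op_δ` is induced by the orientation reversal of strict `n`-categories. -/
noncomputable def opIso (δ : ZTwoPow n) : op δ ⋙ thetaIncl n ≅ thetaIncl n ⋙ opNCat δ :=
  (exists_op δ).choose_spec.some

lemma eq_op_of_iso {δ : ZTwoPow n} {P : Theta n ⥤ Theta n}
    (e : P ⋙ thetaIncl n ≅ thetaIncl n ⋙ opNCat δ) : P = op δ :=
  eq_of_iso_comp_thetaIncl (e ≪≫ (opIso δ).symm)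

lemma op_comp_op (δ δ' : ZTwoPow n) : op δ ⋙ op δ' = op (δ + δ') :=
  eq_op_of_iso (Functor.associator _ _ _ ≪≫ Functor.isoWhiskerLeft _ (opIso δ') ≪≫
    (Functor.associator _ _ _).symm ≪≫ Functor.isoWhiskerRight (opIso δ) _ ≪≫
    Functor.associator _ _ _ ≪≫ Functor.isoWhiskerLeft _ (opNCatCompIso δ δ'))

lemma op_zero : op (0 : ZTwoPow n) = 𝟭 (Theta n) :=
  (eq_op_of_iso (Functor.leftUnitor _ ≪≫ (Functor.rightUnitor _).symm ≪≫
    Functor.isoWhiskerLeft _ opNCatZeroIso.symm)).symm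

lemma op_comp_self (δ : ZTwoPow n) : op δ ⋙ op δ = 𝟭 (Theta n) := by
  rw [op_comp_op, ZTwoPow.add_self, op_zero]

lemma isEquivalence_op (δ : ZTwoPow n) : (op δ).IsEquivalence :=
  (CategoryTheory.Equivalence.mk (op δ) (op δ) (eqToIso (op_comp_self δ).symm)
    (eqToIso (op_comp_self δ))).isEquivalence_functor

lemma op_injective {δ δ' : ZTwoPow n} (h : op δ = op δ') : δ = δ' :=
  eq_of_natTrans_op ((opIso δ).symm ≪≫ Functor.isoWhiskerRight (eqToIso h) _ ≪≫ opIso δ').hom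

lemma exists_eq_op (P : Theta n ⥤ Theta n) [P.Full] [P.Faithful] : ∃ δ, P = op δ := by
  obtain ⟨δ, ⟨e⟩⟩ := exists_comp_thetaIncl_iso P
  exact ⟨δ, eq_op_of_iso e⟩

lemma eq_eqToHom_of_isEquivalence {P Q : Theta n ⥤ Theta n} (hP : P.IsEquivalence)
    (hQ : Q.IsEquivalence) (γ : P ⟶ Q) : ∃ h : P = Q, γ = eqToHom h := by
  obtain ⟨δ, ⟨e⟩⟩ := exists_comp_thetaIncl_iso P
  obtain ⟨δ', ⟨e'⟩⟩ := exists_comp_thetaIncl_iso Q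
  exact natTrans_eq_eqToHom e e' γ

lemma autCat_exists_eq_eqToHom {F G : AutCat (Theta n)} (γ : F ⟶ G) :
    ∃ h : F = G, γ = eqToHom h := by
  obtain ⟨F, hF⟩ := F
  obtain ⟨G, hG⟩ := G
  obtain ⟨h, hγ⟩ := eq_eqToHom_of_isEquivalence hF hG γ.hom
  subst h
  exact ⟨rfl, ObjectProperty.hom_ext _ hγ⟩

instance {F G : AutCat (Theta n)} : Subsingleton (F ⟶ G) :=
  ⟨fun γ γ' => by
    obtain ⟨h, rfl⟩ := autCat_exists_eq_eqToHom γ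
    obtain ⟨_, rfl⟩ := autCat_exists_eq_eqToHom γ'
    rfl⟩

/-- The reversal `op_δ` as an object of the category of autoequivalences. -/
noncomputable def opAut (δ : ZTwoPow n) : AutCat (Theta n) := ⟨op δ, isEquivalence_op δ⟩

lemma opAut_tensor (δ δ' : ZTwoPow n) : opAut δ ⊗ opAut δ' = opAut (δ + δ') :=
  ObjectProperty.FullSubcategory.ext (op_comp_op δ δ')

lemma opAut_zero : 𝟙_ (AutCat (Theta n)) = opAut 0 :=
  ObjectProperty.FullSubcategory.ext op_zero.symm

variable (n) in
/-- The functor `δ ↦ op_δ`. -/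
noncomputable def opFunctor : DiscreteZTwoPow n ⥤ AutCat (Theta n) :=
  Discrete.functor fun a => opAut a.toAdd

lemma opFunctor_obj_injective {X Y : DiscreteZTwoPow n}
    (h : (opFunctor n).obj X = (opFunctor n).obj Y) : X = Y :=
  Discrete.ext (op_injective (congrArg ObjectProperty.FullSubcategory.obj h))

lemma exists_opFunctor_obj_eq (F : AutCat (Theta n)) : ∃ X, (opFunctor n).obj X = F := by
  have : F.obj.IsEquivalence := F.property
  obtain ⟨δ, h⟩ := exists_eq_op F.obj
  exact ⟨δ.toObj, ObjectProperty.FullSubcategory.ext h.symm⟩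

/-- The functor `δ ↦ op_δ` is monoidal; there is no coherence to check, since any two parallel
morphisms of autoequivalences are equal. -/
noncomputable def opFunctorCoreMonoidal : (opFunctor n).CoreMonoidal where
  εIso := eqToIso opAut_zero
  μIso X Y := eqToIso (opAut_tensor X.as.toAdd Y.as.toAdd)
  μIso_hom_natural_left _ _ := Subsingleton.elim _ _
  μIso_hom_natural_right _ _ := Subsingleton.elim _ _
  associativity _ _ _ := Subsingleton.elim _ _
  left_unitality _ := Subsingleton.elim _ _
  right_unitality _ := Subsingleton.elim _ _

lemma isMonoidalIsomorphism_opFunctor : IsMonoidalIsomorphism (opFunctor n) := by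
  refine ⟨⟨opFunctorCoreMonoidal.toMonoidal, autCat_exists_eq_eqToHom _,
    fun X Y => autCat_exists_eq_eqToHom _⟩, ?_⟩
  choose g hg using exists_opFunctor_obj_eq (n := n)
  let G : AutCat (Theta n) ⥤ DiscreteZTwoPow n :=
    { obj := g
      map := fun γ => eqToHom (congrArg g (autCat_exists_eq_eqToHom γ).1)
      map_id := fun _ => Subsingleton.elim _ _
      map_comp := fun _ _ => Subsingleton.elim _ _ }
  exact ⟨G, CategoryTheory.Functor.ext (fun X => opFunctor_obj_injective (hg _))
    (fun _ _ _ => Subsingleton.elim _ _),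
    CategoryTheory.Functor.ext hg (fun _ _ _ => Subsingleton.elim _ _)⟩

end Theta

theorem mainTheorem5 (n : ℕ∞) :
    -- `op_δ` induces a unique autoequivalence of `Θ_n`
    (∀ δ : ZTwoPow n, ∃! P : Theta n ⥤ Theta n,
      Nonempty (P ⋙ thetaIncl n ≅ thetaIncl n ⋙ opNCat δ)) ∧
    -- the resulting functor is an isomorphism of monoidal categories
    (∃ Φ : DiscreteZTwoPow n ⥤ AutCat (Theta n),
      (∀ δ : ZTwoPow n,
        Nonempty ((Φ.obj δ.toObj).obj ⋙ thetaIncl n ≅ thetaIncl n ⋙ opNCat δ)) ∧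
      IsMonoidalIsomorphism Φ) ∧
    -- every autoequivalence is some `op_δ`
    (∀ P : Theta n ⥤ Theta n, P.IsEquivalence →
      ∃! δ : ZTwoPow n, Nonempty (P ⋙ thetaIncl n ≅ thetaIncl n ⋙ opNCat δ)) ∧
    -- there are no non-identity natural transformations between autoequivalences
    (∀ P Q : Theta n ⥤ Theta n, P.IsEquivalence → Q.IsEquivalence → ∀ γ : P ⟶ Q,
      ∃ h : P = Q, γ = eqToHom h) := by
  refine ⟨fun δ => ⟨Theta.op δ, ⟨Theta.opIso δ⟩, fun P ⟨e⟩ => Theta.eq_op_of_iso e⟩,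
    ⟨Theta.opFunctor n, fun δ => ⟨Theta.opIso δ⟩, Theta.isMonoidalIsomorphism_opFunctor⟩,
    fun P hP => ?_, fun P Q hP hQ γ => Theta.eq_eqToHom_of_isEquivalence hP hQ γ⟩
  obtain ⟨δ, ⟨e⟩⟩ := Theta.exists_comp_thetaIncl_iso P
  exact ⟨δ, ⟨e⟩, fun δ' ⟨e'⟩ => Theta.eq_of_natTrans_op (e'.symm ≪≫ e).hom⟩
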